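/- Let $n\ge 1$ and let $\mathrm{C}\ell_{0,n}$ be the real Clifford algebra generated by $e_1,\dots,e_n$ with $e_ie_j+e_je_i=-2\delta_{ij}$, with basis $e_A=e_{i_1}\cdots e_{i_k}$, $A=\{i_1<\dots<i_k\}$, scalar part $\mathrm{Sc}\,\sum_A a_Ae_A=a_\emptyset$, and Clifford conjugation $a\mapsto\overline a$ (the linear anti-automorphism with $\overline{e_i}=-e_i$). Vectors $x\in\mathbb R^n$ are identified with $\sum_i x_ie_i$. Let $D=\sum_{i=1}^n e_i\partial_i$, and for a $\mathrm{C}\ell_{0,n}$-valued function $\alpha$ put $(\alpha C)w=\alpha\,\overline w$ and $(M^\alpha C)w=\overline w\,\alpha$. Let $\Omega\subset\mathbb R^n$ be a bounded domain (nonempty, open, connected) with Lipschitz boundary, with outward unit normal $\eta$ (defined a.e. on $\partial\Omega$) and surface measure $ds$; put $ds^*=\eta\,ds$. Let $C^1(\overline\Omega)$ be the set of $\mathrm{C}\ell_{0,n}$-valued functions that are $C^1$ in $\Omega$ and that extend continuously to $\overline\Omega$ together with their first derivatives. Let $u,v\in C^1(\overline\Omega)$ and $\alpha\in L^\infty(\Omega,\mathrm{C}\ell_{0,n})$.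 Then, with all integrals absolutely convergent, $$\mathrm{Sc}\int_{\partial\Omega}u\,ds_y^*\,v=\mathrm{Sc}\int_\Omega\Big(u\,[(D-\alpha C)v]-[(D-M^\alpha C)\overline u]\,\overline v\Big)\,dy,$$ $$\mathrm{Sc}\int_{\partial\Omega}u\,ds_y^*\,v=\mathrm{Sc}\int_\Omega\Big(u\,[(D-M^\alpha C)v]-[(D-\alpha C)\overline u]\,\overline v\Big)\,dy.$$ For $T\in\{\alpha C,\,M^\alpha C\}$ and $x\in\mathbb R^n$, a function $g\in L^1_{loc}(\Omega,\mathrm{C}\ell_{0,n})$ is called a fundamental solution of $D-T$ in $\Omega$ with pole $x$ if $(D-T)g=\delta_x$ in the sense of distributions on $\Omega$ (so the right-hand side is $0$ if $x\notin\Omega$). Let $x\in\mathbb R^n\setminus\partial\Omega$ and let $\Phi$ be a $\mathrm{C}\ell_{0,n}$-valued function (which may depend on $x$) such that $y\mapsto-\overline{\Phi(y-x)}$ is a fundamental solution of $D-M^\alpha C$ in $\Omega$ with pole $x$, such that $y\mapsto\Phi(y-x)$ is continuous on $\overline\Omega\setminus\{x\}$, and such that, if $x\in\Omega$, $$\lim_{\epsilon\to0^+}\int_{\partial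 B(x;\epsilon)}\Phi(y-x)\,\eta(y)\,w(y)\,ds_y=w(x)\qquad\text{for all }w\in C^1(\overline\Omega),$$ where $\eta$ is here the outward unit normal of the ball $B(x;\epsilon)$. Then, with absolutely convergent integrals, $$\mathrm{Sc}\int_{\partial\Omega}\Phi(y-x)\,\eta(y)\,v(y)\,ds_y-\mathrm{Sc}\int_\Omega\Phi(y-x)\,[(D-\alpha C)v](y)\,dy=\begin{cases}\mathrm{Sc}\,v(x),&x\in\Omega,\\0,&x\in\mathbb R^n\setminus\overline\Omega.\end{cases}$$ Analogously, if $\Psi$ satisfies the same conditions as $\Phi$ but with $-\overline{\Psi(y-x)}$ a fundamental solution of $D-\alpha C$ in $\Omega$ with pole $x$, then $$\mathrm{Sc}\int_{\partial\Omega}\Psi(y-x)\,\eta(y)\,v(y)\,ds_y-\mathrm{Sc}\int_\Omega\Psi(y-x)\,[(D-M^\alpha C)v](y)\,dy=\begin{cases}\mathrm{Sc}\,v(x),&x\in\Omega,\\0,&x\in\mathbb R^n\setminus\overline\Omega.\end{cases}$$ -/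

import Mathlib

open MeasureTheory Set Filter Topology
open scoped ContDiff

namespace Vekua

noncomputable section

/-- Euclidean space `ℝⁿ`. -/
abbrev E (n : ℕ) : Type := EuclideanSpace ℝ (Fin n)

/-- The negative definite quadratic form `x ↦ -|x|²` on `ℝⁿ`. -/
def negNormSq (n : ℕ) : QuadraticForm ℝ (E n) := -LinearMap.BilinMap.toQuadraticMap (innerₗ (E n))

theorem negNormSq_apply {n : ℕ} (x : E n) : negNormSq n x = -‖x‖ ^ 2 := by
  simp [negNormSq, LinearMap.BilinMap.toQuadraticMap_apply]

/-- The real Clifford algebra `Cl_{0,n}`. The Clifford conjugation is `star`. -/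
abbrev Cl (n : ℕ) : Type := CliffordAlgebra (negNormSq n)

/-- The embedding of vectors, `x = ∑ xᵢ eᵢ`. -/
def vec {n : ℕ} (x : E n) : Cl n := CliffordAlgebra.ι (negNormSq n) x

/-- The generator `eᵢ`. -/
def e {n : ℕ} (i : Fin n) : Cl n := vec (EuclideanSpace.single i 1)

theorem vec_mul_vec_add {n : ℕ} (x y : E n) :
    vec x * vec y + vec y * vec x = algebraMap ℝ (Cl n) (-2 * inner ℝ x y) := by
  unfold vec
  rw [CliffordAlgebra.ι_mul_ι_add_swap, QuadraticMap.polar]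
  simp only [negNormSq_apply, norm_add_sq_real]
  congr 1
  ring

/-- The relations `eᵢ eⱼ + eⱼ eᵢ = -2 δᵢⱼ`. -/
theorem e_mul_e_add {n : ℕ} (i j : Fin n) :
    (e i * e j + e j * e i : Cl n) = if i = j then -2 else 0 := by
  unfold e
  rw [vec_mul_vec_add]
  by_cases hij : i = j
  · simp [hij, map_ofNat]
  · have h0 : inner ℝ (EuclideanSpace.single i (1 : ℝ)) (EuclideanSpace.single j (1 : ℝ)) = 0 := by
      simp [EuclideanSpace.inner_single_left, hij]
    rw [h0]
    simp only [if_neg hij, mul_zero, map_zero]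

/-- The basis `e_A` of `Cl_{0,n}`, with `A` running through the subsets of `{1, …, n}`;
`basisCl_apply` below identifies `e_A` with the ordered product of the `eᵢ`, `i ∈ A`. -/
def basisCl (n : ℕ) : Module.Basis (Finset (Fin n)) ℝ (Cl n) :=
  (EuclideanSpace.basisFun (Fin n) ℝ).toBasis.ExteriorAlgebra.map
    (CliffordAlgebra.equivExterior (negNormSq n)).symm

theorem contractLeft_prod_eq_zero {n : ℕ} (d : Module.Dual ℝ (E n)) (l : List (Fin n))
    (h : ∀ j ∈ l, d (EuclideanSpace.single j 1) = 0) :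
    CliffordAlgebra.contractLeft d
      (l.map fun j => ExteriorAlgebra.ι ℝ (EuclideanSpace.single j (1 : ℝ))).prod = 0 := by
  induction l with
  | nil => exact CliffordAlgebra.contractLeft_one (0 : QuadraticForm ℝ (E n)) d
  | cons j l ih =>
    rw [List.map_cons, List.prod_cons]
    refine (CliffordAlgebra.contractLeft_ι_mul (Q := (0 : QuadraticForm ℝ (E n))) d _ _).trans ?_
    rw [h j (by simp), ih fun k hk => h k (by simp [hk])]
    simp

theorem equivExterior_prod {n : ℕ} (l : List (Fin n)) (hl : l.Nodup) :
    CliffordAlgebra.equivExterior (negNormSq n) (l.map e).prod =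
      (l.map fun j => ExteriorAlgebra.ι ℝ (EuclideanSpace.single j (1 : ℝ))).prod := by
  induction l with
  | nil => exact CliffordAlgebra.changeForm_one CliffordAlgebra.changeForm.associated_neg_proof
  | cons i l ih =>
    obtain ⟨hi, hl⟩ := List.nodup_cons.1 hl
    rw [List.map_cons, List.prod_cons, List.map_cons, List.prod_cons, ← ih hl]
    refine (CliffordAlgebra.changeForm_ι_mul
      CliffordAlgebra.changeForm.associated_neg_proof _ _).trans ?_
    have h0 := contractLeft_prod_eq_zero
      (QuadraticMap.associated (R := ℝ) (M := E n) (-negNormSq n) (EuclideanSpace.single i 1)) l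
      (by
        intro j hj
        have hij : i ≠ j := fun h => hi (h ▸ hj)
        have hB : QuadraticMap.associated (R := ℝ) (M := E n) (-negNormSq n) = innerₗ (E n) := by
          rw [negNormSq, neg_neg]
          exact QuadraticMap.associated_left_inverse ℝ (fun x y => real_inner_comm y x)
        rw [hB]
        simp [EuclideanSpace.inner_single_left, hij])
    rw [← ih hl] at h0
    refine (congrArg₂ (· - ·) rfl h0).trans ?_
    exact sub_zero _

theorem basisCl_apply {n : ℕ} (A : Finset (Fin n)) :
    basisCl n A = ((A.sort (· ≤ ·)).map e).prod := by
  rw [basisCl, Module.Basis.map_apply, LinearEquiv.symm_apply_eq,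
    equivExterior_prod _ (Finset.sort_nodup _ _), ExteriorAlgebra.basis_apply]
  change ExteriorAlgebra.ιMulti ℝ A.card _ = _
  rw [ExteriorAlgebra.ιMulti_apply]
  congr 1
  refine List.ext_getElem (by simp) fun k h1 h2 => ?_
  simp [Set.powersetCard.ofFinEmbEquiv_symm_apply, Finset.orderEmbOfFin_apply]

/-- The coordinates `(a_A)_A` of `a = ∑ a_A e_A`. -/
def coords (n : ℕ) : Cl n →ₗ[ℝ] EuclideanSpace ℝ (Finset (Fin n)) :=
  (WithLp.linearEquiv 2 ℝ (Finset (Fin n) → ℝ)).symm.toLinearMap ∘ₗ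
    (basisCl n).equivFun.toLinearMap

theorem coords_injective (n : ℕ) : Function.Injective (coords n) :=
  (WithLp.linearEquiv 2 ℝ (Finset (Fin n) → ℝ)).symm.injective.comp (basisCl n).equivFun.injective

/-- The norm `|a| = (∑ a_A²)^{1/2}` on `Cl_{0,n}`. -/
instance instNormedAddCommGroupCl (n : ℕ) : NormedAddCommGroup (Cl n) :=
  NormedAddCommGroup.induced (Cl n) (EuclideanSpace ℝ (Finset (Fin n))) (coords n)
    (coords_injective n)

instance instNormedSpaceCl (n : ℕ) : NormedSpace ℝ (Cl n) :=
  NormedSpace.induced ℝ (Cl n) (EuclideanSpace ℝ (Finset (Fin n))) (coords n)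

instance instFiniteCl (n : ℕ) : Module.Finite ℝ (Cl n) := Module.Finite.of_basis (basisCl n)

instance instCompleteSpaceCl (n : ℕ) : CompleteSpace (Cl n) := FiniteDimensional.complete ℝ (Cl n)

/-- The scalar part `Sc a = a_∅`. -/
def Sc {n : ℕ} (a : Cl n) : ℝ := (basisCl n).repr a ∅

/-- The Moisil-Teodorescu operator `D w = ∑ eᵢ ∂ᵢ w`. -/
def dirac {n : ℕ} (w : E n → Cl n) (y : E n) : Cl n :=
  ∑ i : Fin n, e i * fderiv ℝ w y (EuclideanSpace.single i 1)

/-- The operator `αC : w ↦ α w̄`. -/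
def mulConj {n : ℕ} (α w : E n → Cl n) : E n → Cl n := fun y => α y * star (w y)

/-- The operator `M^α C : w ↦ w̄ α`. -/
def conjMul {n : ℕ} (α w : E n → Cl n) : E n → Cl n := fun y => star (w y) * α y

/-- The operator `D - T`, for `T = αC` or `T = M^α C`. -/
def diracSub {n : ℕ} (T : (E n → Cl n) → E n → Cl n) (w : E n → Cl n) : E n → Cl n :=
  fun y => dirac w y - T w y

/-- A bounded domain (open connected nonempty set) of `ℝⁿ` with Lipschitz boundary: near each
boundary point it is, after an isometric linear change of coordinates, the region above the graph
of a Lipschitz function of `n - 1` variables. -/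
structure IsBoundedLipschitzDomain {n : ℕ} (Ω : Set (E n)) : Prop where
  isOpen : IsOpen Ω
  isConnected : IsConnected Ω
  isBounded : Bornology.IsBounded Ω
  exists_graph : ∀ p ∈ frontier Ω,
    ∃ (T : E n ≃ₗᵢ[ℝ] WithLp 2 (E (n - 1) × ℝ)) (γ : E (n - 1) → ℝ) (K : NNReal),
      LipschitzWith K γ ∧ ∀ᶠ y in 𝓝 p, (y ∈ Ω ↔ γ (T y).fst < (T y).snd)

/-- `w ∈ C¹(Ω̄)`: `w` is continuously differentiable in the open set `Ω`, and `w` and its first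
derivative extend continuously to the closure. -/
structure IsC1Closure {n : ℕ} (Ω : Set (E n)) (w : E n → Cl n) : Prop where
  contDiffOn : ContDiffOn ℝ 1 w Ω
  continuousOn : ContinuousOn w (closure Ω)
  exists_extension : ∃ w' : E n → E n →L[ℝ] Cl n,
    ContinuousOn w' (closure Ω) ∧ EqOn w' (fderiv ℝ w) Ω

/-- `ν` is the outward unit normal to `∂U` at `p`: near `p`, every open cone of aperture less than
a half-space around `-ν` lies in `U`, and the opposite cone lies outside `U`. -/
def IsOutwardNormal {n : ℕ} (U : Set (E n)) (p ν : E n) : Prop :=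
  ‖ν‖ = 1 ∧ ∀ δ > 0, ∀ᶠ y in 𝓝 p,
    (inner ℝ ν (y - p) < -δ * ‖y - p‖ → y ∈ U) ∧ (δ * ‖y - p‖ < inner ℝ ν (y - p) → y ∉ U)

theorem IsOutwardNormal.unique {n : ℕ} {U : Set (E n)} {p ν ν' : E n}
    (h : IsOutwardNormal U p ν) (h' : IsOutwardNormal U p ν') : ν = ν' := by
  by_contra hne
  have hw : 0 < ‖ν - ν'‖ := norm_pos_iff.2 (sub_ne_zero.2 hne)
  have hsq := @norm_sub_sq_real (E n) _ _ ν ν'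
  rw [h.1, h'.1] at hsq
  have h1 : inner ℝ ν (ν - ν') = ‖ν - ν'‖ ^ 2 / 2 := by
    rw [inner_sub_right, real_inner_self_eq_norm_sq, h.1]; linarith
  have h2 : inner ℝ ν' (ν - ν') = -(‖ν - ν'‖ ^ 2 / 2) := by
    rw [inner_sub_right, real_inner_self_eq_norm_sq, h'.1, real_inner_comm]; linarith
  have hδ : 0 < ‖ν - ν'‖ / 4 := by positivity
  have hev := (h.2 _ hδ).and (h'.2 _ hδ)
  have hc : Tendsto (fun t : ℝ => p + t • (ν - ν')) (𝓝[>] 0) (𝓝 p) := by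
    have : Continuous (fun t : ℝ => p + t • (ν - ν')) := by fun_prop
    simpa using (this.tendsto 0).mono_left nhdsWithin_le_nhds
  obtain ⟨t, ht, htpos⟩ := ((hc.eventually hev).and self_mem_nhdsWithin).exists
  have htpos : 0 < t := htpos
  simp only [add_sub_cancel_left, inner_smul_right, norm_smul, Real.norm_of_nonneg htpos.le,
    h1, h2] at ht
  have hpos : 0 < t * ‖ν - ν'‖ ^ 2 := by positivity
  exact ht.1.2 (by nlinarith) (ht.2.1 (by nlinarith))

open Classical in
/-- The outward unit normal `η(p)` to `∂U` (zero at the points where there is none). -/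
def outwardNormal {n : ℕ} (U : Set (E n)) (p : E n) : E n :=
  if h : ∃ ν, IsOutwardNormal U p ν then h.choose else 0

theorem IsOutwardNormal.outwardNormal_eq {n : ℕ} {U : Set (E n)} {p ν : E n}
    (h : IsOutwardNormal U p ν) : outwardNormal U p = ν := by
  have hex : ∃ ν, IsOutwardNormal U p ν := ⟨ν, h⟩
  rw [outwardNormal, dif_pos hex]
  exact hex.choose_spec.unique h

/-- The outward unit normal as a Clifford vector, so that `ds* = η ds`. -/
def η {n : ℕ} (U : Set (E n)) (p : E n) : Cl n := vec (outwardNormal U p)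

/-- The surface measure `ds` on `∂U`: the `(n-1)`-dimensional Hausdorff measure, normalized to agree
with Lebesgue measure on `ℝⁿ⁻¹`. -/
def surfaceMeasure {n : ℕ} (U : Set (E n)) : Measure (E n) :=
  (Measure.euclideanHausdorffMeasure (n - 1)).restrict (frontier U)

/-- `g` is a fundamental solution in `Ω` of `D - T` with pole `x`: `g` is locally integrable
in `Ω` and `(D - T) g = δₓ` in the sense of distributions on `Ω`. (If `x ∉ Ω`, then
`δₓ` vanishes on `Ω`.) -/
structure IsFundamentalSolution {n : ℕ} (Ω : Set (E n)) (T : (E n → Cl n) → E n → Cl n) (x : E n)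
    (g : E n → Cl n) : Prop where
  locallyIntegrableOn : LocallyIntegrableOn g Ω volume
  eq_delta : ∀ φ : E n → ℝ, ContDiff ℝ ∞ φ → HasCompactSupport φ → tsupport φ ⊆ Ω →
    -(∫ y in Ω, ∑ i : Fin n, fderiv ℝ φ y (EuclideanSpace.single i 1) • (e i * g y))
      - ∫ y in Ω, φ y • T g y = φ x • (1 : Cl n)

/-- The constraint on small spheres around `x`:
`∫_{∂B(x;ε)} Φ(y-x) η(y) w(y) ds_y → w(x)` as `ε → 0⁺`, for all `w ∈ C¹(Ω̄)`. -/
def SphereConstraint {n : ℕ} (Ω : Set (E n)) (Φ : E n → Cl n) (x : E n) : Prop :=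
  ∀ w : E n → Cl n, IsC1Closure Ω w →
    Tendsto (fun ε : ℝ => ∫ y, Φ (y - x) * η (Metric.ball x ε) y * w y
      ∂(surfaceMeasure (Metric.ball x ε))) (𝓝[>] 0) (𝓝 (w x))

end

end Vekua

open Vekua

/-! The integral formulas are the divergence theorem applied to the products `u eᵢ v`: since `u η v
= ∑ ηᵢ u eᵢ v`, the boundary integral equals the integral of `∑ (u eᵢ ∂ᵢv + ∂ᵢu eᵢ v)`. The scalar
part is a trace (`sc_mul_comm`) and is invariant under conjugation (`sc_star`). These two facts turn
the second sum into `-Sc ((D ū) v̄)`, and they make the terms with `α` cancel: `αC` and `M^α C` are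
adjoint to each other under `Sc`.

For the recovery formula, the distributional equation for `-Φ̄` is tested against `χₖ v`, where the
cutoffs `χₖ` exhaust `Ω`. Conjugating and taking scalar parts gives `Sc ∫ χₖ Φ (D - T')v + ∑ Sc ∫
∂ᵢχₖ Φ eᵢ v = -χₖ(x) Sc v(x)`, with `T'` the adjoint operator. As `k → ∞` the measures `∂ᵢχₖ dy`
tend weakly to `-ηᵢ ds`, which produces the boundary integral; the pole does not interfere, because
`∇χₖ` vanishes near an interior point for large `k`. This is `IsFundamentalSolution.recovery`.

The analytic core is therefore the weak convergence of `∇χₖ`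
(`IsCutoffSeq.tendsto_integral_fderiv_smul`). Since `χₖ` varies only in a boundary layer of width
comparable to `δ`, whose volume is `O(δ)`, and has slope at most `1/δ`, the gradients are bounded in
`L¹`. It then suffices to identify the limit on the uniformly dense class of compactly supported
`C¹` functions on the whole space, where it is the divergence theorem. Computing the limit in two
ways extends the divergence theorem to functions that are `C¹` only inside `Ω` and continuous up to
the boundary, with integrable derivative.

The divergence theorem on a Lipschitz domain is localized to graph charts
(`IsBoundedLipschitzDomain.divergenceHolds`). Above a graph (`graph_divergence`) a shear flattens
the boundary, and Fubini reduces the claim to one-dimensional integration in the vertical direction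
and to the vanishing of integrals of tangential derivatives. The surface integral is identified
through the area formula for Lipschitz graphs (`graphMeasure_eq_comap`), which rests on Rademacher's
theorem and on comparison with linear graphs on small pieces. -/

namespace Vekua

/-! ### The area formula for Lipschitz graphs. -/

open scoped NNReal ENNReal

/-- The space `ℝᵐ × ℝ` with its Euclidean norm, in which graphs of functions on `ℝᵐ` live. -/
abbrev W (m : ℕ) : Type := WithLp 2 (E m × ℝ)

/-- The parametrization `x ↦ (x, γ x)` of the graph of `γ`. -/
noncomputable def graphMap {m : ℕ} (γ : E m → ℝ) (x : E m) : W m := WithLp.toLp 2 (x, γ x)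

/-- The area element `√(1 + |∇γ|²)` of the graph of `γ`. -/
noncomputable def areaElement {m : ℕ} (γ : E m → ℝ) (x : E m) : ℝ := √(1 + ‖fderiv ℝ γ x‖ ^ 2)

/-- The linear parametrization of the graph of a linear form. -/
noncomputable def linGraph {m : ℕ} (l : E m →L[ℝ] ℝ) : E m →ₗ[ℝ] W m where
  toFun x := WithLp.toLp 2 (x, l x)
  map_add' x y := by simp [← WithLp.toLp_add]
  map_smul' c x := by simp [← WithLp.toLp_smul]

theorem linGraph_apply {m : ℕ} (l : E m →L[ℝ] ℝ) (x : E m) :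
    linGraph l x = WithLp.toLp 2 (x, l x) := rfl

theorem W_norm_sq {m : ℕ} (w : W m) : ‖w‖ ^ 2 = ‖w.fst‖ ^ 2 + w.snd ^ 2 := by
  rw [WithLp.prod_norm_sq_eq_of_L2, Real.norm_eq_abs, sq_abs]

theorem W_norm_fst_le {m : ℕ} (w : W m) : ‖w.fst‖ ≤ ‖w‖ := by
  have := W_norm_sq w
  exact abs_le_of_sq_le_sq' (by nlinarith [sq_nonneg w.snd]) (norm_nonneg _) |>.2

theorem W_abs_snd_le {m : ℕ} (w : W m) : |w.snd| ≤ ‖w‖ := by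
  have := W_norm_sq w
  exact abs_le_of_sq_le_sq (by nlinarith [sq_nonneg ‖w.fst‖]) (norm_nonneg _)

/-- If `v` represents `l`, the Gram operator of the parametrization is `x ↦ x + l(x) v`, a
transvection of determinant `1 + l(v) = 1 + ‖l‖²`. -/
theorem normDet_linGraph {m : ℕ} (l : E m →L[ℝ] ℝ) :
    (linGraph l).normDet = √(1 + ‖l‖ ^ 2) := by
  have h := (linGraph l).normDet_sq
  set v : E m := (InnerProductSpace.toDual ℝ (E m)).symm l with hv
  have hl : ∀ x, l x = inner ℝ v x := fun x => by simp [hv]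
  have h2 : (linGraph l).adjoint ∘ₗ linGraph l = LinearMap.transvection (l : E m →ₗ[ℝ] ℝ) v := by
    refine LinearMap.ext fun x => ext_inner_left ℝ fun y => ?_
    rw [LinearMap.comp_apply, LinearMap.adjoint_inner_right, LinearMap.transvection.apply]
    rw [WithLp.prod_inner_apply, inner_add_right, inner_smul_right]
    simp only [linGraph_apply]
    simp [hl, real_inner_comm]
  rw [h2, LinearMap.transvection.det] at h
  have h3 : (l : E m →ₗ[ℝ] ℝ) v = ‖l‖ ^ 2 := by
    change l v = _
    rw [hl, real_inner_self_eq_norm_sq, hv, LinearIsometryEquiv.norm_map]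
  rw [h3] at h
  rw [← show (linGraph l).normDet ^ 2 = 1 + ‖l‖ ^ 2 by simpa using h, Real.sqrt_sq]
  exact LinearMap.normDet_nonneg _

theorem continuous_graphMap {m : ℕ} {γ : E m → ℝ} (h : Continuous γ) : Continuous (graphMap γ) :=
  (WithLp.prod_continuous_toLp 2 _ _).comp (continuous_id.prodMk h)

theorem graphMap_injective {m : ℕ} (γ : E m → ℝ) : Function.Injective (graphMap γ) := fun x y h => by
  simpa [graphMap] using congrArg WithLp.fst h

theorem measurableEmbedding_graphMap {m : ℕ} {γ : E m → ℝ} (h : Continuous γ) :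
    MeasurableEmbedding (graphMap γ) :=
  (continuous_graphMap h).measurableEmbedding (graphMap_injective γ)

theorem euclideanHausdorffMeasure_image_le {X Y : Type*} [EMetricSpace X] [MeasurableSpace X]
    [BorelSpace X] [EMetricSpace Y] [MeasurableSpace Y] [BorelSpace Y] {K : ℝ≥0} {f : X → Y}
    {s : Set X} (h : LipschitzOnWith K f s) (d : ℕ) :
    (Measure.euclideanHausdorffMeasure d) (f '' s) ≤
      (K : ℝ≥0∞) ^ d * (Measure.euclideanHausdorffMeasure d) s := by
  simp_rw [Measure.euclideanHausdorffMeasure_def, Measure.smul_apply]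
  rw [mul_smul_comm]
  have := h.hausdorffMeasure_image_le (d := (d : ℝ)) (by positivity)
  rw [ENNReal.rpow_natCast] at this
  gcongr

theorem linGraph_sub_norm {m : ℕ} {γ : E m → ℝ} {l : E m →L[ℝ] ℝ} {A : Set (E m)} {ε : ℝ≥0}
    (h : ApproximatesLinearOn γ l A ε) {x y : E m} (hx : x ∈ A) (hy : y ∈ A) :
    ‖graphMap γ x - graphMap γ y - (linGraph l x - linGraph l y)‖ ≤ ε * ‖x - y‖ := by
  have h1 := h x hx y hy
  have : graphMap γ x - graphMap γ y - (linGraph l x - linGraph l y)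
      = WithLp.toLp 2 ((0 : E m), γ x - γ y - l (x - y)) := by
    simp only [graphMap, linGraph_apply, ← WithLp.toLp_sub]
    simp
  rw [this]
  refine le_trans (abs_le_of_sq_le_sq' ?_ (norm_nonneg _)).2 h1
  rw [W_norm_sq]
  simp

/-- Vertical projection between the graph and its linear approximation, in both directions. The
error in a difference is at most `ε` times the horizontal distance, which is at most the distance on
either graph. -/
theorem lipschitzOn_linGraph_graphMap {m : ℕ} {γ : E m → ℝ} {l : E m →L[ℝ] ℝ} {A : Set (E m)}
    {ε : ℝ≥0} (h : ApproximatesLinearOn γ l A ε) :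
    LipschitzOnWith (1 + ε) (fun w : W m => graphMap γ w.fst) (linGraph l '' A) ∧
    LipschitzOnWith (1 + ε) (fun w : W m => linGraph l w.fst) (graphMap γ '' A) := by
  constructor
  · refine LipschitzOnWith.of_dist_le_mul ?_
    rintro _ ⟨x, hx, rfl⟩ _ ⟨y, hy, rfl⟩
    have h1 := linGraph_sub_norm h hx hy
    have h2 := W_norm_fst_le (linGraph l x - linGraph l y)
    rw [dist_eq_norm, dist_eq_norm]
    have h3 : (linGraph l x - linGraph l y).fst = x - y := by simp [linGraph_apply]
    rw [h3] at h2
    have h4 := norm_le_norm_add_norm_sub' (graphMap γ x - graphMap γ y) (linGraph l x - linGraph l y)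
    have : (ε : ℝ) * ‖x - y‖ ≤ ε * ‖linGraph l x - linGraph l y‖ := by gcongr
    change ‖graphMap γ x - graphMap γ y‖ ≤ _
    push_cast
    linarith
  · refine LipschitzOnWith.of_dist_le_mul ?_
    rintro _ ⟨x, hx, rfl⟩ _ ⟨y, hy, rfl⟩
    have h1 := linGraph_sub_norm h hx hy
    have h2 := W_norm_fst_le (graphMap γ x - graphMap γ y)
    rw [dist_eq_norm, dist_eq_norm]
    have h3 : (graphMap γ x - graphMap γ y).fst = x - y := by simp [graphMap]
    rw [h3] at h2
    have h4 := norm_le_norm_add_norm_sub (graphMap γ x - graphMap γ y) (linGraph l x - linGraph l y)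
    have : (ε : ℝ) * ‖x - y‖ ≤ ε * ‖graphMap γ x - graphMap γ y‖ := by gcongr
    change ‖linGraph l x - linGraph l y‖ ≤ _
    push_cast
    linarith

theorem euclideanHausdorffMeasure_linGraph {m : ℕ} (l : E m →L[ℝ] ℝ) (A : Set (E m)) :
    (Measure.euclideanHausdorffMeasure m) (linGraph l '' A)
      = ENNReal.ofReal √(1 + ‖l‖ ^ 2) * volume A := by
  have := (linGraph l).euclideanHausdorffMeasure_image A
  rw [finrank_euclideanSpace_fin, normDet_linGraph,
    EuclideanSpace.euclideanHausdorffMeasure_eq_volume] at this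
  exact this

theorem euclideanHausdorffMeasure_graphMap_approx {m : ℕ} {γ : E m → ℝ} {l : E m →L[ℝ] ℝ}
    {A : Set (E m)} {ε : ℝ≥0} (h : ApproximatesLinearOn γ l A ε) :
    (Measure.euclideanHausdorffMeasure m) (graphMap γ '' A)
      ≤ (1 + ε : ℝ≥0) ^ m * (ENNReal.ofReal √(1 + ‖l‖ ^ 2) * volume A) ∧
    ENNReal.ofReal √(1 + ‖l‖ ^ 2) * volume A
      ≤ (1 + ε : ℝ≥0) ^ m * (Measure.euclideanHausdorffMeasure m) (graphMap γ '' A) := by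
  obtain ⟨h1, h2⟩ := lipschitzOn_linGraph_graphMap h
  rw [← euclideanHausdorffMeasure_linGraph]
  constructor
  · convert! euclideanHausdorffMeasure_image_le h1 m using 2
    rw [image_image]
    simp [linGraph_apply]
  · convert! euclideanHausdorffMeasure_image_le h2 m using 2
    rw [image_image]
    simp [graphMap]

/-- Changing the slope by `ε` changes the area element by a factor of at most `1 + ε`. -/
theorem sqrt_one_add_sq_le {a b ε : ℝ} (ha : 0 ≤ a) (hab : a ≤ b + ε) (hb : 0 ≤ b) (hε : 0 ≤ ε) :
    √(1 + a ^ 2) ≤ (1 + ε) * √(1 + b ^ 2) := by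
  have h1 : 1 ≤ √(1 + b ^ 2) := Real.one_le_sqrt.2 (by nlinarith)
  have h2 := Real.sq_sqrt (show 0 ≤ 1 + b ^ 2 by positivity)
  have h3 : b ≤ √(1 + b ^ 2) := Real.le_sqrt_of_sq_le (by linarith)
  refine Real.sqrt_le_iff.2 ⟨by positivity, ?_⟩
  rw [mul_pow, h2]
  nlinarith [mul_nonneg hε hb, sq_nonneg (ε * b), mul_nonneg hε (sq_nonneg (b - 1))]

theorem measure_le_of_iUnion {X : Type*} [MeasurableSpace X] {ν μ : Measure X} {S : ℕ → Set X}
    (hS : ∀ i, MeasurableSet (S i)) (h : ∀ i B, MeasurableSet B → B ⊆ S i → ν B ≤ μ B)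
    {B : Set X} (hB : MeasurableSet B) (hBS : B ⊆ ⋃ i, S i) : ν B ≤ μ B := by
  have hd := disjoint_disjointed S
  have hU : B = ⋃ i, B ∩ disjointed S i := by
    rw [← inter_iUnion, iUnion_disjointed, inter_eq_self_of_subset_left hBS]
  have hm : ∀ i, MeasurableSet (B ∩ disjointed S i) := fun i =>
    hB.inter (MeasurableSet.disjointed hS i)
  have hd' : Pairwise (Function.onFun Disjoint fun i => B ∩ disjointed S i) := fun i j hij =>
    (hd hij).mono inter_subset_right inter_subset_right
  rw [hU, measure_iUnion hd' hm, measure_iUnion hd' hm]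
  exact ENNReal.tsum_le_tsum fun i =>
    h i _ (hm i) (inter_subset_right.trans (disjointed_subset S i))

theorem areaElement_pos {m : ℕ} (γ : E m → ℝ) (x : E m) : 0 < areaElement γ x :=
  Real.sqrt_pos.2 (by positivity)

theorem measurable_areaElement {m : ℕ} (γ : E m → ℝ) : Measurable (areaElement γ) := by
  have := measurable_fderiv ℝ γ
  unfold areaElement
  fun_prop

/-- The measure on `ℝᵐ` with density the area element of the graph of `γ`. -/
noncomputable def graphMeasure {m : ℕ} (γ : E m → ℝ) : Measure (E m) :=
  volume.withDensity fun x => ENNReal.ofReal (areaElement γ x)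

/-- Of the `m + 1` factors, `m` come from comparing Hausdorff measures under the projections between
the graph and its linear approximation, and one from replacing the slope of `l` by that of `γ` in
the area element. -/
theorem graphMeasure_piece {m : ℕ} {γ : E m → ℝ} {l : E m →L[ℝ] ℝ} {A : Set (E m)} {ε : ℝ≥0}
    (h : ApproximatesLinearOn γ l A ε) (hA : MeasurableSet A)
    (hl : ∀ x ∈ A, ‖fderiv ℝ γ x - l‖ ≤ ε) :
    (Measure.euclideanHausdorffMeasure m) (graphMap γ '' A)
      ≤ (1 + ε : ℝ≥0) ^ (m + 1) * graphMeasure γ A ∧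
    graphMeasure γ A ≤
      (1 + ε : ℝ≥0) ^ (m + 1) * (Measure.euclideanHausdorffMeasure m) (graphMap γ '' A) := by
  obtain ⟨h1, h2⟩ := euclideanHausdorffMeasure_graphMap_approx h
  have hJ : graphMeasure γ A = ∫⁻ x in A, ENNReal.ofReal (areaElement γ x) :=
    withDensity_apply _ hA
  have key : ∀ a b : ℝ, 0 ≤ a → 0 ≤ b → a ≤ b + ε →
      ENNReal.ofReal √(1 + a ^ 2) ≤ (1 + ε : ℝ≥0) * ENNReal.ofReal √(1 + b ^ 2) := by
    intro a b ha hb hab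
    rw [← ENNReal.ofReal_coe_nnreal, ← ENNReal.ofReal_mul (by positivity)]
    exact ENNReal.ofReal_le_ofReal (by simpa using sqrt_one_add_sq_le ha hab hb ε.2)
  have k1 : ENNReal.ofReal √(1 + ‖l‖ ^ 2) * volume A ≤ (1 + ε : ℝ≥0) * graphMeasure γ A := by
    rw [hJ, ← lintegral_const_mul _ (measurable_areaElement γ).ennreal_ofReal,
      ← setLIntegral_const]
    refine setLIntegral_mono (((measurable_areaElement γ).ennreal_ofReal).const_mul _)
      fun x hx => key _ _ (norm_nonneg _) (norm_nonneg _) ?_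
    have := norm_le_norm_add_norm_sub (fderiv ℝ γ x) l
    linarith [hl x hx]
  have k2 : graphMeasure γ A ≤ (1 + ε : ℝ≥0) * (ENNReal.ofReal √(1 + ‖l‖ ^ 2) * volume A) := by
    rw [hJ, ← mul_assoc, ← setLIntegral_const]
    refine setLIntegral_mono measurable_const
      fun x hx => key _ _ (norm_nonneg _) (norm_nonneg _) ?_
    have := norm_le_norm_add_norm_sub' (fderiv ℝ γ x) l
    linarith [hl x hx]
  constructor
  · calc _ ≤ _ := h1
      _ ≤ (1 + ε : ℝ≥0) ^ m * ((1 + ε : ℝ≥0) * graphMeasure γ A) := by gcongr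
      _ = _ := by rw [← mul_assoc, pow_succ]
  · calc _ ≤ _ := k2
      _ ≤ (1 + ε : ℝ≥0) * ((1 + ε : ℝ≥0) ^ m *
          (Measure.euclideanHausdorffMeasure m) (graphMap γ '' A)) := by gcongr
      _ = _ := by rw [← mul_assoc, pow_succ']

theorem lipschitzWith_graphMap {m : ℕ} {γ : E m → ℝ} {K : ℝ≥0} (h : LipschitzWith K γ) :
    LipschitzWith (1 + K) (graphMap γ) := by
  have h0 : ApproximatesLinearOn γ (0 : E m →L[ℝ] ℝ) univ K := by
    intro x _ y _
    simpa [Real.dist_eq, dist_eq_norm x y] using h.dist_le_mul x y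
  refine LipschitzWith.of_dist_le_mul fun x y => ?_
  have h1 := linGraph_sub_norm h0 (mem_univ x) (mem_univ y)
  have h4 := norm_le_norm_add_norm_sub' (graphMap γ x - graphMap γ y)
    (linGraph 0 x - linGraph 0 y)
  have h5 : ‖linGraph (0 : E m →L[ℝ] ℝ) x - linGraph 0 y‖ ≤ ‖x - y‖ := by
    refine (abs_le_of_sq_le_sq' ?_ (norm_nonneg _)).2
    rw [W_norm_sq]
    simp [linGraph_apply]
  rw [dist_eq_norm, dist_eq_norm]
  push_cast
  linarith

theorem comap_graphMap_apply {m : ℕ} {γ : E m → ℝ} (h : Continuous γ) (A : Set (E m)) :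
    ((Measure.euclideanHausdorffMeasure m).comap (graphMap γ)) A =
      (Measure.euclideanHausdorffMeasure m) (graphMap γ '' A) :=
  (measurableEmbedding_graphMap h).comap_apply _ _

theorem graphMap_image_null {m : ℕ} {γ : E m → ℝ} {K : ℝ≥0} (h : LipschitzWith K γ)
    {A : Set (E m)} (hA : volume A = 0) :
    (Measure.euclideanHausdorffMeasure m) (graphMap γ '' A) = 0 := by
  refine le_antisymm ?_ bot_le
  refine (euclideanHausdorffMeasure_image_le
    (lipschitzWith_graphMap h).lipschitzOnWith m).trans ?_
  rw [EuclideanSpace.euclideanHausdorffMeasure_eq_volume, hA]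
  simp

/-- Countably many pieces suffice. A dense sequence of linear forms cuts the differentiability set
into parts on which the derivative varies by less than `ε`, and each part is subdivided so that `γ`
is `ε`-approximated by a linear form. -/
theorem measure_le_of_forall_approx {m : ℕ} {γ : E m → ℝ} {ν ρ : Measure (E m)} {ε : ℝ≥0}
    (hε : ε ≠ 0) (hν : ν {x | DifferentiableAt ℝ γ x}ᶜ = 0)
    (h : ∀ (l : E m →L[ℝ] ℝ) (A : Set (E m)), MeasurableSet A → ApproximatesLinearOn γ l A ε →
      (∀ x ∈ A, ‖fderiv ℝ γ x - l‖ ≤ ε) → ν A ≤ ρ A) {B : Set (E m)} (hB : MeasurableSet B) :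
    ν B ≤ ρ B := by
  set D : Set (E m) := {x | DifferentiableAt ℝ γ x} with hD
  have hDm : MeasurableSet D := measurableSet_of_differentiableAt ℝ γ
  suffices hs : ν (B ∩ D) ≤ ρ (B ∩ D) by
    calc ν B ≤ ν (B ∩ D) + ν Dᶜ := by
          refine (measure_mono (fun x hx => ?_)).trans (measure_union_le _ _)
          by_cases hxD : x ∈ D
          · exact Or.inl ⟨hx, hxD⟩
          · exact Or.inr hxD
      _ = ν (B ∩ D) := by rw [hν, add_zero]
      _ ≤ ρ (B ∩ D) := hs
      _ ≤ ρ B := measure_mono inter_subset_left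
  obtain ⟨d, hd⟩ := TopologicalSpace.exists_dense_seq (E m →L[ℝ] ℝ)
  set s : ℕ → Set (E m) := fun k => D ∩ {x | ‖fderiv ℝ γ x - d k‖ < ε / 2} with hs
  have hεp : (0 : ℝ) < ε := lt_of_le_of_ne ε.2 (by exact_mod_cast hε.symm)
  have hsm : ∀ k, MeasurableSet (s k) := fun k => by
    refine hDm.inter (measurableSet_lt ?_ measurable_const)
    have := measurable_fderiv ℝ γ
    fun_prop
  refine measure_le_of_iUnion hsm (fun k B' hB' hBk => ?_) (hB.inter hDm) ?_
  · obtain ⟨t, A, -, htm, hcov, happ, hA⟩ := exists_partition_approximatesLinearOn_of_hasFDerivWithinAt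
      γ (s k) (fderiv ℝ γ) (fun x hx => hx.1.hasFDerivAt.hasFDerivWithinAt) (fun _ => ε)
      (fun _ => hε)
    refine measure_le_of_iUnion (fun i => (hsm k).inter (htm i)) (fun i B'' hB'' hsub => ?_) hB' ?_
    · refine h (A i) B'' hB'' ((happ i).mono_set hsub) fun x hx => ?_
      -- The approximating form is itself the derivative at a point of the same part, hence within
      -- `ε/2 + ε/2` of the derivative at `x`.
      obtain ⟨y, hy, hAy⟩ := hA ⟨x, (hsub hx).1⟩ i
      have h1 : ‖fderiv ℝ γ x - d k‖ < ε / 2 := (hsub hx).1.2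
      have h2 : ‖fderiv ℝ γ y - d k‖ < ε / 2 := hy.2
      rw [hAy]
      have := norm_sub_le_norm_sub_add_norm_sub (fderiv ℝ γ x) (d k) (fderiv ℝ γ y)
      rw [norm_sub_rev (d k)] at this
      linarith
    · rw [← inter_iUnion]
      exact subset_inter hBk (hBk.trans hcov)
  · rintro x ⟨-, hx⟩
    obtain ⟨_, hk, k, rfl⟩ := Metric.dense_iff.1 hd (fderiv ℝ γ x) (ε / 2) (by positivity)
    refine mem_iUnion.2 ⟨k, hx, ?_⟩
    rw [Metric.mem_ball, dist_comm, dist_eq_norm] at hk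
    exact hk

/-- Both measures ignore the points of non-differentiability, a null set by Rademacher's theorem,
and on small pieces they agree up to the factor `(1 + ε)^(m+1)`. Letting `ε → 0` gives both
inequalities. -/
theorem graphMeasure_eq_comap {m : ℕ} {γ : E m → ℝ} {K : ℝ≥0} (h : LipschitzWith K γ) :
    graphMeasure γ = (Measure.euclideanHausdorffMeasure m).comap (graphMap γ) := by
  have hae : volume {x | DifferentiableAt ℝ γ x}ᶜ = 0 := h.ae_differentiableAt
  have hlim : ∀ a b : ℝ≥0∞, (∀ ε : ℝ≥0, ε ≠ 0 → a ≤ (1 + ε : ℝ≥0) ^ (m + 1) * b) → a ≤ b := by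
    intro a b hab
    have ht : Tendsto (fun ε : ℝ≥0 => ((1 + ε : ℝ≥0) : ℝ≥0∞) ^ (m + 1) * b) (𝓝[≠] 0)
        (𝓝 (((1 + 0 : ℝ≥0) : ℝ≥0∞) ^ (m + 1) * b)) := by
      refine ENNReal.Tendsto.mul_const ?_ (Or.inl (by simp))
      have : Continuous fun ε : ℝ≥0 => (((1 + ε) ^ (m + 1) : ℝ≥0) : ℝ≥0∞) := by fun_prop
      have h2 := this.tendsto 0
      push_cast at h2 ⊢
      exact h2.mono_left nhdsWithin_le_nhds
    refine (ge_of_tendsto ht ?_).trans (by simp)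
    filter_upwards [self_mem_nhdsWithin] with ε hε using hab ε hε
  ext B hB
  refine le_antisymm (hlim _ _ fun ε hε => ?_) (hlim _ _ fun ε hε => ?_)
  · refine measure_le_of_forall_approx (γ := γ)
      (ρ := ((1 + ε : ℝ≥0) : ℝ≥0∞) ^ (m + 1) • (Measure.euclideanHausdorffMeasure m).comap _) hε
      (withDensity_absolutelyContinuous _ _ hae) (fun l A hA h1 h2 => ?_) hB
    rw [Measure.smul_apply, comap_graphMap_apply h.continuous]
    exact (graphMeasure_piece h1 hA h2).2
  · refine measure_le_of_forall_approx (γ := γ)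
      (ρ := ((1 + ε : ℝ≥0) : ℝ≥0∞) ^ (m + 1) • graphMeasure γ) hε
      ?_ (fun l A hA h1 h2 => ?_) hB
    · rw [comap_graphMap_apply h.continuous, graphMap_image_null h hae]
    · rw [Measure.smul_apply, comap_graphMap_apply h.continuous]
      exact (graphMeasure_piece h1 hA h2).1

/-- The area formula for the graph of a Lipschitz function. -/
theorem map_graphMap_graphMeasure {m : ℕ} {γ : E m → ℝ} {K : ℝ≥0} (h : LipschitzWith K γ) :
    (graphMeasure γ).map (graphMap γ) =
      (Measure.euclideanHausdorffMeasure m).restrict (range (graphMap γ)) := by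
  rw [graphMeasure_eq_comap h, (measurableEmbedding_graphMap h.continuous).map_comap]

end Vekua

/-! ### The divergence theorem above a Lipschitz graph. -/

namespace Vekua

open scoped NNReal ENNReal

theorem W_ext {m : ℕ} {v w : W m} (h1 : v.fst = w.fst) (h2 : v.snd = w.snd) : v = w :=
  WithLp.ofLp_injective 2 (Prod.ext h1 h2)

/-- The homeomorphism `(x, s) ↦ (x, γ x + s)`. -/
noncomputable def shear {m : ℕ} (γ : E m → ℝ) (h : Continuous γ) : (E m × ℝ) ≃ₜ W m where
  toFun p := WithLp.toLp 2 (p.1, γ p.1 + p.2)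
  invFun w := (w.fst, w.snd - γ w.fst)
  left_inv p := by simp
  right_inv w := W_ext (by simp) (by simp)
  continuous_toFun := (WithLp.prod_continuous_toLp 2 _ _).comp (by fun_prop)
  continuous_invFun := by fun_prop

theorem shear_apply {m : ℕ} {γ : E m → ℝ} (h : Continuous γ) (p : E m × ℝ) :
    shear γ h p = WithLp.toLp 2 (p.1, γ p.1 + p.2) := rfl

/-- On each vertical line the shear is a translation. -/
theorem measurePreserving_shear {m : ℕ} {γ : E m → ℝ} (h : Continuous γ) :
    MeasurePreserving (shear γ h) (volume.prod volume) volume := by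
  have h1 : MeasurePreserving (fun p : E m × ℝ => (p.1, γ p.1 + p.2)) (volume.prod volume)
      (volume.prod volume) := by
    refine (MeasurePreserving.id _).skew_product (g := fun x s => γ x + s) ?_ ?_
    · have := h.measurable
      fun_prop
    · exact ae_of_all _ fun x => (measurePreserving_add_left volume (γ x)).map_eq
  exact (WithLp.volume_preserving_toLp (E m) ℝ).comp h1

/-- The vector `(∇γ, -1) / √(1 + |∇γ|²)`, the outward unit normal of `{γ x < t}`. -/
noncomputable def graphNormal {m : ℕ} (γ : E m → ℝ) (x : E m) : W m :=
  (areaElement γ x)⁻¹ • WithLp.toLp 2 ((InnerProductSpace.toDual ℝ (E m)).symm (fderiv ℝ γ x), (-1 : ℝ))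

/-- The area element cancels the normalization of the normal, so in the parameter `x` the vector
measure `η ds` is `(∇γ, -1) dx`. -/
theorem inner_graphNormal {m : ℕ} (γ : E m → ℝ) (x : E m) (b : W m) :
    areaElement γ x * inner ℝ (graphNormal γ x) b = fderiv ℝ γ x b.fst - b.snd := by
  rw [graphNormal, real_inner_smul_left, mul_inv_cancel_left₀ (areaElement_pos γ x).ne',
    WithLp.prod_inner_apply]
  simp [sub_eq_add_neg]

theorem norm_graphNormal {m : ℕ} (γ : E m → ℝ) (x : E m) : ‖graphNormal γ x‖ = 1 := by
  have h := areaElement_pos γ x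
  rw [graphNormal, norm_smul, norm_inv, Real.norm_of_nonneg h.le, inv_mul_eq_one₀ h.ne',
    areaElement, Real.sqrt_eq_iff_mul_self_eq (by positivity) (norm_nonneg _), ← sq, W_norm_sq]
  simp [add_comm]

theorem measurable_graphNormal {m : ℕ} (γ : E m → ℝ) : Measurable (graphNormal γ) := by
  have h1 := measurable_fderiv ℝ γ
  have h2 := measurable_areaElement γ
  have h3 : Measurable fun x => (InnerProductSpace.toDual ℝ (E m)).symm (fderiv ℝ γ x) :=
    (InnerProductSpace.toDual ℝ (E m)).symm.continuous.measurable.comp h1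
  refine h2.inv.smul ?_
  exact (WithLp.prod_continuous_toLp 2 (E m) ℝ).measurable.comp (h3.prodMk measurable_const)

theorem integral_lineDeriv_eq_zero {m : ℕ} {g : E m → ℝ} {C : ℝ≥0} (hg : LipschitzWith C g)
    (hc : HasCompactSupport g) (v : E m) : ∫ x, lineDeriv ℝ g x v = 0 := by
  -- Integration by parts against the constant `1`; the direction `-v` compensates the sign that it
  -- introduces.
  have h := LipschitzWith.integral_lineDeriv_mul_eq (μ := (volume : Measure (E m)))
    (LipschitzWith.const (1 : ℝ)) hg hc (-v)
  have h0 : ∀ x, lineDeriv ℝ (fun _ : E m => (1 : ℝ)) x (-v) = 0 := fun x => by simp [lineDeriv]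
  simpa [h0] using h.symm

section
variable {m : ℕ} {γ : E m → ℝ} {K : ℝ≥0} {f : W m → ℝ}

theorem hasFDerivAt_slice (hf : ContDiff ℝ 1 f) {x : E m} (hx : DifferentiableAt ℝ γ x) (s : ℝ)
    (b : E m) :
    lineDeriv ℝ (fun x => f (WithLp.toLp 2 (x, γ x + s))) x b =
      fderiv ℝ f (WithLp.toLp 2 (x, γ x + s)) (WithLp.toLp 2 (b, fderiv ℝ γ x b)) := by
  have h1 : HasFDerivAt (fun x => (x, γ x + s))
      ((ContinuousLinearMap.id ℝ (E m)).prod (fderiv ℝ γ x)) x :=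
    (hasFDerivAt_id x).prodMk (hx.hasFDerivAt.add_const s)
  have h2 := ((WithLp.prodContinuousLinearEquiv 2 ℝ (E m) ℝ).symm.hasFDerivAt
    (x := (x, γ x + s))).comp x h1
  have h3 := ((hf.differentiable one_ne_zero _).hasFDerivAt (x := WithLp.toLp 2 (x, γ x + s))).comp x h2
  exact (h3.hasLineDerivAt b).lineDeriv

/-- By Rademacher and the chain rule the integrand is almost everywhere the derivative along `b` of
the compactly supported Lipschitz function `x ↦ f (x, γ x + s)`: the tangential contribution
vanishes on every translate of the graph. -/
theorem integral_slice (hγ : LipschitzWith K γ) (hf : ContDiff ℝ 1 f) (hc : HasCompactSupport f)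
    (s : ℝ) (b : E m) :
    ∫ x, fderiv ℝ f (WithLp.toLp 2 (x, γ x + s)) (WithLp.toLp 2 (b, fderiv ℝ γ x b)) = 0 := by
  obtain ⟨C, hC⟩ := hf.lipschitzWith_of_hasCompactSupport hc one_ne_zero
  have hL : LipschitzWith (C * (1 + K)) fun x => f (WithLp.toLp 2 (x, γ x + s)) := by
    refine hC.comp (LipschitzWith.of_dist_le_mul fun x y => ?_)
    have := (lipschitzWith_graphMap hγ).dist_le_mul x y
    rw [dist_eq_norm] at this ⊢
    convert! this using 2
    · exact W_ext (by simp [graphMap]) (by simp [graphMap])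
  have hcs : HasCompactSupport fun x => f (WithLp.toLp 2 (x, γ x + s)) := by
    have h1 := hc.comp_homeomorph (shear γ hγ.continuous)
    have h2 : IsCompact (Prod.fst '' tsupport (f ∘ shear γ hγ.continuous)) := h1.image continuous_fst
    refine HasCompactSupport.intro h2 fun x hx => ?_
    by_contra h0
    exact hx ⟨(x, s), subset_tsupport _ h0, rfl⟩
  rw [← integral_lineDeriv_eq_zero hL hcs b]
  refine integral_congr_ae ?_
  filter_upwards [hγ.ae_differentiableAt] with x hx
  exact (hasFDerivAt_slice hf hx s b).symm

theorem integral_vertical (hγ : Continuous γ) (hf : ContDiff ℝ 1 f) (hc : HasCompactSupport f)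
    (x : E m) :
    ∫ s in Ioi (0 : ℝ), fderiv ℝ f (WithLp.toLp 2 (x, γ x + s)) (WithLp.toLp 2 (0, 1)) =
      - f (graphMap γ x) := by
  have hd : ∀ s : ℝ, HasDerivAt (fun s => f (WithLp.toLp 2 (x, γ x + s)))
      (fderiv ℝ f (WithLp.toLp 2 (x, γ x + s)) (WithLp.toLp 2 (0, 1))) s := by
    intro s
    have h1 : HasDerivAt (fun s : ℝ => (x, γ x + s)) ((0 : E m), (1 : ℝ)) s :=
      (hasDerivAt_const s x).prodMk ((hasDerivAt_id s).const_add _)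
    have h2 := ((WithLp.prodContinuousLinearEquiv 2 ℝ (E m) ℝ).symm.hasFDerivAt
      (x := (x, γ x + s))).comp_hasDerivAt s h1
    exact ((hf.differentiable one_ne_zero _).hasFDerivAt
      (x := WithLp.toLp 2 (x, γ x + s))).comp_hasDerivAt s h2
  have hcs : HasCompactSupport fun s => f (WithLp.toLp 2 (x, γ x + s)) := by
    have h1 := hc.comp_homeomorph (shear γ hγ)
    have h2 : IsCompact (Prod.snd '' tsupport (f ∘ shear γ hγ)) := h1.image continuous_snd
    refine HasCompactSupport.intro h2 fun s hx => ?_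
    by_contra h0
    exact hx ⟨(x, s), subset_tsupport _ h0, rfl⟩
  have hcont : Continuous fun s : ℝ => (WithLp.toLp 2 (x, γ x + s) : W m) :=
    (WithLp.prod_continuous_toLp 2 _ _).comp (by fun_prop)
  have hC1 : ContDiff ℝ 1 fun s => f (WithLp.toLp 2 (x, γ x + s)) := by
    rw [contDiff_one_iff_deriv]
    refine ⟨fun s => (hd s).differentiableAt, ?_⟩
    rw [show deriv (fun s => f (WithLp.toLp 2 (x, γ x + s))) = _ from funext fun s => (hd s).deriv]
    exact (((hf.continuous_fderiv one_ne_zero).comp hcont).clm_apply continuous_const)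
  have := hcs.integral_Ioi_deriv_eq hC1 0
  rw [show deriv (fun s => f (WithLp.toLp 2 (x, γ x + s))) = _ from funext fun s => (hd s).deriv] at this
  rw [this]
  simp [graphMap]

/-- The direction `b` splits into the tangent vector `(b.fst, ∇γ · b.fst)` minus the multiple `∇γ ·
b.fst - b.snd` of the vertical vector. The first part integrates to zero over each translated graph,
and the second is integrated along vertical lines, where it leaves the boundary value. -/
theorem graph_divergence_aux (hγ : LipschitzWith K γ) (hf : ContDiff ℝ 1 f)
    (hc : HasCompactSupport f) (b : W m) :
    ∫ w in {w : W m | γ w.fst < w.snd}, fderiv ℝ f w b =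
      ∫ x, (fderiv ℝ γ x b.fst - b.snd) * f (graphMap γ x) := by
  set S := shear γ hγ.continuous with hS
  have hpre : S ⁻¹' {w : W m | γ w.fst < w.snd} = univ ×ˢ Ioi (0 : ℝ) := by
    ext p
    simp [hS, shear_apply]
  rw [← (measurePreserving_shear hγ.continuous).setIntegral_preimage_emb
    S.measurableEmbedding, ← hS, hpre]
  have hd : Continuous (fderiv ℝ f) := hf.continuous_fderiv one_ne_zero
  have hdc : HasCompactSupport (fderiv ℝ f) := hc.fderiv (𝕜 := ℝ)
  have hG : ∀ c : W m, Integrable (fun p : E m × ℝ => fderiv ℝ f (S p) c)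
      (volume.prod (volume.restrict (Ioi (0 : ℝ)))) := by
    intro c
    have h0 : Continuous fun p => fderiv ℝ f (S p) c :=
      (hd.comp S.continuous).clm_apply continuous_const
    have h1 : HasCompactSupport fun p => fderiv ℝ f (S p) c :=
      (hdc.comp_homeomorph S).comp_left (g := fun L : W m →L[ℝ] ℝ => L c) rfl
    have h2 := (h0.integrable_of_hasCompactSupport h1 (μ := volume.prod volume))
    have h3 := h2.restrict (s := univ ×ˢ Ioi (0 : ℝ))
    rwa [← Measure.prod_restrict, Measure.restrict_univ] at h3
  have hmγ : Measurable fun x => fderiv ℝ γ x b.fst := by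
    have := measurable_fderiv ℝ γ
    fun_prop
  have hb : ∀ x, ‖fderiv ℝ γ x b.fst - b.snd‖ ≤ K * ‖b.fst‖ + |b.snd| := by
    intro x
    refine (norm_sub_le _ _).trans ?_
    rw [Real.norm_eq_abs b.snd]
    gcongr
    exact (ContinuousLinearMap.le_opNorm _ _).trans (by gcongr; exact norm_fderiv_le_of_lipschitz ℝ hγ)
  have hH : Integrable (fun p : E m × ℝ => (fderiv ℝ γ p.1 b.fst - b.snd) *
      fderiv ℝ f (S p) (WithLp.toLp 2 (0, 1))) (volume.prod (volume.restrict (Ioi (0 : ℝ)))) := by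
    refine (hG _).bdd_mul (c := K * ‖b.fst‖ + |b.snd|) ?_ (ae_of_all _ fun p => hb p.1)
    exact ((hmγ.comp measurable_fst).sub_const _).aestronglyMeasurable
  rw [← Measure.prod_restrict, Measure.restrict_univ]
  have hsum : ∀ p : E m × ℝ, fderiv ℝ f (S p) b =
      fderiv ℝ f (S p) (WithLp.toLp 2 (b.fst, fderiv ℝ γ p.1 b.fst)) -
        (fderiv ℝ γ p.1 b.fst - b.snd) * fderiv ℝ f (S p) (WithLp.toLp 2 (0, 1)) := by
    intro p
    rw [← smul_eq_mul, ← map_smul, ← map_sub]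
    congr 1
    exact W_ext (by simp) (by simp)
  have hG' : Integrable (fun p : E m × ℝ =>
      fderiv ℝ f (S p) (WithLp.toLp 2 (b.fst, fderiv ℝ γ p.1 b.fst)))
      (volume.prod (volume.restrict (Ioi (0 : ℝ)))) := by
    refine ((hG b).add hH).congr (ae_of_all _ fun p => ?_)
    simp only [Pi.add_apply]
    rw [hsum p]
    ring
  simp_rw [hsum]
  -- The two parts use opposite orders of integration: the tangential one in `x` first, the vertical
  -- one in `s` first.
  rw [integral_sub hG' hH, integral_prod_symm _ hG', integral_prod _ hH]
  have h1 : ∀ s, ∫ x, fderiv ℝ f (S (x, s)) (WithLp.toLp 2 (b.fst, fderiv ℝ γ x b.fst)) = 0 :=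
    fun s => integral_slice hγ hf hc s b.fst
  have h2 : ∀ x, ∫ s in Ioi (0 : ℝ), fderiv ℝ f (S (x, s)) (WithLp.toLp 2 (0, 1))
      = - f (graphMap γ x) := fun x => integral_vertical hγ.continuous hf hc x
  simp only [h1, integral_const_mul, h2]
  rw [integral_zero, zero_sub, ← integral_neg]
  simp

/-- The divergence theorem in the region above the graph of a Lipschitz function. -/
theorem graph_divergence (hγ : LipschitzWith K γ) (hf : ContDiff ℝ 1 f)
    (hc : HasCompactSupport f) (b : W m) :
    ∫ w in {w : W m | γ w.fst < w.snd}, fderiv ℝ f w b =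
      ∫ w in range (graphMap γ), f w * inner ℝ (graphNormal γ w.fst) b
        ∂(Measure.euclideanHausdorffMeasure m) := by
  rw [graph_divergence_aux hγ hf hc, ← map_graphMap_graphMeasure hγ,
    (measurableEmbedding_graphMap hγ.continuous).integral_map, graphMeasure,
    integral_withDensity_eq_integral_toReal_smul (measurable_areaElement γ).ennreal_ofReal
      (ae_of_all _ fun _ => ENNReal.ofReal_lt_top)]
  refine integral_congr_ae (ae_of_all _ fun x => ?_)
  simp only [smul_eq_mul]
  rw [ENNReal.toReal_ofReal (areaElement_pos γ x).le, ← inner_graphNormal]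
  simp only [graphMap, WithLp.toLp_fst]
  ring

/-- At a point of differentiability, cones around the normal are on the right side of the graph. -/
theorem graphNormal_cone {x : E m} (hx : DifferentiableAt ℝ γ x) {δ : ℝ} (hδ : 0 < δ) :
    ∀ᶠ w in 𝓝 (graphMap γ x),
      (inner ℝ (graphNormal γ x) (w - graphMap γ x) < -δ * ‖w - graphMap γ x‖ →
        γ w.fst < w.snd) ∧
      (δ * ‖w - graphMap γ x‖ < inner ℝ (graphNormal γ x) (w - graphMap γ x) →
        ¬ γ w.fst < w.snd) := by
  have h1 := hx.hasFDerivAt.isLittleO.def hδ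
  have hcont : Tendsto (fun w : W m => w.fst) (𝓝 (graphMap γ x)) (𝓝 x) := by
    have : Continuous fun w : W m => w.fst := by fun_prop
    simpa [graphMap] using this.tendsto (graphMap γ x)
  filter_upwards [hcont.eventually h1] with w hw
  set J := areaElement γ x with hJ
  have hJ1 : 1 ≤ J := Real.one_le_sqrt.2 (by nlinarith [norm_nonneg (fderiv ℝ γ x)])
  have h2 := inner_graphNormal γ x (w - graphMap γ x)
  have h3 := W_norm_fst_le (w - graphMap γ x)
  have h4 : (w - graphMap γ x).fst = w.fst - x := by simp [graphMap]
  have h5 : (w - graphMap γ x).snd = w.snd - γ x := by simp [graphMap]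
  rw [h4] at h2 h3
  rw [h5] at h2
  rw [Real.norm_eq_abs, abs_le] at hw
  set N := ‖w - graphMap γ x‖
  have hN : 0 ≤ N := norm_nonneg _
  have h6 : δ * ‖w.fst - x‖ ≤ δ * N := by gcongr
  -- Clearing the normalization of the normal multiplies the cone margin by `J ≥ 1`, so it still
  -- absorbs the differentiability error `δ * ‖w.fst - x‖`.
  have h7 : δ * N ≤ J * (δ * N) := le_mul_of_one_le_left (by positivity) hJ1
  constructor
  · intro h
    have := mul_lt_mul_of_pos_left h (areaElement_pos γ x)
    rw [h2] at this
    nlinarith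
  · intro h
    have := mul_lt_mul_of_pos_left h (areaElement_pos γ x)
    rw [h2] at this
    nlinarith

end

end Vekua

/-! ### Graph charts of the boundary. -/

namespace Vekua

open scoped NNReal ENNReal

/-- In the open set `U`, after the isometry `T`, the set `Ω` is the region above the graph of the
Lipschitz function `γ`. -/
structure IsGraphChart {n m : ℕ} (Ω U : Set (E n)) (T : E n ≃ₗᵢ[ℝ] W m) (γ : E m → ℝ)
    (K : ℝ≥0) : Prop where
  isOpen : IsOpen U
  lipschitz : LipschitzWith K γ
  mem_iff : ∀ y ∈ U, (y ∈ Ω ↔ γ (T y).fst < (T y).snd)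

/-- The shear is a homeomorphism that carries the half-space `s > 0` to the epigraph and its
boundary `s = 0` to the graph. -/
theorem frontier_epigraph {m : ℕ} {γ : E m → ℝ} (h : Continuous γ) :
    frontier {w : W m | γ w.fst < w.snd} = range (graphMap γ) := by
  have h1 := (shear γ h).preimage_frontier {w : W m | γ w.fst < w.snd}
  have hpre : shear γ h ⁻¹' {w : W m | γ w.fst < w.snd} = univ ×ˢ Ioi (0 : ℝ) := by
    ext p
    simp [shear_apply]
  rw [hpre, frontier_univ_prod_eq, frontier_Ioi] at h1
  rw [← (shear γ h).image_preimage (frontier _), h1]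
  ext w
  constructor
  · rintro ⟨⟨x, s⟩, ⟨-, hs⟩, rfl⟩
    refine ⟨x, ?_⟩
    obtain rfl : s = 0 := hs
    simp [shear_apply, graphMap]
  · rintro ⟨x, rfl⟩
    exact ⟨(x, 0), by simp, by simp [shear_apply, graphMap]⟩

section
variable {n m : ℕ} {Ω U : Set (E n)} {T : E n ≃ₗᵢ[ℝ] W m} {γ : E m → ℝ} {K : ℝ≥0}

theorem IsGraphChart.frontier_inter (h : IsGraphChart Ω U T γ K) :
    frontier Ω ∩ U = T ⁻¹' range (graphMap γ) ∩ U := by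
  have h1 : Ω ∩ U = T ⁻¹' {w : W m | γ w.fst < w.snd} ∩ U := by
    ext y
    exact ⟨fun hy => ⟨(h.mem_iff y hy.2).1 hy.1, hy.2⟩, fun hy => ⟨(h.mem_iff y hy.2).2 hy.1, hy.2⟩⟩
  rw [← frontier_inter_open_inter h.isOpen, h1, frontier_inter_open_inter h.isOpen,
    ← frontier_epigraph h.lipschitz.continuous]
  have := T.toHomeomorph.preimage_frontier {w : W m | γ w.fst < w.snd}
  rw [LinearIsometryEquiv.coe_toHomeomorph] at this
  rw [this]

theorem map_chart (T : E n ≃ₗᵢ[ℝ] W m) (hγ : LipschitzWith K γ) :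
    (graphMeasure γ).map (fun x => T.symm (graphMap γ x)) =
      (Measure.euclideanHausdorffMeasure m).restrict (T ⁻¹' range (graphMap γ)) := by
  have h1 := T.symm.toIsometryEquiv.measurePreserving_euclideanHausdorffMeasure m
  have h2 := (h1.restrict_preimage_emb T.symm.toHomeomorph.measurableEmbedding
    (T ⁻¹' range (graphMap γ))).map_eq
  have h3 : T.symm.toIsometryEquiv ⁻¹' (T ⁻¹' range (graphMap γ)) = range (graphMap γ) := by
    ext w
    simp
  rw [h3, ← map_graphMap_graphMeasure hγ, Measure.map_map h1.measurable
    (continuous_graphMap hγ.continuous).measurable] at h2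
  exact h2

theorem measurableEmbedding_chart (T : E n ≃ₗᵢ[ℝ] W m) (hγ : Continuous γ) :
    MeasurableEmbedding fun x => T.symm (graphMap γ x) :=
  T.symm.toHomeomorph.measurableEmbedding.comp (measurableEmbedding_graphMap hγ)

/-- The area formula transported by the isometry `T`, which preserves Hausdorff measure: inside a
chart, surface integrals become integrals over the parameter space. -/
theorem IsGraphChart.restrict_frontier (h : IsGraphChart Ω U T γ K) :
    (Measure.euclideanHausdorffMeasure m).restrict (frontier Ω ∩ U) =
      ((graphMeasure γ).map (fun x => T.symm (graphMap γ x))).restrict U := by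
  rw [map_chart T h.lipschitz, Measure.restrict_restrict h.isOpen.measurableSet, h.frontier_inter,
    inter_comm]

theorem IsGraphChart.isOutwardNormal (h : IsGraphChart Ω U T γ K) {x : E m}
    (hx : DifferentiableAt ℝ γ x) (hU : T.symm (graphMap γ x) ∈ U) :
    IsOutwardNormal Ω (T.symm (graphMap γ x)) (T.symm (graphNormal γ x)) := by
  refine ⟨by rw [LinearIsometryEquiv.norm_map, norm_graphNormal], fun δ hδ => ?_⟩
  have h1 := graphNormal_cone hx hδ
  have h2 : Tendsto T (𝓝 (T.symm (graphMap γ x))) (𝓝 (graphMap γ x)) := by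
    simpa using T.continuous.tendsto (T.symm (graphMap γ x))
  filter_upwards [h2.eventually h1, h.isOpen.mem_nhds hU] with y hy hyU
  rw [h.mem_iff y hyU]
  have h3 : inner ℝ (T.symm (graphNormal γ x)) (y - T.symm (graphMap γ x)) =
      inner ℝ (graphNormal γ x) (T y - graphMap γ x) := by
    rw [← T.inner_map_map, map_sub]
    simp
  have h4 : ‖y - T.symm (graphMap γ x)‖ = ‖T y - graphMap γ x‖ := by
    rw [← T.norm_map, map_sub]
    simp
  rw [h3, h4]
  exact hy

/-- The normal exists wherever `γ` is differentiable. The remaining parameters are Lebesgue null by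
Rademacher, hence null for the area measure, which has a density. -/
theorem IsGraphChart.ae_isOutwardNormal (h : IsGraphChart Ω U T γ K) :
    ∀ᵐ y ∂(Measure.euclideanHausdorffMeasure m).restrict (frontier Ω ∩ U),
      IsOutwardNormal Ω y (T.symm (graphNormal γ (T y).fst)) := by
  rw [h.restrict_frontier, ae_restrict_iff' h.isOpen.measurableSet,
    (measurableEmbedding_chart T h.lipschitz.continuous).ae_map_iff]
  have h1 : ∀ᵐ x ∂graphMeasure γ, DifferentiableAt ℝ γ x :=
    (withDensity_absolutelyContinuous _ _).ae_le h.lipschitz.ae_differentiableAt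
  filter_upwards [h1] with x hx hU
  have := h.isOutwardNormal hx hU
  simpa [graphMap] using this

theorem IsGraphChart.ae_outwardNormal_eq (h : IsGraphChart Ω U T γ K) :
    ∀ᵐ y ∂(Measure.euclideanHausdorffMeasure m).restrict (frontier Ω ∩ U),
      outwardNormal Ω y = T.symm (graphNormal γ (T y).fst) :=
  h.ae_isOutwardNormal.mono fun _ hy => hy.outwardNormal_eq

theorem measurable_chartNormal (T : E n ≃ₗᵢ[ℝ] W m) (γ : E m → ℝ) :
    Measurable fun y => T.symm (graphNormal γ (T y).fst) := by
  have h1 : Measurable fun y => (T y).fst :=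
    (show Continuous fun y => (T y).fst by fun_prop).measurable
  exact T.symm.continuous.measurable.comp ((measurable_graphNormal γ).comp h1)

theorem IsGraphChart.aestronglyMeasurable_outwardNormal (h : IsGraphChart Ω U T γ K) :
    AEStronglyMeasurable (outwardNormal Ω)
      ((Measure.euclideanHausdorffMeasure m).restrict (frontier Ω ∩ U)) :=
  (measurable_chartNormal T γ).aestronglyMeasurable.congr
    (h.ae_outwardNormal_eq.mono fun _ hy => hy.symm)

theorem areaElement_le (hγ : LipschitzWith K γ) (x : E m) : areaElement γ x ≤ √(1 + (K : ℝ) ^ 2) := by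
  unfold areaElement
  gcongr
  exact norm_fderiv_le_of_lipschitz ℝ hγ

/-- A bounded chart has a bounded parameter set, on which the density is at most `√(1 + K²)`. -/
theorem IsGraphChart.measure_frontier_lt_top (h : IsGraphChart Ω U T γ K)
    (hb : Bornology.IsBounded U) :
    (Measure.euclideanHausdorffMeasure m) (frontier Ω ∩ U) < ⊤ := by
  have h1 := congrArg (fun μ => μ univ) h.restrict_frontier
  simp only [Measure.restrict_apply_univ] at h1
  rw [h1, (measurableEmbedding_chart T h.lipschitz.continuous).map_apply]
  set A := (fun x => T.symm (graphMap γ x)) ⁻¹' U with hA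
  have hAb : Bornology.IsBounded A := by
    obtain ⟨R, hR⟩ := hb.exists_norm_le
    refine isBounded_iff_forall_norm_le.2 ⟨R, fun x hx => ?_⟩
    have h2 := hR _ hx
    rw [LinearIsometryEquiv.norm_map] at h2
    exact (by simpa [graphMap] using W_norm_fst_le (graphMap γ x) : ‖x‖ ≤ _).trans h2
  have hAm : MeasurableSet A := h.isOpen.measurableSet.preimage
    (measurableEmbedding_chart T h.lipschitz.continuous).measurable
  rw [graphMeasure, withDensity_apply _ hAm]
  refine (setLIntegral_mono measurable_const
    fun x _ => ENNReal.ofReal_le_ofReal (areaElement_le h.lipschitz x)).trans_lt ?_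
  rw [setLIntegral_const]
  exact ENNReal.mul_lt_top ENNReal.ofReal_lt_top hAb.measure_lt_top

theorem fderiv_comp_isometry_symm (T : E n ≃ₗᵢ[ℝ] W m) (f : E n → ℝ) (y a : E n) :
    fderiv ℝ (f ∘ T.symm) (T y) (T a) = fderiv ℝ f y a := by
  have h := T.symm.toContinuousLinearEquiv.comp_right_fderiv (f := f) (x := T y)
  have h2 := congrArg (fun L => L (T a)) h
  refine h2.trans ?_
  simp

theorem fderiv_eq_zero_of_notMem {F : Type*} [NormedAddCommGroup F] [NormedSpace ℝ F]
    {f : E n → F} (hfU : tsupport f ⊆ U) {y : E n} (hy : y ∉ U) : fderiv ℝ f y = 0 := by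
  by_contra h0
  exact hy (hfU (support_fderiv_subset ℝ h0))

theorem eq_zero_of_notMem {F : Type*} [Zero F] {f : E n → F} (hfU : tsupport f ⊆ U) {y : E n}
    (hy : y ∉ U) : f y = 0 := by
  by_contra h0
  exact hy (hfU (subset_tsupport _ h0))

theorem measurableSet_epigraph (hγ : Continuous γ) :
    MeasurableSet {w : W m | γ w.fst < w.snd} :=
  (isOpen_lt (by fun_prop) (by fun_prop)).measurableSet

/-- Inside `U` the domain and the epigraph coincide; outside `U` the integrand vanishes, so it does
not matter that they differ there. -/
theorem IsGraphChart.integral_fderiv (h : IsGraphChart Ω U T γ K) (hΩ : MeasurableSet Ω)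
    {f : E n → ℝ} (hfU : tsupport f ⊆ U) (a : E n) :
    ∫ w in {w : W m | γ w.fst < w.snd}, fderiv ℝ (f ∘ T.symm) w (T a) =
      ∫ y in Ω, fderiv ℝ f y a := by
  have hS := measurableSet_epigraph (m := m) h.lipschitz.continuous
  rw [← T.measurePreserving.setIntegral_preimage_emb T.toHomeomorph.measurableEmbedding,
    ← integral_indicator hΩ, ← integral_indicator (hS.preimage T.continuous.measurable)]
  congr 1
  funext y
  set S := T ⁻¹' {w : W m | γ w.fst < w.snd}
  by_cases hy : y ∈ U
  · have h1 : y ∈ Ω ↔ y ∈ S := h.mem_iff y hy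
    by_cases hyΩ : y ∈ Ω
    · rw [indicator_of_mem hyΩ, indicator_of_mem (h1.1 hyΩ), fderiv_comp_isometry_symm]
    · rw [indicator_of_notMem hyΩ, indicator_of_notMem (mt h1.2 hyΩ)]
  · have h0 : fderiv ℝ f y a = 0 := by rw [fderiv_eq_zero_of_notMem hfU hy]; rfl
    have h1 : fderiv ℝ (f ∘ T.symm) (T y) (T a) = 0 := by rw [fderiv_comp_isometry_symm, h0]
    exact (indicator_apply_eq_zero (f := fun y => fderiv ℝ (f ∘ T.symm) (T y) (T a)).2
      fun _ => h1).trans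
      (indicator_apply_eq_zero (f := fun y => fderiv ℝ f y a).2 fun _ => h0).symm

theorem IsGraphChart.integral_frontier (h : IsGraphChart Ω U T γ K) {f : E n → ℝ}
    (hfU : tsupport f ⊆ U) (a : E n) :
    ∫ w in range (graphMap γ), (f ∘ T.symm) w * inner ℝ (graphNormal γ w.fst) (T a)
        ∂(Measure.euclideanHausdorffMeasure m) =
      ∫ y in frontier Ω, f y * inner ℝ (outwardNormal Ω y) a
        ∂(Measure.euclideanHausdorffMeasure m) := by
  have hR : MeasurableSet (range (graphMap γ)) :=
    (measurableEmbedding_graphMap h.lipschitz.continuous).measurableSet_range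
  have hT := T.toIsometryEquiv.measurePreserving_euclideanHausdorffMeasure m
  rw [← hT.setIntegral_preimage_emb T.toHomeomorph.measurableEmbedding]
  have hRT : MeasurableSet (T.toIsometryEquiv ⁻¹' range (graphMap γ)) := hR.preimage hT.measurable
  have hres : ∀ (A : Set (E n)) (g : E n → ℝ), MeasurableSet A → (∀ y, y ∉ U → g y = 0) →
      ∫ y in A, g y ∂(Measure.euclideanHausdorffMeasure m) =
        ∫ y in A ∩ U, g y ∂(Measure.euclideanHausdorffMeasure m) := by
    intro A g hA hg
    refine setIntegral_eq_of_subset_of_forall_sdiff_eq_zero hA inter_subset_left ?_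
    exact fun y hy => hg y fun hyU => hy.2 ⟨hy.1, hyU⟩
  have hfT : ∀ y, (f ∘ T.symm) (T.toIsometryEquiv y) = f y := fun y => by simp
  simp only [hfT]
  have hz : ∀ y, y ∉ U → f y = 0 := fun y hy => eq_zero_of_notMem hfU hy
  rw [hres _ _ hRT fun y hy => by rw [hz y hy, zero_mul],
    hres _ _ isClosed_frontier.measurableSet fun y hy => by rw [hz y hy, zero_mul],
    show T.toIsometryEquiv ⁻¹' range (graphMap γ) ∩ U = frontier Ω ∩ U from h.frontier_inter.symm]
  refine integral_congr_ae ?_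
  filter_upwards [h.ae_outwardNormal_eq] with y hy
  rw [hy, ← T.inner_map_map (T.symm _) a, LinearIsometryEquiv.apply_symm_apply]
  rfl

/-- The divergence theorem for functions supported in a chart. -/
theorem IsGraphChart.divergence (h : IsGraphChart Ω U T γ K) (hΩ : MeasurableSet Ω) {f : E n → ℝ}
    (hf : ContDiff ℝ 1 f) (hc : HasCompactSupport f) (hfU : tsupport f ⊆ U) (a : E n) :
    ∫ y in Ω, fderiv ℝ f y a = ∫ y in frontier Ω, f y * inner ℝ (outwardNormal Ω y) a
      ∂(Measure.euclideanHausdorffMeasure m) := by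
  rw [← h.integral_fderiv hΩ hfU, ← h.integral_frontier hfU]
  exact graph_divergence h.lipschitz (hf.comp T.symm.contDiff)
    (hc.comp_homeomorph T.symm.toHomeomorph) (T a)

/-- A point of `Ω` within `δ` of a point outside `Ω` in the same chart lies at height between `0`
and `(1 + K) δ` above the graph: the heights differ by at most `δ`, the values of `γ` by at most `K
δ`. The shear preserves volume, so the layer has volume at most that of a ball times `(1 + K) δ`. -/
theorem IsGraphChart.volume_thin_le (h : IsGraphChart Ω U T γ K) (hb : Bornology.IsBounded U) :
    ∃ C : ℝ≥0, ∀ (δ : ℝ≥0) (B : Set (E n)), (∀ y ∈ B, Metric.ball y δ ⊆ U) →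
      volume {y | y ∈ Ω ∩ B ∧ ∃ z ∉ Ω, dist y z < δ} ≤ C * δ := by
  obtain ⟨R, hR⟩ := hb.exists_norm_le
  refine ⟨(volume (Metric.closedBall (0 : E m) R)).toNNReal * (1 + K), fun δ B hB => ?_⟩
  have hpre : {y | y ∈ Ω ∩ B ∧ ∃ z ∉ Ω, dist y z < δ} ⊆
      T ⁻¹' (shear γ h.lipschitz.continuous ''
        (Metric.closedBall (0 : E m) R ×ˢ Icc 0 ((1 + K) * δ : ℝ))) := by
    rintro y ⟨⟨hyΩ, hyB⟩, z, hz, hyz⟩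
    have hδ : (0 : ℝ) < δ := dist_nonneg.trans_lt hyz
    have hyU : y ∈ U := hB y hyB (Metric.mem_ball_self hδ)
    have hzU : z ∈ U := hB y hyB (by rwa [Metric.mem_ball, dist_comm])
    have h1 := (h.mem_iff y hyU).1 hyΩ
    have h2 := not_lt.1 (mt (h.mem_iff z hzU).2 hz)
    have h3 : ‖T y - T z‖ < δ := by rwa [← map_sub, T.norm_map, ← dist_eq_norm]
    have h4 := W_norm_fst_le (T y - T z)
    have h5 := W_abs_snd_le (T y - T z)
    have h6 := h.lipschitz.dist_le_mul (T y).fst (T z).fst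
    rw [Real.dist_eq, dist_eq_norm] at h6
    rw [WithLp.sub_fst] at h4
    rw [WithLp.sub_snd] at h5
    have h7 := (abs_le.1 h5).2
    have h8 := (abs_le.1 h6).1
    have h9 : (K : ℝ) * ‖(T y).fst - (T z).fst‖ ≤ K * δ := by gcongr; linarith
    refine ⟨((T y).fst, (T y).snd - γ (T y).fst), ⟨?_, ?_, ?_⟩, W_ext (by simp [shear_apply])
      (by simp [shear_apply])⟩
    · rw [mem_closedBall_zero_iff]
      exact (W_norm_fst_le (T y)).trans (T.norm_map y ▸ hR y hyU)
    · simpa using h1.le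
    · simp only
      linarith
  refine (measure_mono hpre).trans ?_
  rw [T.measurePreserving.measure_preimage_emb T.toHomeomorph.measurableEmbedding,
    ← (measurePreserving_shear h.lipschitz.continuous).measure_preimage_emb
      (shear γ h.lipschitz.continuous).measurableEmbedding,
    (shear γ h.lipschitz.continuous).preimage_image, Measure.prod_prod, Real.volume_Icc, sub_zero,
    show ((1 + K) * δ : ℝ) = ((1 + K) * δ : ℝ≥0) by push_cast; rfl, ENNReal.ofReal_coe_nnreal]
  push_cast
  rw [ENNReal.coe_toNNReal (isCompact_closedBall _ _).measure_lt_top.ne, mul_assoc]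

end

/-- Every boundary point of a Lipschitz domain has a graph chart on a ball. -/
theorem IsBoundedLipschitzDomain.exists_chart {n : ℕ} {Ω : Set (E n)}
    (h : IsBoundedLipschitzDomain Ω) {p : E n} (hp : p ∈ frontier Ω) :
    ∃ r > 0, ∃ (T : E n ≃ₗᵢ[ℝ] W (n - 1)) (γ : E (n - 1) → ℝ) (K : ℝ≥0),
      IsGraphChart Ω (Metric.ball p r) T γ K := by
  obtain ⟨T, γ, K, hγ, hev⟩ := h.exists_graph p hp
  obtain ⟨r, hr, hball⟩ := Metric.eventually_nhds_iff_ball.1 hev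
  exact ⟨r, hr, T, γ, K, Metric.isOpen_ball, hγ, hball⟩

end Vekua

/-! ### The divergence theorem on a bounded Lipschitz domain. -/

namespace Vekua

open scoped NNReal

/-- The value `1` is attained on a neighbourhood of `K`, so that the support of `1 - θ` misses `K`.
-/
theorem exists_smooth_cutoff {n : ℕ} {K U : Set (E n)} (hK : IsClosed K) (hU : IsOpen U)
    (hKU : K ⊆ U) : ∃ θ : E n → ℝ, ContDiff ℝ ∞ θ ∧ tsupport θ ⊆ U ∧ (∀ᶠ y in 𝓝ˢ K, θ y = 1) ∧
      ∀ y, θ y ∈ Icc (0 : ℝ) 1 := by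
  obtain ⟨f, h0, h1, h01⟩ := exists_contMDiffMap_zero_one_nhds_of_isClosed (n := (⊤ : ℕ∞))
    (modelWithCornersSelf ℝ (E n)) hU.isClosed_compl hK
    (disjoint_compl_left_iff_subset.2 hKU)
  refine ⟨f, f.contMDiff.contDiff, fun y hy => ?_, h1, h01⟩
  by_contra hyU
  have h2 := Filter.Eventually.filter_mono (nhds_le_nhdsSet (show y ∈ Uᶜ from hyU)) h0
  exact (notMem_tsupport_iff_eventuallyEq.2 h2) hy

theorem norm_outwardNormal_le {n : ℕ} (Ω : Set (E n)) (y : E n) : ‖outwardNormal Ω y‖ ≤ 1 := by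
  by_cases h : ∃ ν, IsOutwardNormal Ω y ν
  · obtain ⟨ν, hν⟩ := h
    rw [hν.outwardNormal_eq, hν.1]
  · rw [outwardNormal, dif_neg h]
    simp

section
variable {n : ℕ} {Ω : Set (E n)}

theorem IsBoundedLipschitzDomain.isCompact_closure (h : IsBoundedLipschitzDomain Ω) :
    IsCompact (closure Ω) := h.isBounded.isCompact_closure

theorem IsBoundedLipschitzDomain.isCompact_frontier (h : IsBoundedLipschitzDomain Ω) :
    IsCompact (frontier Ω) :=
  h.isCompact_closure.of_isClosed_subset isClosed_frontier frontier_subset_closure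

theorem IsBoundedLipschitzDomain.isFiniteMeasure (h : IsBoundedLipschitzDomain Ω) :
    IsFiniteMeasure (surfaceMeasure Ω) := by
  refine ⟨?_⟩
  rw [surfaceMeasure, Measure.restrict_apply_univ]
  have := h.isCompact_frontier.induction_on
    (p := fun s => (Measure.euclideanHausdorffMeasure (n - 1)) (frontier Ω ∩ s) < ⊤)
    (by simp) (fun s t hst ht => (measure_mono (inter_subset_inter_right _ hst)).trans_lt ht)
    (fun s t hs ht => by
      rw [inter_union_distrib_left]
      exact measure_union_lt_top hs ht)
    (fun p hp => by
      obtain ⟨r, hr, T, γ, K, hc⟩ := h.exists_chart hp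
      exact ⟨_, mem_nhdsWithin_of_mem_nhds (Metric.ball_mem_nhds p hr),
        hc.measure_frontier_lt_top Metric.isBounded_ball⟩)
  simpa using this

theorem IsBoundedLipschitzDomain.aestronglyMeasurable_outwardNormal
    (h : IsBoundedLipschitzDomain Ω) :
    AEStronglyMeasurable (outwardNormal Ω) (surfaceMeasure Ω) := by
  refine AEMeasurable.aestronglyMeasurable ?_
  have := h.isCompact_frontier.induction_on
    (p := fun s => AEMeasurable (outwardNormal Ω)
      ((Measure.euclideanHausdorffMeasure (n - 1)).restrict (frontier Ω ∩ s)))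
    (by simp) (fun s t hst ht => ht.mono_measure
      (Measure.restrict_mono (inter_subset_inter_right _ hst) le_rfl))
    (fun s t hs ht => by
      rw [inter_union_distrib_left]
      exact aemeasurable_union_iff.2 ⟨hs, ht⟩)
    (fun p hp => by
      obtain ⟨r, hr, T, γ, K, hc⟩ := h.exists_chart hp
      exact ⟨_, mem_nhdsWithin_of_mem_nhds (Metric.ball_mem_nhds p hr),
        hc.aestronglyMeasurable_outwardNormal.aemeasurable⟩)
  simpa [surfaceMeasure] using this

theorem IsBoundedLipschitzDomain.integrable_of_continuousOn (h : IsBoundedLipschitzDomain Ω)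
    {V : Type*} [NormedAddCommGroup V] {F : E n → V} (hF : ContinuousOn F (frontier Ω)) :
    Integrable F (surfaceMeasure Ω) := by
  have := h.isFiniteMeasure
  have hm : AEStronglyMeasurable F (surfaceMeasure Ω) :=
    hF.aestronglyMeasurable_of_isCompact h.isCompact_frontier isClosed_frontier.measurableSet
  obtain ⟨C, hC⟩ := h.isCompact_frontier.exists_bound_of_continuousOn hF
  refine Integrable.of_bound hm C ?_
  exact (ae_restrict_iff' isClosed_frontier.measurableSet).2 (ae_of_all _ hC)

theorem IsBoundedLipschitzDomain.integrable_normal_smul (h : IsBoundedLipschitzDomain Ω)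
    {V : Type*} [NormedAddCommGroup V] [NormedSpace ℝ V] {F : E n → V}
    (hF : ContinuousOn F (frontier Ω)) (a : E n) :
    Integrable (fun y => inner ℝ (outwardNormal Ω y) a • F y) (surfaceMeasure Ω) := by
  refine (h.integrable_of_continuousOn hF).bdd_smul ‖a‖ ?_ (ae_of_all _ fun y => ?_)
  · exact h.aestronglyMeasurable_outwardNormal.inner aestronglyMeasurable_const
  · refine (norm_inner_le_norm _ _).trans ?_
    exact mul_le_of_le_one_left (norm_nonneg _) (norm_outwardNormal_le _ _)

/-- The divergence theorem holds on `Ω` for the function `f`. -/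
def DivergenceHolds (Ω : Set (E n)) (f : E n → ℝ) : Prop :=
  ∀ a : E n, ∫ y in Ω, fderiv ℝ f y a = ∫ y, inner ℝ (outwardNormal Ω y) a * f y ∂(surfaceMeasure Ω)

theorem IsBoundedLipschitzDomain.divergenceHolds_add (h : IsBoundedLipschitzDomain Ω)
    {f g : E n → ℝ} (hf : ContDiff ℝ 1 f) (hfc : HasCompactSupport f) (hg : ContDiff ℝ 1 g)
    (hgc : HasCompactSupport g) (h1 : DivergenceHolds Ω f) (h2 : DivergenceHolds Ω g) :
    DivergenceHolds Ω (f + g) := by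
  intro a
  have hi : ∀ {f : E n → ℝ}, ContDiff ℝ 1 f → HasCompactSupport f →
      Integrable (fun y => fderiv ℝ f y a) (volume.restrict Ω) := by
    intro f hf hfc
    refine Integrable.restrict (Continuous.integrable_of_hasCompactSupport ?_ ?_)
    · exact (hf.continuous_fderiv one_ne_zero).clm_apply continuous_const
    · exact (hfc.fderiv (𝕜 := ℝ)).comp_left (g := fun L : E n →L[ℝ] ℝ => L a) rfl
  have e1 : ∀ y, fderiv ℝ (f + g) y a = fderiv ℝ f y a + fderiv ℝ g y a := by
    intro y
    rw [fderiv_add (hf.differentiable one_ne_zero y) (hg.differentiable one_ne_zero y)]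
    rfl
  simp only [e1, Pi.add_apply, mul_add]
  rw [integral_add (hi hf hfc) (hi hg hgc), h1 a, h2 a, integral_add]
  · exact h.integrable_normal_smul hf.continuous.continuousOn a
  · exact h.integrable_normal_smul hg.continuous.continuousOn a

theorem divergenceHolds_of_tsupport_subset_compl {f : E n → ℝ} (hf : tsupport f ⊆ (closure Ω)ᶜ) :
    DivergenceHolds Ω f := by
  intro a
  have h0 : ∀ y ∈ closure Ω, y ∉ (closure Ω)ᶜ := fun y hy h => h hy
  rw [setIntegral_eq_zero_of_forall_eq_zero fun y hy => by
    rw [fderiv_eq_zero_of_notMem hf (h0 y (subset_closure hy))]; rfl]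
  rw [surfaceMeasure, setIntegral_eq_zero_of_forall_eq_zero fun y hy => by
    rw [eq_zero_of_notMem hf (h0 y (frontier_subset_closure hy)), mul_zero]]

theorem integral_fderiv_eq_zero {f : E n → ℝ} (hf : ContDiff ℝ 1 f) (hc : HasCompactSupport f)
    (a : E n) : ∫ y, fderiv ℝ f y a = 0 := by
  obtain ⟨C, hC⟩ := hf.lipschitzWith_of_hasCompactSupport hc one_ne_zero
  rw [← integral_lineDeriv_eq_zero hC hc a]
  refine integral_congr_ae (ae_of_all _ fun y => ?_)
  exact ((hf.differentiable one_ne_zero y).lineDeriv_eq_fderiv).symm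

theorem setIntegral_fderiv_eq_zero {f : E n → ℝ} (hf : ContDiff ℝ 1 f) (hc : HasCompactSupport f)
    (hs : tsupport f ⊆ Ω) (a : E n) : ∫ y in Ω, fderiv ℝ f y a = 0 := by
  rw [setIntegral_eq_integral_of_forall_compl_eq_zero, integral_fderiv_eq_zero hf hc]
  intro y hy
  rw [fderiv_eq_zero_of_notMem hs hy]
  rfl

theorem divergenceHolds_of_tsupport_subset (hΩ : IsOpen Ω) {f : E n → ℝ} (hf : ContDiff ℝ 1 f)
    (hc : HasCompactSupport f) (hs : tsupport f ⊆ Ω) : DivergenceHolds Ω f := by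
  intro a
  rw [setIntegral_fderiv_eq_zero hf hc hs, surfaceMeasure,
    setIntegral_eq_zero_of_forall_eq_zero fun y hy => ?_]
  rw [eq_zero_of_notMem hs fun h => (hΩ.frontier_eq ▸ hy).2 h, mul_zero]

/-- The divergence theorem on a bounded Lipschitz domain, for real functions. -/
theorem IsBoundedLipschitzDomain.divergenceHolds (h : IsBoundedLipschitzDomain Ω) {f : E n → ℝ}
    (hf : ContDiff ℝ 1 f) (hc : HasCompactSupport f) : DivergenceHolds Ω f := by
  suffices hs : ∃ U, IsOpen U ∧ tsupport f ⊆ U ∧ ∀ g : E n → ℝ, ContDiff ℝ 1 g →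
      HasCompactSupport g → tsupport g ⊆ U → DivergenceHolds Ω g by
    obtain ⟨U, -, hU, hdiv⟩ := hs
    exact hdiv f hf hc hU
  -- The compact support of `f` is covered by open sets on which the theorem is known for functions
  -- supported there. The property carried along is stable under unions, so an explicit partition of
  -- unity is not needed.
  refine IsCompact.induction_on hc
    (p := fun s => ∃ U, IsOpen U ∧ s ⊆ U ∧ ∀ g : E n → ℝ, ContDiff ℝ 1 g → HasCompactSupport g →
      tsupport g ⊆ U → DivergenceHolds Ω g) ?_ ?_ ?_ ?_
  · refine ⟨∅, isOpen_empty, subset_rfl, fun g _ _ hg => ?_⟩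
    exact divergenceHolds_of_tsupport_subset_compl (hg.trans (empty_subset _))
  · rintro s t hst ⟨U, hU, htU, hdiv⟩
    exact ⟨U, hU, hst.trans htU, hdiv⟩
  · rintro s t ⟨U, hU, hsU, hdU⟩ ⟨V, hV, htV, hdV⟩
    refine ⟨U ∪ V, hU.union hV, union_subset_union hsU htV, fun g hg hgc hgs => ?_⟩
    -- With `θ = 1` near the part of the support outside `V`, the piece `θ g` is supported in `U`
    -- and `(1 - θ) g` in `V`.
    obtain ⟨θ, hθ, hθU, hθ1, -⟩ := exists_smooth_cutoff (K := tsupport g \ V)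
      ((isClosed_tsupport g).sdiff hV) hU
      (fun y hy => (hgs hy.1).resolve_right hy.2)
    have hθ' : ContDiff ℝ 1 θ := hθ.of_le (by exact_mod_cast le_top)
    have h1 : ContDiff ℝ 1 (θ * g) := hθ'.mul hg
    have h2 : ContDiff ℝ 1 ((1 - θ) * g) := (contDiff_const.sub hθ').mul hg
    have e : g = θ * g + (1 - θ) * g := by ring
    rw [e]
    refine h.divergenceHolds_add h1 hgc.mul_left h2 hgc.mul_left
      (hdU _ h1 hgc.mul_left ((tsupport_mul_subset_left).trans hθU))
      (hdV _ h2 hgc.mul_left fun y hy => ?_)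
    by_contra hyV
    have hy' : y ∈ tsupport g \ V := ⟨tsupport_mul_subset_right hy, hyV⟩
    have h3 : ∀ᶠ z in 𝓝 y, θ z = 1 := Filter.Eventually.filter_mono (nhds_le_nhdsSet hy') hθ1
    refine notMem_tsupport_iff_eventuallyEq.2 ?_ hy
    filter_upwards [h3] with z hz
    simp [hz]
  · intro p _
    by_cases hp : p ∈ closure Ω
    · by_cases hpΩ : p ∈ Ω
      · exact ⟨Ω, mem_nhdsWithin_of_mem_nhds (h.isOpen.mem_nhds hpΩ), Ω, h.isOpen, subset_rfl,
          fun g hg hgc hgs => divergenceHolds_of_tsupport_subset h.isOpen hg hgc hgs⟩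
      · have hpf : p ∈ frontier Ω := by
          rw [h.isOpen.frontier_eq]
          exact ⟨hp, hpΩ⟩
        obtain ⟨r, hr, T, γ, K, hch⟩ := h.exists_chart hpf
        refine ⟨_, mem_nhdsWithin_of_mem_nhds (Metric.ball_mem_nhds p hr), _, Metric.isOpen_ball,
          subset_rfl, fun g hg hgc hgs a => ?_⟩
        rw [hch.divergence h.isOpen.measurableSet hg hgc hgs, surfaceMeasure]
        simp only [mul_comm]
    · have ho : IsOpen (closure Ω)ᶜ := isClosed_closure.isOpen_compl
      exact ⟨(closure Ω)ᶜ, mem_nhdsWithin_of_mem_nhds (ho.mem_nhds hp), _, ho, subset_rfl,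
        fun g _ _ hgs => divergenceHolds_of_tsupport_subset_compl hgs⟩

/-- The divergence theorem on a bounded Lipschitz domain, for vector-valued functions. -/
theorem IsBoundedLipschitzDomain.integral_fderiv (h : IsBoundedLipschitzDomain Ω) {V : Type*}
    [NormedAddCommGroup V] [NormedSpace ℝ V] [CompleteSpace V] {f : E n → V}
    (hf : ContDiff ℝ 1 f) (hc : HasCompactSupport f) (a : E n) :
    ∫ y in Ω, fderiv ℝ f y a =
      ∫ y, inner ℝ (outwardNormal Ω y) a • f y ∂(surfaceMeasure Ω) := by
  refine (SeparatingDual.eq_iff_forall_dual_eq (R := ℝ)).2 fun L => ?_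
  have h1 : Integrable (fun y => fderiv ℝ f y a) (volume.restrict Ω) := by
    refine Integrable.restrict (Continuous.integrable_of_hasCompactSupport ?_ ?_)
    · exact (hf.continuous_fderiv one_ne_zero).clm_apply continuous_const
    · exact (hc.fderiv (𝕜 := ℝ)).comp_left (g := fun L : E n →L[ℝ] V => L a) rfl
  rw [← L.integral_comp_comm h1,
    ← L.integral_comp_comm (h.integrable_normal_smul hf.continuous.continuousOn a)]
  have h2 := h.divergenceHolds (f := fun y => L (f y)) (L.contDiff.comp hf)
    (hc.comp_left (map_zero L)) a
  simp only [map_smul, smul_eq_mul]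
  rw [← h2]
  congr 1
  ext y
  have := (L.hasFDerivAt.comp y (hf.differentiable one_ne_zero y).hasFDerivAt).fderiv
  exact (congrArg (fun M => M a) this).symm

end

end Vekua

/-! ### Thin boundary layers and cutoff functions. -/

namespace Vekua

open scoped NNReal

section
variable {n : ℕ} {Ω : Set (E n)}

/-- The points of `Ω` at distance less than `δ` from the complement. -/
def thinSet (Ω : Set (E n)) (δ : ℝ) : Set (E n) := {y | y ∈ Ω ∧ ∃ z ∉ Ω, dist y z < δ}

/-- By compactness of the closure the bound is local. Near an interior point the layer is empty for
small `δ`, and near a boundary point it is controlled by a chart. -/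
theorem IsBoundedLipschitzDomain.volume_thinSet_le_of_small (h : IsBoundedLipschitzDomain Ω) :
    ∃ (C : ℝ≥0) (δ₀ : ℝ≥0), 0 < δ₀ ∧ ∀ δ ≤ δ₀, volume (thinSet Ω δ) ≤ C * δ := by
  suffices hs : ∃ (C : ℝ≥0) (δ₀ : ℝ≥0), 0 < δ₀ ∧ ∀ δ ≤ δ₀,
      volume {y | y ∈ Ω ∩ closure Ω ∧ ∃ z ∉ Ω, dist y z < δ} ≤ C * δ by
    rwa [inter_eq_self_of_subset_left subset_closure] at hs
  refine IsCompact.induction_on h.isCompact_closure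
    (p := fun s => ∃ (C : ℝ≥0) (δ₀ : ℝ≥0), 0 < δ₀ ∧ ∀ δ ≤ δ₀,
      volume {y | y ∈ Ω ∩ s ∧ ∃ z ∉ Ω, dist y z < δ} ≤ C * δ) ?_ ?_ ?_ ?_
  · exact ⟨0, 1, one_pos, fun δ _ => by simp⟩
  · rintro s t hst ⟨C, δ₀, hδ₀, hC⟩
    refine ⟨C, δ₀, hδ₀, fun δ hδ => (measure_mono ?_).trans (hC δ hδ)⟩
    exact fun y hy => ⟨⟨hy.1.1, hst hy.1.2⟩, hy.2⟩
  · rintro s t ⟨C, δ₀, hδ₀, hC⟩ ⟨C', δ₁, hδ₁, hC'⟩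
    refine ⟨C + C', min δ₀ δ₁, lt_min hδ₀ hδ₁, fun δ hδ => ?_⟩
    calc _ ≤ volume ({y | y ∈ Ω ∩ s ∧ ∃ z ∉ Ω, dist y z < δ} ∪
          {y | y ∈ Ω ∩ t ∧ ∃ z ∉ Ω, dist y z < δ}) := by
          refine measure_mono ?_
          rintro y ⟨⟨hy, hst⟩, hz⟩
          exact hst.imp (fun hs => ⟨⟨hy, hs⟩, hz⟩) fun ht => ⟨⟨hy, ht⟩, hz⟩
      _ ≤ C * δ + C' * δ := (measure_union_le _ _).trans
          (add_le_add (hC δ (hδ.trans (min_le_left _ _))) (hC' δ (hδ.trans (min_le_right _ _))))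
      _ = _ := by push_cast; ring
  · intro p hp
    -- Working in the half ball with `δ ≤ r/2` keeps the nearby exterior point inside the ball where
    -- `Ω` is understood.
    have hsub : ∀ (r : ℝ≥0) (δ : ℝ≥0), δ ≤ r / 2 → ∀ y ∈ Metric.ball p ((r / 2 : ℝ≥0) : ℝ),
        Metric.ball y δ ⊆ Metric.ball p r := by
      intro r δ hδ y hy
      refine Metric.ball_subset_ball' ?_
      have h1 : (δ : ℝ) ≤ (r : ℝ) / 2 := by exact_mod_cast hδ
      have h2 := Metric.mem_ball.1 hy
      push_cast at h2
      linarith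
    by_cases hpΩ : p ∈ Ω
    · obtain ⟨r, hr, hball⟩ := Metric.isOpen_iff.1 h.isOpen p hpΩ
      lift r to ℝ≥0 using hr.le
      have hr' : 0 < r := by exact_mod_cast hr
      refine ⟨Metric.ball p ((r / 2 : ℝ≥0) : ℝ), mem_nhdsWithin_of_mem_nhds
        (Metric.ball_mem_nhds p (by positivity)), 0, r / 2, by positivity, fun δ hδ => ?_⟩
      refine le_of_eq_of_le (measure_mono_null (t := ∅) ?_ measure_empty) bot_le
      rintro y ⟨⟨-, hy⟩, z, hz, hyz⟩
      exact hz (hball (hsub r δ hδ y hy (by rwa [Metric.mem_ball, dist_comm])))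
    · have hpf : p ∈ frontier Ω := by
        rw [h.isOpen.frontier_eq]
        exact ⟨hp, hpΩ⟩
      obtain ⟨r, hr, T, γ, K, hch⟩ := h.exists_chart hpf
      lift r to ℝ≥0 using hr.le
      have hr' : 0 < r := by exact_mod_cast hr
      obtain ⟨C, hC⟩ := hch.volume_thin_le Metric.isBounded_ball
      exact ⟨Metric.ball p ((r / 2 : ℝ≥0) : ℝ), mem_nhdsWithin_of_mem_nhds
        (Metric.ball_mem_nhds p (by positivity)), C, r / 2, by positivity,
        fun δ hδ => hC δ _ (hsub r δ hδ)⟩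

theorem IsBoundedLipschitzDomain.volume_thinSet_le (h : IsBoundedLipschitzDomain Ω) :
    ∃ C : ℝ≥0, ∀ δ : ℝ≥0, volume (thinSet Ω δ) ≤ C * δ := by
  obtain ⟨C, δ₀, hδ₀, hC⟩ := h.volume_thinSet_le_of_small
  -- For `δ ≥ δ₀` the trivial bound by the whole volume is already linear, with slope `|Ω| / δ₀`.
  refine ⟨max C ((volume Ω).toNNReal / δ₀), fun δ => ?_⟩
  rcases le_total δ δ₀ with hδ | hδ
  · refine (hC δ hδ).trans ?_
    gcongr
    exact le_max_left _ _
  · calc volume (thinSet Ω δ) ≤ volume Ω := measure_mono fun y hy => hy.1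
      _ = (((volume Ω).toNNReal / δ₀ * δ₀ : ℝ≥0) : ENNReal) := by
          rw [div_mul_cancel₀ _ hδ₀.ne', ENNReal.coe_toNNReal h.isBounded.measure_lt_top.ne]
      _ ≤ _ := by
          push_cast
          gcongr
          exact le_max_right _ _

/-- The average of `f` against a bump function of radius `ε`. -/
noncomputable def mollify (φ : ContDiffBump (0 : E n)) {V : Type*} [NormedAddCommGroup V]
    [NormedSpace ℝ V] (f : E n → V) : E n → V :=
  convolution (φ.normed volume) f (ContinuousLinearMap.lsmul ℝ ℝ) volume

theorem mollify_apply (φ : ContDiffBump (0 : E n)) {V : Type*} [NormedAddCommGroup V]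
    [NormedSpace ℝ V] (f : E n → V) (x : E n) :
    mollify φ f x = ∫ t, φ.normed volume t • f (x - t) := rfl

theorem norm_integral_normed_smul_le (φ : ContDiffBump (0 : E n)) {V : Type*}
    [NormedAddCommGroup V] [NormedSpace ℝ V] {g : E n → V} {C : ℝ} (hg : ∀ t, ‖g t‖ ≤ C) :
    ‖∫ t, φ.normed volume t • g t‖ ≤ C := by
  have h1 : ∀ᵐ t : E n, ‖φ.normed volume t • g t‖ ≤ φ.normed volume t * C := by
    refine ae_of_all _ fun t => ?_
    rw [norm_smul, Real.norm_of_nonneg (φ.nonneg_normed t)]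
    exact mul_le_mul_of_nonneg_left (hg t) (φ.nonneg_normed t)
  refine (norm_integral_le_of_norm_le (φ.integrable_normed.mul_const C) h1).trans ?_
  rw [integral_mul_const, φ.integral_normed, one_mul]

theorem mollify_norm_le (φ : ContDiffBump (0 : E n)) {V : Type*} [NormedAddCommGroup V]
    [NormedSpace ℝ V] {f : E n → V} {C : ℝ} (hf : ∀ t, ‖f t‖ ≤ C) (x : E n) :
    ‖mollify φ f x‖ ≤ C := norm_integral_normed_smul_le φ fun t => hf (x - t)

theorem mollify_lipschitz (φ : ContDiffBump (0 : E n)) {f : E n → ℝ} {K : ℝ≥0}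
    (hf : LipschitzWith K f) : LipschitzWith K (mollify φ f) := by
  refine LipschitzWith.of_dist_le_mul fun x y => ?_
  have hi : ∀ x, Integrable fun t => φ.normed volume t • f (x - t) := by
    intro x
    refine Continuous.integrable_of_hasCompactSupport ?_ ?_
    · exact φ.continuous_normed.smul (hf.continuous.comp (continuous_const.sub continuous_id))
    · exact φ.hasCompactSupport_normed.smul_right
  rw [dist_eq_norm, mollify_apply, mollify_apply, ← integral_sub (hi x) (hi y)]
  simp only [← smul_sub]
  refine norm_integral_normed_smul_le φ fun t => ?_
  rw [← dist_eq_norm]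
  simpa using hf.dist_le_mul (x - t) (y - t)

theorem mollify_contDiff (φ : ContDiffBump (0 : E n)) {f : E n → ℝ} (hf : Continuous f) :
    ContDiff ℝ ∞ (mollify φ f) :=
  φ.hasCompactSupport_normed.contDiff_convolution_left _ φ.contDiff_normed hf.locallyIntegrable

theorem mollify_eq (φ : ContDiffBump (0 : E n)) {f : E n → ℝ} {x : E n}
    (h : ∀ y ∈ Metric.ball x φ.rOut, f y = f x) : mollify φ f x = f x :=
  φ.normed_convolution_eq_right h

theorem fderiv_mollify (φ : ContDiffBump (0 : E n)) {f : E n → ℝ} (hf : ContDiff ℝ 1 f)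
    (hc : HasCompactSupport f) (x : E n) :
    fderiv ℝ (mollify φ f) x = mollify φ (fderiv ℝ f) x := by
  have h := (hc.hasFDerivAt_convolution_right (μ := volume) (ContinuousLinearMap.lsmul ℝ ℝ)
    (φ.continuous_normed (μ := volume)).locallyIntegrable hf x).fderiv
  refine h.trans ?_
  rw [mollify_apply, convolution_def]
  rfl

/-- A sequence of smooth cutoff functions exhausting `Ω`, whose gradients are bounded in `L¹`. -/
structure IsCutoffSeq (Ω : Set (E n)) (χ : ℕ → E n → ℝ) : Prop where
  contDiff : ∀ k, ContDiff ℝ ∞ (χ k)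
  hasCompactSupport : ∀ k, HasCompactSupport (χ k)
  tsupport_subset : ∀ k, tsupport (χ k) ⊆ Ω
  norm_le : ∀ k y, ‖χ k y‖ ≤ 1
  eventually_eq_one : ∀ K ⊆ Ω, IsCompact K → ∀ᶠ k in atTop, ∀ y ∈ K, χ k y = 1
  exists_bound : ∃ C : ℝ, ∀ k, ∫ y in Ω, ‖fderiv ℝ (χ k) y‖ ≤ C

theorem mem_thinSet_iff {y : E n} (hne : Ωᶜ.Nonempty) {δ : ℝ} :
    y ∈ thinSet Ω δ ↔ y ∈ Ω ∧ Metric.infDist y Ωᶜ < δ := by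
  rw [Metric.infDist_lt_iff hne]
  rfl

/-- With `d` the distance to the complement, the clamped function `d/δ - 2` is `1/δ`-Lipschitz, is
`0` for `d ≤ 2δ` and is `1` for `d ≥ 3δ`. Mollifying at radius `δ` keeps the bounds and the
Lipschitz constant and moves the thresholds to `δ` and `4δ`. -/
theorem exists_cutoff_of_pos (hb : Bornology.IsBounded Ω) {δ : ℝ≥0} (hδ : 0 < δ) :
    ∃ χ : E n → ℝ, ContDiff ℝ ∞ χ ∧ HasCompactSupport χ ∧ tsupport χ ⊆ Ω ∧ (∀ y, ‖χ y‖ ≤ 1) ∧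
      (∀ y, 4 * δ < Metric.infDist y Ωᶜ → χ y = 1) ∧ ∀ y, ‖fderiv ℝ χ y‖ ≤ (δ : ℝ)⁻¹ := by
  have hδ' : (0 : ℝ) < δ := by exact_mod_cast hδ
  set d : E n → ℝ := fun y => Metric.infDist y Ωᶜ with hd
  have hdL : LipschitzWith 1 d := Metric.lipschitz_infDist_pt _
  set g : E n → ℝ := fun y => max 0 (min 1 ((δ : ℝ)⁻¹ * d y - 2)) with hg
  have hgL : LipschitzWith δ⁻¹ g := by
    have h1 : LipschitzWith δ⁻¹ fun y => (δ : ℝ)⁻¹ * d y - 2 := by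
      refine LipschitzWith.of_dist_le_mul fun x y => ?_
      have := hdL.dist_le_mul x y
      rw [Real.dist_eq] at this ⊢
      rw [sub_sub_sub_cancel_right, ← mul_sub, abs_mul, abs_of_pos (inv_pos.2 hδ')]
      push_cast at *
      gcongr
      linarith
    have h2 := ((h1.const_min 1).const_max 0)
    exact h2
  have hball : ∀ x y, y ∈ Metric.ball x δ → |d y - d x| < δ := by
    intro x y hy
    have := hdL.dist_le_mul y x
    rw [Real.dist_eq] at this
    have h2 := Metric.mem_ball.1 hy
    push_cast at this
    linarith
  have hg0 : ∀ y, d y ≤ 2 * δ → g y = 0 := by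
    intro y hy
    have : (δ : ℝ)⁻¹ * d y - 2 ≤ 0 := by
      rw [sub_nonpos, inv_mul_le_iff₀ hδ']
      linarith
    simp only [hg]
    exact max_eq_left ((min_le_right _ _).trans this)
  have hg1 : ∀ y, 3 * δ ≤ d y → g y = 1 := by
    intro y hy
    have : 1 ≤ (δ : ℝ)⁻¹ * d y - 2 := by
      have : 3 ≤ (δ : ℝ)⁻¹ * d y := by
        rw [le_inv_mul_iff₀ hδ']
        linarith
      linarith
    simp only [hg]
    rw [min_eq_left this]
    exact max_eq_right zero_le_one
  set φ : ContDiffBump (0 : E n) := ⟨δ / 2, δ, by positivity, half_lt_self hδ'⟩ with hφ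
  have hr : φ.rOut = δ := rfl
  have hz : ∀ y, d y < δ → mollify φ g y = 0 := by
    intro y hy
    have hy0 : g y = 0 := hg0 y (by linarith)
    rw [mollify_eq φ fun z hz => ?_, hy0]
    have := abs_lt.1 (hball y z hz)
    rw [hy0, hg0 z (by linarith)]
  have hsupp : tsupport (mollify φ g) ⊆ {y | (δ : ℝ) ≤ d y} := by
    refine closure_minimal (fun y hy => ?_) (isClosed_le continuous_const hdL.continuous)
    by_contra hlt
    exact hy (hz y (not_le.1 hlt))
  have hsub : {y | (δ : ℝ) ≤ d y} ⊆ Ω := by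
    intro y hy
    by_contra hyΩ
    have : d y = 0 := Metric.infDist_zero_of_mem hyΩ
    have h2 : (δ : ℝ) ≤ d y := hy
    linarith
  refine ⟨mollify φ g, mollify_contDiff φ hgL.continuous, ?_, hsupp.trans hsub, ?_, ?_, ?_⟩
  · exact (hb.isCompact_closure).of_isClosed_subset (isClosed_tsupport _)
      ((hsupp.trans hsub).trans subset_closure)
  · refine fun y => mollify_norm_le φ (fun t => ?_) y
    rw [Real.norm_eq_abs, abs_le]
    exact ⟨(neg_nonpos.2 zero_le_one).trans (le_max_left _ _),
      max_le zero_le_one (min_le_left _ _)⟩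
  · intro y hy
    have hy1 : g y = 1 := hg1 y (by simp only [hd]; linarith)
    rw [mollify_eq φ fun z hz => ?_, hy1]
    have := abs_lt.1 (hball y z hz)
    rw [hy1, hg1 z (by simp only [hd] at this ⊢; linarith)]
  · intro y
    simpa using norm_fderiv_le_of_lipschitz ℝ (mollify_lipschitz φ hgL)

theorem IsBoundedLipschitzDomain.compl_nonempty (h : IsBoundedLipschitzDomain Ω) (hn : 1 ≤ n) :
    Ωᶜ.Nonempty := by
  rw [nonempty_compl]
  rintro rfl
  have : Nonempty (Fin n) := ⟨⟨0, hn⟩⟩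
  exact NormedSpace.unbounded_univ ℝ (E n) h.isBounded

theorem IsBoundedLipschitzDomain.exists_cutoffSeq (h : IsBoundedLipschitzDomain Ω) (hn : 1 ≤ n) :
    ∃ χ, IsCutoffSeq Ω χ := by
  have hne := h.compl_nonempty hn
  have hδ : ∀ k : ℕ, (0 : ℝ≥0) < ((k : ℝ≥0) + 1)⁻¹ := fun k => by positivity
  choose χ h1 h2 h3 h4 h5 h6 using fun k : ℕ => exists_cutoff_of_pos h.isBounded (hδ k)
  refine ⟨χ, h1, h2, h3, h4, fun K hKΩ hK => ?_, ?_⟩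
  · obtain ⟨c, hc, hcK⟩ : ∃ c > 0, ∀ y ∈ K, c ≤ Metric.infDist y Ωᶜ := by
      rcases K.eq_empty_or_nonempty with rfl | hKne
      · exact ⟨1, one_pos, by simp⟩
      obtain ⟨y, hy, hmin⟩ := hK.exists_isMinOn hKne (Metric.continuous_infDist_pt Ωᶜ).continuousOn
      refine ⟨_, ?_, hmin⟩
      exact (h.isOpen.isClosed_compl.notMem_iff_infDist_pos hne).1 fun hy' => hy' (hKΩ hy)
    have ht := (tendsto_one_div_add_atTop_nhds_zero_nat (𝕜 := ℝ)).const_mul 4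
    rw [mul_zero] at ht
    filter_upwards [ht.eventually_lt_const hc] with k hk y hy
    refine h5 k y (lt_of_lt_of_le ?_ (hcK y hy))
    push_cast
    simpa using hk
  · obtain ⟨C, hC⟩ := h.volume_thinSet_le
    -- The gradient vanishes where the distance is at least `5δ > 4δ`, because the cutoff is `1` on
    -- a whole neighbourhood there. A slope of at most `1/δ` on a layer of volume at most `5Cδ` has
    -- integral at most `5C`.
    refine ⟨5 * C, fun k => ?_⟩
    set δ : ℝ≥0 := ((k : ℝ≥0) + 1)⁻¹ with hδdef
    have hδk : 0 < δ := hδ k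
    have hδ' : (0 : ℝ) < δ := by exact_mod_cast hδk
    have hz : ∀ y ∈ Ω, y ∉ thinSet Ω ((5 * δ : ℝ≥0) : ℝ) → fderiv ℝ (χ k) y = 0 := by
      intro y hyΩ hy
      rw [mem_thinSet_iff hne] at hy
      have hy' : 4 * (δ : ℝ) < Metric.infDist y Ωᶜ := by
        have : ((5 * δ : ℝ≥0) : ℝ) ≤ Metric.infDist y Ωᶜ := not_lt.1 fun h => hy ⟨hyΩ, h⟩
        push_cast at this
        linarith
      have hev : χ k =ᶠ[𝓝 y] fun _ => 1 := by
        filter_upwards [(Metric.continuous_infDist_pt Ωᶜ).continuousAt.eventually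
          (lt_mem_nhds hy')] with z hz using h5 k z hz
      rw [hev.fderiv_eq]
      simp
    have hCk := hC (5 * δ)
    have hlt : volume (thinSet Ω ((5 * δ : ℝ≥0) : ℝ)) < ⊤ := hCk.trans_lt (by
      exact ENNReal.mul_lt_top ENNReal.coe_lt_top ENNReal.coe_lt_top)
    rw [setIntegral_eq_of_subset_of_forall_sdiff_eq_zero h.isOpen.measurableSet
      (s := thinSet Ω ((5 * δ : ℝ≥0) : ℝ)) (fun y hy => hy.1)
      (fun y hy => by rw [hz y hy.1 hy.2, norm_zero])]
    have h7 := norm_setIntegral_le_of_norm_le_const hlt (f := fun y => ‖fderiv ℝ (χ k) y‖)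
      (C := (δ : ℝ)⁻¹) (fun y _ => by rw [norm_norm]; exact h6 k y)
    refine (le_abs_self _).trans (h7.trans ?_)
    have h8 : volume.real (thinSet Ω ((5 * δ : ℝ≥0) : ℝ)) ≤ C * (5 * δ) := by
      have := ENNReal.toReal_mono (by exact ENNReal.mul_ne_top ENNReal.coe_ne_top ENNReal.coe_ne_top) hCk
      simpa [Measure.real] using this
    calc (δ : ℝ)⁻¹ * volume.real (thinSet Ω ((5 * δ : ℝ≥0) : ℝ)) ≤ (δ : ℝ)⁻¹ * (C * (5 * δ)) := by
          gcongr
      _ = 5 * C := by field_simp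

end

end Vekua

/-! ### Weak convergence of the cutoff gradients to the surface measure. -/

namespace Vekua

open scoped NNReal

section
variable {n : ℕ} {Ω : Set (E n)} {V : Type*} [NormedAddCommGroup V] [NormedSpace ℝ V]

theorem contDiff_smul_of_tsupport_subset {k : ℕ∞ω} (hΩ : IsOpen Ω) {χ : E n → ℝ} {w : E n → V}
    (hχ : ContDiff ℝ k χ) (hs : tsupport χ ⊆ Ω) (hw : ContDiffOn ℝ k w Ω) :
    ContDiff ℝ k fun y => χ y • w y := by
  refine contDiff_iff_contDiffAt.2 fun y => ?_
  by_cases hy : y ∈ Ω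
  · exact hχ.contDiffAt.smul (hw.contDiffAt (hΩ.mem_nhds hy))
  · have h0 := notMem_tsupport_iff_eventuallyEq.1 fun h => hy (hs h)
    refine contDiffAt_const (c := (0 : V)) |>.congr_of_eventuallyEq ?_
    filter_upwards [h0] with z hz
    simp [hz]

theorem fderiv_smul_apply (hΩ : IsOpen Ω) {χ : E n → ℝ} {w : E n → V} (hχ : ContDiff ℝ 1 χ)
    (hw : ContDiffOn ℝ 1 w Ω) {y : E n} (hy : y ∈ Ω) (a : E n) :
    fderiv ℝ (fun y => χ y • w y) y a = χ y • fderiv ℝ w y a + fderiv ℝ χ y a • w y := by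
  rw [fderiv_fun_smul (hχ.differentiable one_ne_zero y)
    ((hw.differentiableOn one_ne_zero).differentiableAt (hΩ.mem_nhds hy))]
  rfl

theorem tsupport_smul_subset {χ : E n → ℝ} (w : E n → V) :
    tsupport (fun y => χ y • w y) ⊆ tsupport χ :=
  closure_mono fun y hy h0 => hy (by simp [h0])

/-- Extended by zero, `χ w` is a `C¹` function on the whole space that vanishes on the boundary, so
the product rule leaves no boundary term. -/
theorem IsBoundedLipschitzDomain.integral_fderiv_smul_eq_zero [CompleteSpace V]
    (h : IsBoundedLipschitzDomain Ω)
    {χ : E n → ℝ} {w : E n → V} (hχ : ContDiff ℝ 1 χ) (hc : HasCompactSupport χ)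
    (hs : tsupport χ ⊆ Ω) (hw : ContDiffOn ℝ 1 w Ω) (a : E n) :
    ∫ y in Ω, (χ y • fderiv ℝ w y a + fderiv ℝ χ y a • w y) = 0 := by
  have h1 := h.integral_fderiv (f := fun y => χ y • w y) (contDiff_smul_of_tsupport_subset h.isOpen hχ hs hw)
    (hc.smul_right (f' := w)) a
  have h2 : ∀ y ∈ frontier Ω, inner ℝ (outwardNormal Ω y) a • χ y • w y = 0 := fun y hy => by
    rw [eq_zero_of_notMem hs fun h' => (h.isOpen.frontier_eq ▸ hy).2 h', zero_smul, smul_zero]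
  rw [surfaceMeasure, setIntegral_eq_zero_of_forall_eq_zero h2] at h1
  rw [← h1]
  exact setIntegral_congr_fun h.isOpen.measurableSet fun y hy =>
    (fderiv_smul_apply h.isOpen hχ hw hy a).symm

section
variable {χ : ℕ → E n → ℝ}

theorem IsCutoffSeq.contDiff_one (hχ : IsCutoffSeq Ω χ) (k : ℕ) : ContDiff ℝ 1 (χ k) :=
  (hχ.contDiff k).of_le (by exact_mod_cast le_top)

theorem IsCutoffSeq.tendsto_integral_smul (hΩ : IsOpen Ω) (hχ : IsCutoffSeq Ω χ) {g : E n → V}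
    (hg : IntegrableOn g Ω) :
    Tendsto (fun k => ∫ y in Ω, χ k y • g y) atTop (𝓝 (∫ y in Ω, g y)) := by
  refine tendsto_integral_of_dominated_convergence (fun y => ‖g y‖) (fun k => ?_) hg.norm
    (fun k => ae_of_all _ fun y => ?_) ?_
  · exact (hχ.contDiff k).continuous.aestronglyMeasurable.smul hg.aestronglyMeasurable
  · rw [norm_smul]
    exact mul_le_of_le_one_left (norm_nonneg _) (hχ.norm_le k y)
  · refine (ae_restrict_iff' hΩ.measurableSet).2 (ae_of_all _ fun y hy => ?_)
    refine tendsto_const_nhds.congr' ?_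
    filter_upwards [hχ.eventually_eq_one {y} (singleton_subset_iff.2 hy) isCompact_singleton]
      with k hk
    rw [hk y rfl, one_smul]

theorem IsCutoffSeq.integrableOn_smul (hχ : IsCutoffSeq Ω χ) {g : E n → V}
    (hg : IntegrableOn g Ω) (k : ℕ) : IntegrableOn (fun y => χ k y • g y) Ω :=
  hg.bdd_smul 1 (hχ.contDiff k).continuous.aestronglyMeasurable
    (ae_of_all _ (hχ.norm_le k))

theorem IsCutoffSeq.integrable_fderiv (hχ : IsCutoffSeq Ω χ) (k : ℕ) :
    Integrable (fderiv ℝ (χ k)) :=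
  ((hχ.contDiff_one k).continuous_fderiv one_ne_zero).integrable_of_hasCompactSupport
    ((hχ.hasCompactSupport k).fderiv (𝕜 := ℝ))

theorem IsBoundedLipschitzDomain.integrableOn_of_continuousOn (h : IsBoundedLipschitzDomain Ω)
    {V : Type*} [NormedAddCommGroup V] {F : E n → V} (hF : ContinuousOn F (closure Ω)) :
    IntegrableOn F Ω :=
  (hF.integrableOn_compact h.isCompact_closure).mono_set subset_closure

theorem IsCutoffSeq.integrableOn_fderiv_smul (h : IsBoundedLipschitzDomain Ω)
    (hχ : IsCutoffSeq Ω χ) {F : E n → V} (hF : ContinuousOn F (closure Ω)) (a : E n) (k : ℕ) :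
    IntegrableOn (fun y => fderiv ℝ (χ k) y a • F y) Ω := by
  obtain ⟨C, hC⟩ := (hχ.hasCompactSupport k).fderiv (𝕜 := ℝ) |>.exists_bound_of_continuous
    ((hχ.contDiff_one k).continuous_fderiv one_ne_zero)
  refine (h.integrableOn_of_continuousOn hF).bdd_smul (C * ‖a‖) ?_ (ae_of_all _ fun y => ?_)
  · exact (((hχ.contDiff_one k).continuous_fderiv one_ne_zero).clm_apply
      continuous_const).aestronglyMeasurable
  · exact (ContinuousLinearMap.le_opNorm _ _).trans (by gcongr; exact hC y)

/-- If `w` is continuous up to the boundary and has integrable derivative, then the integrals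
against the derivatives of the cutoff functions converge. -/
theorem IsCutoffSeq.tendsto_integral_fderiv_smul_of_contDiffOn [CompleteSpace V]
    (h : IsBoundedLipschitzDomain Ω)
    (hχ : IsCutoffSeq Ω χ) {w : E n → V} (hw : ContDiffOn ℝ 1 w Ω)
    (hc : ContinuousOn w (closure Ω)) (a : E n) (hi : IntegrableOn (fun y => fderiv ℝ w y a) Ω) :
    Tendsto (fun k => ∫ y in Ω, fderiv ℝ (χ k) y a • w y) atTop
      (𝓝 (-∫ y in Ω, fderiv ℝ w y a)) := by
  refine (hχ.tendsto_integral_smul h.isOpen hi).neg.congr fun k => ?_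
  have h1 := h.integral_fderiv_smul_eq_zero (hχ.contDiff_one k) (hχ.hasCompactSupport k)
    (hχ.tsupport_subset k) hw a
  rw [integral_add (hχ.integrableOn_smul hi k) (hχ.integrableOn_fderiv_smul h hc a k)] at h1
  exact neg_eq_of_add_eq_zero_right h1

theorem IsCutoffSeq.exists_nonneg_bound (hχ : IsCutoffSeq Ω χ) :
    ∃ C : ℝ, 0 ≤ C ∧ ∀ k, ∫ y in Ω, ‖fderiv ℝ (χ k) y‖ ≤ C := by
  obtain ⟨C, hC⟩ := hχ.exists_bound
  exact ⟨C, (integral_nonneg fun y => norm_nonneg _).trans (hC 0), hC⟩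

/-- Tietze extension, uniform smooth approximation of the extension, and a cutoff equal to `1` on
the closure. -/
theorem exists_contDiff_approx_on_closure [FiniteDimensional ℝ V] (h : IsBoundedLipschitzDomain Ω)
    {F : E n → V} (hF : ContinuousOn F (closure Ω)) {ε : ℝ} (hε : 0 < ε) :
    ∃ f : E n → V, ContDiff ℝ 1 f ∧ HasCompactSupport f ∧ ∀ y ∈ closure Ω, ‖F y - f y‖ ≤ ε := by
  obtain ⟨G, hG⟩ := ContinuousMap.exists_restrict_eq (isClosed_closure (s := Ω))
    (⟨(closure Ω).domRestrict F, continuousOn_iff_continuous_domRestrict.1 hF⟩ : C(closure Ω, V))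
  obtain ⟨g, hg, hgG, -⟩ := G.continuous.exists_contDiff_approx 1 (ε := fun _ => ε)
    continuous_const fun _ => hε
  obtain ⟨R, hR⟩ := h.isCompact_closure.isBounded.subset_ball (0 : E n)
  obtain ⟨θ, hθ, hθs, hθ1, -⟩ := exists_smooth_cutoff isClosed_closure Metric.isOpen_ball hR
  refine ⟨fun y => θ y • g y, (hθ.of_le (by exact_mod_cast le_top)).smul hg, ?_, fun y hy => ?_⟩
  · have : HasCompactSupport θ := (isCompact_closedBall (0 : E n) R).of_isClosed_subset
      (isClosed_tsupport _) (hθs.trans Metric.ball_subset_closedBall)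
    exact this.smul_right
  · have h1 : θ y = 1 := hθ1.self_of_nhdsSet y hy
    have h2 : G y = F y := congrArg (fun f : C(closure Ω, V) => f ⟨y, hy⟩) hG
    simp only [h1, one_smul]
    rw [← h2, ← dist_eq_norm, dist_comm]
    exact (hgG y).le

/-- The gradients of the cutoff functions converge to minus the outward normal times the surface
measure, weakly against functions that are continuous up to the boundary. -/
theorem IsCutoffSeq.tendsto_integral_fderiv_smul [CompleteSpace V] [FiniteDimensional ℝ V]
    (h : IsBoundedLipschitzDomain Ω) (hχ : IsCutoffSeq Ω χ) {F : E n → V}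
    (hF : ContinuousOn F (closure Ω)) (a : E n) :
    Tendsto (fun k => ∫ y in Ω, fderiv ℝ (χ k) y a • F y) atTop
      (𝓝 (-∫ y, inner ℝ (outwardNormal Ω y) a • F y ∂(surfaceMeasure Ω))) := by
  have hfin := h.isFiniteMeasure
  obtain ⟨C, hC0, hC⟩ := hχ.exists_nonneg_bound
  set M := (surfaceMeasure Ω).real univ with hM
  have hM0 : 0 ≤ M := measureReal_nonneg
  rw [Metric.tendsto_atTop']
  intro ε₀ hε₀
  -- The three summands budget for replacing `F` by `f` in the volume integral (`L¹` bound `C`), for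
  -- the same in the surface integral (total mass `M`), and for the convergence already known for
  -- `f`.
  set ε := ε₀ / (‖a‖ * C + ‖a‖ * M + 1) with hε
  have hD : 0 < ‖a‖ * C + ‖a‖ * M + 1 := by positivity
  have hεpos : 0 < ε := by positivity
  obtain ⟨f, hf, hfc, hfF⟩ := exists_contDiff_approx_on_closure h hF hεpos
  have hfi : IntegrableOn (fun y => fderiv ℝ f y a) Ω :=
    (((hf.continuous_fderiv one_ne_zero).clm_apply
      continuous_const).integrable_of_hasCompactSupport
      ((hfc.fderiv (𝕜 := ℝ)).comp_left (g := fun L : E n →L[ℝ] V => L a) rfl)).integrableOn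
  have hlim := hχ.tendsto_integral_fderiv_smul_of_contDiffOn h hf.contDiffOn
    hf.continuous.continuousOn a hfi
  rw [h.integral_fderiv hf hfc a] at hlim
  obtain ⟨N, hN⟩ := Metric.tendsto_atTop'.1 hlim ε hεpos
  refine ⟨N, fun k hk => ?_⟩
  have h1 := hN k hk
  have h2 : ‖(∫ y in Ω, fderiv ℝ (χ k) y a • F y) - ∫ y in Ω, fderiv ℝ (χ k) y a • f y‖
      ≤ ε * (‖a‖ * C) := by
    rw [← integral_sub (hχ.integrableOn_fderiv_smul h hF a k)
      (hχ.integrableOn_fderiv_smul h hf.continuous.continuousOn a k)]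
    have h3 : Integrable (fun y => ε * ‖a‖ * ‖fderiv ℝ (χ k) y‖) (volume.restrict Ω) :=
      ((hχ.integrable_fderiv k).norm.integrableOn).const_mul _
    refine (norm_integral_le_of_norm_le h3 ?_).trans ?_
    · refine (ae_restrict_iff' h.isOpen.measurableSet).2 (ae_of_all _ fun y hy => ?_)
      rw [← smul_sub, norm_smul]
      calc ‖fderiv ℝ (χ k) y a‖ * ‖F y - f y‖ ≤ (‖fderiv ℝ (χ k) y‖ * ‖a‖) * ε :=
            mul_le_mul (ContinuousLinearMap.le_opNorm _ _) (hfF y (subset_closure hy))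
              (norm_nonneg _) (by positivity)
        _ = _ := by ring
    · rw [integral_const_mul, ← mul_assoc]
      exact mul_le_mul_of_nonneg_left (hC k) (by positivity)
  have h4 : ‖(∫ y, inner ℝ (outwardNormal Ω y) a • F y ∂(surfaceMeasure Ω)) -
      ∫ y, inner ℝ (outwardNormal Ω y) a • f y ∂(surfaceMeasure Ω)‖ ≤ ε * (‖a‖ * M) := by
    rw [← integral_sub (h.integrable_normal_smul (hF.mono frontier_subset_closure) a)
      (h.integrable_normal_smul hf.continuous.continuousOn a)]
    refine (norm_integral_le_of_norm_le_const (C := ‖a‖ * ε) ?_).trans (le_of_eq (by ring))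
    refine (ae_restrict_iff' isClosed_frontier.measurableSet).2 (ae_of_all _ fun y hy => ?_)
    rw [← smul_sub, norm_smul]
    refine mul_le_mul ((norm_inner_le_norm _ _).trans ?_) (hfF y (frontier_subset_closure hy))
      (norm_nonneg _) (norm_nonneg _)
    exact mul_le_of_le_one_left (norm_nonneg _) (norm_outwardNormal_le _ _)
  rw [dist_eq_norm] at h1 ⊢
  set A := ∫ y in Ω, fderiv ℝ (χ k) y a • F y
  set A' := ∫ y in Ω, fderiv ℝ (χ k) y a • f y
  set B := ∫ y, inner ℝ (outwardNormal Ω y) a • F y ∂(surfaceMeasure Ω)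
  set B' := ∫ y, inner ℝ (outwardNormal Ω y) a • f y ∂(surfaceMeasure Ω)
  calc ‖A - -B‖ = ‖(A - A') + (A' - -B') + (B - B')‖ := by congr 1; abel
    _ ≤ ‖A - A'‖ + ‖A' - -B'‖ + ‖B - B'‖ := norm_add₃_le
    _ < ε * (‖a‖ * C) + ε + ε * (‖a‖ * M) := by linarith
    _ = ε * (‖a‖ * C + ‖a‖ * M + 1) := by ring
    _ = ε₀ := div_mul_cancel₀ _ hD.ne'

/-- The divergence theorem on a bounded Lipschitz domain of `ℝⁿ`, `n ≥ 1`, for functions that are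
continuous up to the boundary and have integrable derivative. -/
theorem IsBoundedLipschitzDomain.integral_fderiv_of_contDiffOn [CompleteSpace V]
    [FiniteDimensional ℝ V]
    (h : IsBoundedLipschitzDomain Ω) (hn : 1 ≤ n) {w : E n → V} (hw : ContDiffOn ℝ 1 w Ω)
    (hc : ContinuousOn w (closure Ω)) (a : E n) (hi : IntegrableOn (fun y => fderiv ℝ w y a) Ω) :
    ∫ y in Ω, fderiv ℝ w y a =
      ∫ y, inner ℝ (outwardNormal Ω y) a • w y ∂(surfaceMeasure Ω) := by
  obtain ⟨χ, hχ⟩ := h.exists_cutoffSeq hn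
  -- The integrals of `∂χₖ w` have one limit by the product rule and another by weak convergence;
  -- the latter needs only continuity of `w` up to the boundary.
  exact neg_injective (tendsto_nhds_unique
    (hχ.tendsto_integral_fderiv_smul_of_contDiffOn h hw hc a hi)
    (hχ.tendsto_integral_fderiv_smul h hc a))

end

end

end Vekua

/-! ### The scalar part as a conjugation-invariant trace. -/

namespace Vekua

section
variable {n : ℕ}

/-- The scalar part as a continuous linear form. -/
noncomputable def scL (n : ℕ) : Cl n →L[ℝ] ℝ := LinearMap.toContinuousLinearMap ((basisCl n).coord ∅)

theorem scL_apply (a : Cl n) : scL n a = Sc a := rfl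

/-- The Clifford conjugation as a continuous linear map. -/
noncomputable def starL (n : ℕ) : Cl n →L[ℝ] Cl n := LinearMap.toContinuousLinearMap
  { toFun := star
    map_add' := star_add
    map_smul' := fun r a => CliffordAlgebra.star_smul r a }

/-- The multiplication as a continuous bilinear map. -/
noncomputable def mulL (n : ℕ) : Cl n →L[ℝ] Cl n →L[ℝ] Cl n :=
  LinearMap.toContinuousLinearMap
    (LinearMap.toContinuousLinearMap.toLinearMap ∘ₗ LinearMap.mul ℝ (Cl n))

instance instContinuousMulCl (n : ℕ) : ContinuousMul (Cl n) :=
  ⟨(mulL n).isBoundedBilinearMap.continuous⟩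

instance instContinuousStarCl (n : ℕ) : ContinuousStar (Cl n) := ⟨(starL n).continuous⟩

theorem norm_mul_le_mulL (a b : Cl n) : ‖a * b‖ ≤ ‖mulL n‖ * ‖a‖ * ‖b‖ := (mulL n).le_opNorm₂ a b

theorem norm_star_le_starL (a : Cl n) : ‖star a‖ ≤ ‖starL n‖ * ‖a‖ := (starL n).le_opNorm a

theorem star_e (i : Fin n) : star (e i : Cl n) = -e i := CliffordAlgebra.star_ι _

/-- In the exterior algebra the degree-zero part is an algebra homomorphism that kills every
generator, so among the basis products only the empty one survives. -/
theorem sc_eq_algebraMapInv (a : Cl n) :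
    Sc a = ExteriorAlgebra.algebraMapInv (CliffordAlgebra.equivExterior (negNormSq n) a) := by
  have h : (basisCl n).coord ∅ = (ExteriorAlgebra.algebraMapInv (R := ℝ) (M := E n)).toLinearMap ∘ₗ
      (CliffordAlgebra.equivExterior (negNormSq n)).toLinearMap := by
    refine (basisCl n).ext fun A => ?_
    rw [LinearMap.comp_apply, LinearEquiv.coe_coe, AlgHom.toLinearMap_apply,
      Module.Basis.coord_apply, Module.Basis.repr_self, basisCl_apply,
      equivExterior_prod _ (Finset.sort_nodup _ _), map_list_prod, List.map_map]
    rcases A.eq_empty_or_nonempty with rfl | ⟨i, hi⟩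
    · simp
    · have hne : A ≠ ∅ := Finset.ne_empty_of_mem hi
      rw [Finsupp.single_eq_of_ne hne.symm, List.prod_eq_zero]
      refine List.mem_map.2 ⟨i, (Finset.mem_sort _).2 hi, ?_⟩
      simp [ExteriorAlgebra.algebraMapInv]
  exact congrArg (fun f => f a) h

theorem sc_prod_eq_zero {l : List (Fin n)} (hl : l.Nodup) (hne : l ≠ []) :
    Sc (l.map e).prod = 0 := by
  rw [sc_eq_algebraMapInv, equivExterior_prod _ hl, map_list_prod, List.map_map]
  obtain ⟨i, hi⟩ := List.exists_mem_of_ne_nil l hne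
  refine List.prod_eq_zero (List.mem_map.2 ⟨i, hi, ?_⟩)
  simp [ExteriorAlgebra.algebraMapInv]

theorem e_mul_e_of_ne {i j : Fin n} (h : i ≠ j) : (e i * e j : Cl n) = -(e j * e i) := by
  have := e_mul_e_add (n := n) i j
  rw [if_neg h] at this
  exact eq_neg_of_add_eq_zero_left this

theorem e_mul_self (i : Fin n) : (e i * e i : Cl n) = -1 := by
  have h := e_mul_e_add (n := n) i i
  rw [if_pos rfl, ← two_smul ℝ (e i * e i : Cl n)] at h
  have h2 : (-2 : Cl n) = (2 : ℝ) • (-1 : Cl n) := by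
    rw [two_smul]
    norm_num
  rw [h2] at h
  exact smul_right_injective _ (two_ne_zero' ℝ) h

theorem e_mul_prod {i : Fin n} {l : List (Fin n)} (h : i ∉ l) :
    (e i * (l.map e).prod : Cl n) = (-1 : ℝ) ^ l.length • ((l.map e).prod * e i) := by
  induction l with
  | nil => simp
  | cons j l ih =>
    rw [List.mem_cons, not_or] at h
    rw [List.map_cons, List.prod_cons, ← mul_assoc, e_mul_e_of_ne h.1, neg_mul, mul_assoc, ih h.2,
      List.length_cons, pow_succ]
    simp [mul_assoc]

/-- If `i ∉ l`, both sides are products of distinct generators and have no scalar part. If `l = s ++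
i :: t`, cancelling the two copies of `e i` gives `±` the product over `s ++ t` on both sides. Its
scalar part vanishes unless `s` and `t` are empty, and then the signs agree. -/
theorem sc_e_mul_prod (i : Fin n) {l : List (Fin n)} (hl : l.Nodup) :
    Sc (e i * (l.map e).prod : Cl n) = Sc ((l.map e).prod * e i) := by
  by_cases hi : i ∈ l
  · obtain ⟨s, t, rfl⟩ := List.append_of_mem hi
    have hn : (s ++ t).Nodup ∧ i ∉ s ∧ i ∉ t := by
      rw [List.nodup_middle, List.nodup_cons, List.mem_append, not_or] at hl
      exact ⟨hl.2, hl.1⟩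
    have h1 : (e i * ((s ++ i :: t).map e).prod : Cl n) =
        (-1 : ℝ) ^ s.length • -((s ++ t).map e).prod := by
      rw [List.map_append, List.map_cons, List.prod_append, List.prod_cons, ← mul_assoc,
        e_mul_prod hn.2.1, smul_mul_assoc, mul_assoc, ← mul_assoc (e i), e_mul_self]
      simp
    have h2 : (((s ++ i :: t).map e).prod * e i : Cl n) =
        (-1 : ℝ) ^ t.length • -((s ++ t).map e).prod := by
      have h3 : ((t.map e).prod * e i : Cl n) = (-1 : ℝ) ^ t.length • (e i * (t.map e).prod) := by
        rw [e_mul_prod hn.2.2, smul_smul, ← mul_pow]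
        simp
      rw [List.map_append, List.map_cons, List.prod_append, List.prod_cons, mul_assoc, mul_assoc, h3,
        mul_smul_comm, mul_smul_comm, ← mul_assoc (e i), e_mul_self]
      simp
    rw [h1, h2, ← scL_apply, ← scL_apply, map_smul, map_smul]
    by_cases hst : s ++ t = []
    · obtain ⟨rfl, rfl⟩ := List.append_eq_nil_iff.1 hst
      rfl
    · rw [map_neg, scL_apply, sc_prod_eq_zero hn.1 hst]
      simp
  · have h1 : Sc (e i * (l.map e).prod : Cl n) = 0 := by
      have := sc_prod_eq_zero (n := n) (l := i :: l) (List.nodup_cons.2 ⟨hi, hl⟩) (by simp)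
      simpa using this
    have h2 : Sc ((l.map e).prod * e i : Cl n) = 0 := by
      have := sc_prod_eq_zero (n := n) (l := l ++ [i]) (List.nodup_append.2 (by
        refine ⟨hl, by simp, ?_⟩
        rintro j hj k hk rfl
        simp only [List.mem_singleton] at hk
        exact hi (hk ▸ hj))) (by simp)
      simpa using this
    rw [h1, h2]

theorem sc_e_mul (i : Fin n) (b : Cl n) : Sc (e i * b) = Sc (b * e i) := by
  have h : (basisCl n).coord ∅ ∘ₗ LinearMap.mulLeft ℝ (e i) =
      (basisCl n).coord ∅ ∘ₗ LinearMap.mulRight ℝ (e i) := by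
    refine (basisCl n).ext fun A => ?_
    have := sc_e_mul_prod i (Finset.sort_nodup A (· ≤ ·))
    rw [← basisCl_apply] at this
    exact this
  exact congrArg (fun f => f b) h

/-- The scalar part is a trace. -/
theorem sc_mul_comm (a b : Cl n) : Sc (a * b) = Sc (b * a) := by
  have key : ∀ (l : List (Fin n)) (b : Cl n), Sc ((l.map e).prod * b) = Sc (b * (l.map e).prod) := by
    intro l
    induction l with
    | nil => simp
    | cons i l ih =>
      intro b
      rw [List.map_cons, List.prod_cons, mul_assoc, sc_e_mul, mul_assoc, ih, mul_assoc]
  have h : (basisCl n).coord ∅ ∘ₗ LinearMap.mulRight ℝ b =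
      (basisCl n).coord ∅ ∘ₗ LinearMap.mulLeft ℝ b := by
    refine (basisCl n).ext fun A => ?_
    have := key (A.sort (· ≤ ·)) b
    rw [← basisCl_apply] at this
    exact this
  exact congrArg (fun f => f a) h

theorem star_prod (l : List (Fin n)) :
    star (l.map e).prod = ((-1 : ℝ) ^ l.length • (l.reverse.map e).prod : Cl n) := by
  induction l with
  | nil => simp
  | cons i l ih =>
    rw [List.map_cons, List.prod_cons, star_mul, star_e, ih, List.reverse_cons, List.map_append,
      List.prod_append, List.length_cons, pow_succ]
    simp

/-- Conjugation sends a basis product to `±` the reversed product, which has no scalar part unless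
it is empty. -/
theorem sc_star (a : Cl n) : Sc (star a) = Sc a := by
  have h : (basisCl n).coord ∅ ∘ₗ (starL n).toLinearMap = (basisCl n).coord ∅ := by
    refine (basisCl n).ext fun A => ?_
    change Sc (star (basisCl n A)) = Sc (basisCl n A)
    rw [basisCl_apply]
    have hl := Finset.sort_nodup A (· ≤ ·)
    rcases A.eq_empty_or_nonempty with rfl | hne
    · simp
    · have hne' : A.sort (· ≤ ·) ≠ [] := fun h0 => by
        have := Finset.length_sort (s := A) (· ≤ ·)
        rw [h0] at this
        exact hne.card_pos.ne this
      rw [star_prod, ← scL_apply, map_smul, scL_apply, sc_prod_eq_zero hl hne',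
        sc_prod_eq_zero (List.nodup_reverse.2 hl) (by simpa using hne'), smul_zero]
  exact congrArg (fun f => f a) h

theorem vec_eq_sum (x : E n) : vec x = ∑ i, x i • (e i : Cl n) := by
  conv_lhs => rw [← (EuclideanSpace.basisFun (Fin n) ℝ).sum_repr x]
  simp [vec, e]

theorem η_eq_sum (Ω : Set (E n)) (y : E n) :
    η Ω y = ∑ i, inner ℝ (outwardNormal Ω y) (EuclideanSpace.single i 1) • (e i : Cl n) := by
  rw [η, vec_eq_sum]
  simp [EuclideanSpace.inner_single_right]

end

end Vekua

/-! ### Less regular test functions and an interior singularity. -/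

namespace Vekua

section
variable {n : ℕ} {Ω : Set (E n)}

theorem tsupport_mollify_subset (φ : ContDiffBump (0 : E n)) {f : E n → ℝ} {r : ℝ}
    (hr : φ.rOut ≤ r) : tsupport (mollify φ f) ⊆ Metric.cthickening r (tsupport f) := by
  refine closure_minimal (fun y hy => ?_) Metric.isClosed_cthickening
  by_contra hyK
  have h0 : ∀ z ∈ Metric.ball y φ.rOut, f z = 0 := by
    intro z hz
    by_contra hfz
    refine hyK (Metric.mem_cthickening_of_dist_le y z r _ (subset_tsupport _ hfz) ?_)
    rw [dist_comm]
    exact (Metric.mem_ball.1 hz).le.trans hr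
  have hy0 : f y = 0 := h0 y (Metric.mem_ball_self φ.rOut_pos)
  exact hy (by rw [mollify_eq φ fun z hz => by rw [h0 z hz, hy0], hy0])

/-- A first order weak equation holding for smooth test functions holds for `C¹` test functions. -/
theorem weak_equation_of_contDiff_one (hΩ : IsOpen Ω) {A : Fin n → E n → ℝ} {B : E n → ℝ}
    (hA : ∀ i, IntegrableOn (A i) Ω) (hB : IntegrableOn B Ω) {x : E n} {s : ℝ}
    (h : ∀ φ : E n → ℝ, ContDiff ℝ ∞ φ → HasCompactSupport φ → tsupport φ ⊆ Ω →
      ∫ y in Ω, (∑ i, fderiv ℝ φ y (EuclideanSpace.single i 1) * A i y + φ y * B y) = φ x * s)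
    {φ : E n → ℝ} (hφ : ContDiff ℝ 1 φ) (hc : HasCompactSupport φ) (hs : tsupport φ ⊆ Ω) :
    ∫ y in Ω, (∑ i, fderiv ℝ φ y (EuclideanSpace.single i 1) * A i y + φ y * B y) = φ x * s := by
  -- The mollification radii `r / (j + 1)` never exceed `r`, so all mollified functions are
  -- supported in one compact subset of `Ω` and are admissible smooth tests.
  obtain ⟨r, hr, hrΩ⟩ := IsCompact.exists_cthickening_subset_open hc hΩ hs
  have hj : ∀ j : ℕ, (0 : ℝ) < r * (1 / ((j : ℝ) + 1)) := fun j => by positivity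
  set b : ℕ → ContDiffBump (0 : E n) := fun j =>
    ⟨r * (1 / ((j : ℝ) + 1)) / 2, r * (1 / ((j : ℝ) + 1)), half_pos (hj j), half_lt_self (hj j)⟩
  have hb : Tendsto (fun j => (b j).rOut) atTop (𝓝 0) := by
    have h0 := (tendsto_one_div_add_atTop_nhds_zero_nat (𝕜 := ℝ)).const_mul r
    rwa [mul_zero] at h0
  have hbr : ∀ j, (b j).rOut ≤ r := fun j => by
    refine mul_le_of_le_one_right hr.le ?_
    rw [div_le_one (by positivity)]
    linarith [(Nat.cast_nonneg j : (0 : ℝ) ≤ j)]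
  have hd := hφ.continuous_fderiv one_ne_zero
  obtain ⟨C₀, hC₀⟩ := hc.exists_bound_of_continuous hφ.continuous
  obtain ⟨C₁, hC₁⟩ := (hc.fderiv (𝕜 := ℝ)).exists_bound_of_continuous hd
  have hsm : ∀ j, ContDiff ℝ ∞ (mollify (b j) φ) := fun j => mollify_contDiff _ hφ.continuous
  have hsub : ∀ j, tsupport (mollify (b j) φ) ⊆ Metric.cthickening r (tsupport φ) :=
    fun j => tsupport_mollify_subset _ (hbr j)
  have heq : ∀ j, ∫ y in Ω, (∑ i, fderiv ℝ (mollify (b j) φ) y (EuclideanSpace.single i 1) * A i y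
      + mollify (b j) φ y * B y) = mollify (b j) φ x * s := fun j =>
    h _ (hsm j) (hc.isCompact.cthickening.of_isClosed_subset (isClosed_tsupport _) (hsub j))
      ((hsub j).trans hrΩ)
  have hl0 : ∀ y, Tendsto (fun j => mollify (b j) φ y) atTop (𝓝 (φ y)) := fun y =>
    ContDiffBump.convolution_tendsto_right_of_continuous hb hφ.continuous y
  have hl1 : ∀ y, Tendsto (fun j => fderiv ℝ (mollify (b j) φ) y) atTop (𝓝 (fderiv ℝ φ y)) := by
    intro y
    simp only [fderiv_mollify _ hφ hc]
    exact ContDiffBump.convolution_tendsto_right_of_continuous hb hd y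
  refine tendsto_nhds_unique ?_ ((hl0 x).mul_const s)
  simp only [← heq]
  -- The bounds of `φ` and of its derivative pass to the mollified functions, since differentiation
  -- commutes with mollification; this provides the dominating function.
  refine tendsto_integral_of_dominated_convergence
    (fun y => ∑ i, C₁ * ‖A i y‖ + C₀ * ‖B y‖) (fun j => ?_) ?_ (fun j => ?_) ?_
  · refine AEStronglyMeasurable.add (Finset.aestronglyMeasurable_fun_sum _ fun i _ => ?_) ?_
    · exact (((hsm j).continuous_fderiv (by simp)).clm_apply
        continuous_const).aestronglyMeasurable.mul (hA i).aestronglyMeasurable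
    · exact (hsm j).continuous.aestronglyMeasurable.mul hB.aestronglyMeasurable
  · exact (integrable_finsetSum _ fun i _ => (hA i).norm.const_mul _).add (hB.norm.const_mul _)
  · refine ae_of_all _ fun y => (norm_add_le _ _).trans (add_le_add ?_ ?_)
    · refine (norm_sum_le _ _).trans (Finset.sum_le_sum fun i _ => ?_)
      rw [norm_mul]
      refine mul_le_mul_of_nonneg_right ?_ (norm_nonneg _)
      refine (ContinuousLinearMap.le_opNorm _ _).trans ?_
      rw [fderiv_mollify _ hφ hc]
      simpa using mollify_norm_le (b j) hC₁ y
    · rw [norm_mul]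
      exact mul_le_mul_of_nonneg_right (mollify_norm_le (b j) hC₀ y) (norm_nonneg _)
  · refine ae_of_all _ fun y => Tendsto.add (tendsto_finsetSum _ fun i _ => ?_)
      ((hl0 y).mul_const _)
    exact (((ContinuousLinearMap.apply ℝ ℝ (EuclideanSpace.single i 1)).continuous.tendsto _).comp
      (hl1 y)).mul_const _

variable {V : Type*} [NormedAddCommGroup V] [NormedSpace ℝ V] {χ : ℕ → E n → ℝ}

theorem frontier_subset_closure_sdiff {x : E n} (hx : x ∉ frontier Ω) :
    frontier Ω ⊆ closure Ω \ {x} := fun y hy =>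
  ⟨frontier_subset_closure hy, fun h => hx (by rwa [mem_singleton_iff.1 h] at hy)⟩

/-- The gradients of the cutoff functions also converge weakly against functions that are continuous
up to the boundary except at one interior point. -/
theorem IsCutoffSeq.tendsto_integral_fderiv_smul_of_sdiff [CompleteSpace V] [FiniteDimensional ℝ V]
    (h : IsBoundedLipschitzDomain Ω) (hχ : IsCutoffSeq Ω χ) {x : E n} (hx : x ∉ frontier Ω)
    {F : E n → V} (hF : ContinuousOn F (closure Ω \ {x})) (a : E n) :
    Tendsto (fun k => ∫ y in Ω, fderiv ℝ (χ k) y a • F y) atTop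
      (𝓝 (-∫ y, inner ℝ (outwardNormal Ω y) a • F y ∂(surfaceMeasure Ω))) := by
  by_cases hxΩ : x ∈ Ω
  · obtain ⟨r, hr, hball⟩ := Metric.nhds_basis_closedBall.mem_iff.1 (h.isOpen.mem_nhds hxΩ)
    obtain ⟨θ, hθ, hθs, hθ1, -⟩ := exists_smooth_cutoff (K := {x}) isClosed_singleton
      Metric.isOpen_ball (singleton_subset_iff.2 (Metric.mem_ball_self hr))
    rw [nhdsSet_singleton] at hθ1
    -- Removing the singularity by `1 - θ` changes neither side of the limit: `θ` vanishes on the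
    -- boundary, and for large `k` the gradient of `χ k` vanishes on the ball that contains the
    -- support of `θ`.
    have hF' : ContinuousOn (fun y => (1 - θ y) • F y) (closure Ω) := by
      intro y hy
      by_cases hyx : y = x
      · subst hyx
        refine ContinuousAt.continuousWithinAt ?_
        refine ContinuousAt.congr (f := fun _ => (0 : V)) continuousAt_const ?_
        filter_upwards [hθ1] with z hz
        simp [hz]
      · have h1 : ContinuousWithinAt F (closure Ω) y :=
          (hF y ⟨hy, hyx⟩).mono_of_mem_nhdsWithin
            (inter_mem_nhdsWithin _ (isOpen_compl_singleton.mem_nhds hyx))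
        exact ((continuous_const.sub hθ.continuous).continuousWithinAt).smul h1
    have key := hχ.tendsto_integral_fderiv_smul h hF' a
    have e1 : ∫ y, inner ℝ (outwardNormal Ω y) a • (1 - θ y) • F y ∂(surfaceMeasure Ω) =
        ∫ y, inner ℝ (outwardNormal Ω y) a • F y ∂(surfaceMeasure Ω) := by
      refine setIntegral_congr_fun isClosed_frontier.measurableSet fun y hy => ?_
      have h0 : θ y = 0 := eq_zero_of_notMem hθs fun hyb =>
        (h.isOpen.frontier_eq ▸ hy).2 (hball (Metric.ball_subset_closedBall hyb))
      simp [h0]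
    rw [e1] at key
    refine key.congr' ?_
    filter_upwards [hχ.eventually_eq_one _ hball (isCompact_closedBall x r)] with k hk
    refine integral_congr_ae (ae_of_all _ fun y => ?_)
    by_cases hy : y ∈ Metric.ball x r
    · have h0 : fderiv ℝ (χ k) y = 0 := by
        have hev : χ k =ᶠ[𝓝 y] fun _ => 1 := by
          filter_upwards [Metric.isOpen_ball.mem_nhds hy] with z hz
            using hk z (Metric.ball_subset_closedBall hz)
        rw [hev.fderiv_eq]
        simp
      simp [h0]
    · simp [eq_zero_of_notMem hθs hy]
  · have hxc : x ∉ closure Ω := fun hc => hx (h.isOpen.frontier_eq ▸ ⟨hc, hxΩ⟩)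
    rw [sdiff_singleton_eq_self hxc] at hF
    exact hχ.tendsto_integral_fderiv_smul h hF a

/-- If `x` lies in `Ω`, local integrability covers a ball about `x`, and continuity covers the
compact remainder of the closure. Otherwise `x` is outside the closure and continuity alone
suffices. -/
theorem IsBoundedLipschitzDomain.integrableOn_of_sdiff (h : IsBoundedLipschitzDomain Ω)
    {V : Type*} [NormedAddCommGroup V] {x : E n} (hx : x ∉ frontier Ω) {F : E n → V}
    (hF : ContinuousOn F (closure Ω \ {x})) (hl : LocallyIntegrableOn F Ω) : IntegrableOn F Ω := by
  by_cases hxΩ : x ∈ Ω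
  · obtain ⟨s, hs, hsF⟩ := hl x hxΩ
    rw [h.isOpen.nhdsWithin_eq hxΩ] at hs
    obtain ⟨r, hr, hball⟩ := Metric.mem_nhds_iff.1 hs
    have hc : IsCompact (closure Ω \ Metric.ball x r) :=
      h.isCompact_closure.diff Metric.isOpen_ball
    have h1 : IntegrableOn F (closure Ω \ Metric.ball x r) := by
      refine (hF.mono fun y hy => ⟨hy.1, fun hyx => hy.2 ?_⟩).integrableOn_compact hc
      rw [mem_singleton_iff.1 hyx]
      exact Metric.mem_ball_self hr
    refine ((hsF.mono_set hball).union h1).mono_set fun y hy => ?_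
    by_cases hyb : y ∈ Metric.ball x r
    · exact Or.inl hyb
    · exact Or.inr ⟨subset_closure hy, hyb⟩
  · have hxc : x ∉ closure Ω := fun hc => hx (h.isOpen.frontier_eq ▸ ⟨hc, hxΩ⟩)
    rw [sdiff_singleton_eq_self hxc] at hF
    exact h.integrableOn_of_continuousOn hF

end

end Vekua

/-! ### Clifford-valued calculus and the pointwise Green identities. -/

namespace Vekua

section
variable {n : ℕ} {Ω : Set (E n)}

theorem HasFDerivAt.mul_cl {u v : E n → Cl n} {u' v' : E n →L[ℝ] Cl n} {y : E n}
    (hu : HasFDerivAt u u' y) (hv : HasFDerivAt v v' y) :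
    HasFDerivAt (fun y => u y * v y) ((mulL n).precompR (E n) (u y) v' +
      (mulL n).precompL (E n) u' (v y)) y :=
  (mulL n).hasFDerivAt_of_bilinear hu hv

theorem fderiv_mul_apply {u v : E n → Cl n} {y : E n} (hu : DifferentiableAt ℝ u y)
    (hv : DifferentiableAt ℝ v y) (a : E n) :
    fderiv ℝ (fun y => u y * v y) y a = u y * fderiv ℝ v y a + fderiv ℝ u y a * v y := by
  rw [(HasFDerivAt.mul_cl hu.hasFDerivAt hv.hasFDerivAt).fderiv]
  rfl

theorem ContDiffOn.mul_cl {u v : E n → Cl n} {s : Set (E n)} (hu : ContDiffOn ℝ 1 u s)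
    (hv : ContDiffOn ℝ 1 v s) : ContDiffOn ℝ 1 (fun y => u y * v y) s :=
  (mulL n).isBoundedBilinearMap.contDiff.comp_contDiffOn (hu.prodMk hv)

theorem fderiv_star_apply {u : E n → Cl n} {y : E n} (hu : DifferentiableAt ℝ u y) (a : E n) :
    fderiv ℝ (fun z => star (u z)) y a = star (fderiv ℝ u y a) := by
  have := ((starL n).hasFDerivAt.comp y hu.hasFDerivAt).fderiv
  exact congrArg (fun L => L a) this

theorem integrable_mul_bdd {μ : Measure (E n)} {f g : E n → Cl n} (hf : Integrable f μ)
    (hg : AEStronglyMeasurable g μ) {C : ℝ} (hC : ∀ᵐ y ∂μ, ‖g y‖ ≤ C) :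
    Integrable (fun y => f y * g y) μ := by
  refine Integrable.mono' (hf.norm.const_mul (‖mulL n‖ * C)) (hf.aestronglyMeasurable.mul hg) ?_
  filter_upwards [hC] with y hy
  calc ‖f y * g y‖ ≤ ‖mulL n‖ * ‖f y‖ * ‖g y‖ := norm_mul_le_mulL _ _
    _ ≤ ‖mulL n‖ * ‖f y‖ * C := by gcongr
    _ = _ := by ring

theorem integrable_bdd_mul {μ : Measure (E n)} {f g : E n → Cl n} (hf : Integrable f μ)
    (hg : AEStronglyMeasurable g μ) {C : ℝ} (hC : ∀ᵐ y ∂μ, ‖g y‖ ≤ C) :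
    Integrable (fun y => g y * f y) μ := by
  refine Integrable.mono' (hf.norm.const_mul (‖mulL n‖ * C)) (hg.mul hf.aestronglyMeasurable) ?_
  filter_upwards [hC] with y hy
  calc ‖g y * f y‖ ≤ ‖mulL n‖ * ‖g y‖ * ‖f y‖ := norm_mul_le_mulL _ _
    _ ≤ ‖mulL n‖ * C * ‖f y‖ := by gcongr

theorem integrable_star {μ : Measure (E n)} {f : E n → Cl n} (hf : Integrable f μ) :
    Integrable (fun y => star (f y)) μ := (starL n).integrable_comp hf

theorem exists_ae_bound (h : IsBoundedLipschitzDomain Ω) {F : E n → Cl n}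
    (hF : ContinuousOn F (closure Ω)) :
    AEStronglyMeasurable F (volume.restrict Ω) ∧ ∃ C, ∀ᵐ y ∂volume.restrict Ω, ‖F y‖ ≤ C := by
  refine ⟨(h.integrableOn_of_continuousOn hF).aestronglyMeasurable, ?_⟩
  obtain ⟨C, hC⟩ := h.isCompact_closure.exists_bound_of_continuousOn hF
  exact ⟨C, (ae_restrict_iff' h.isOpen.measurableSet).2
    (ae_of_all _ fun y hy => hC y (subset_closure hy))⟩

theorem exists_ae_bound_of_memLp {α : E n → Cl n} (hα : MemLp α ⊤ (volume.restrict Ω)) :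
    AEStronglyMeasurable α (volume.restrict Ω) ∧ ∃ C, ∀ᵐ y ∂volume.restrict Ω, ‖α y‖ ≤ C := by
  refine ⟨hα.aestronglyMeasurable, (eLpNormEssSup α (volume.restrict Ω)).toReal, ?_⟩
  exact ae_le_eLpNormEssSup.mono fun y hy => by
    have h1 := hα.eLpNorm_lt_top
    rw [eLpNorm_exponent_top] at h1
    have := ENNReal.toReal_mono h1.ne hy
    simpa using this

/-- The partial derivatives of a function in `C¹(Ω̄)`, extended continuously to `Ω̄`. -/
theorem IsC1Closure.exists_partials {w : E n → Cl n} (hw : IsC1Closure Ω w) :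
    ∃ w' : Fin n → E n → Cl n, (∀ i, ContinuousOn (w' i) (closure Ω)) ∧
      ∀ i, ∀ y ∈ Ω, fderiv ℝ w y (EuclideanSpace.single i 1) = w' i y := by
  obtain ⟨w', hc, he⟩ := hw.exists_extension
  refine ⟨fun i y => w' y (EuclideanSpace.single i 1), fun i => hc.clm_apply continuousOn_const,
    fun i y hy => ?_⟩
  change _ = w' y _
  rw [he hy]

theorem IsC1Closure.differentiableAt (h : IsBoundedLipschitzDomain Ω) {w : E n → Cl n}
    (hw : IsC1Closure Ω w) {y : E n} (hy : y ∈ Ω) : DifferentiableAt ℝ w y :=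
  (hw.contDiffOn.differentiableOn one_ne_zero).differentiableAt (h.isOpen.mem_nhds hy)

theorem mul_η_mul (Ω : Set (E n)) (a b : Cl n) (y : E n) :
    a * η Ω y * b =
      ∑ i, inner ℝ (outwardNormal Ω y) (EuclideanSpace.single i 1) • (a * (e i * b)) := by
  rw [η_eq_sum, Finset.mul_sum, Finset.sum_mul]
  refine Finset.sum_congr rfl fun i _ => ?_
  rw [mul_smul_comm, smul_mul_assoc, mul_assoc]

theorem IsBoundedLipschitzDomain.integrable_mul_η_mul (h : IsBoundedLipschitzDomain Ω)
    {u v : E n → Cl n} (hu : ContinuousOn u (frontier Ω)) (hv : ContinuousOn v (frontier Ω)) :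
    Integrable (fun y => u y * η Ω y * v y) (surfaceMeasure Ω) := by
  simp only [mul_η_mul]
  exact integrable_finsetSum _ fun i _ => h.integrable_normal_smul
    (F := fun y => u y * (e i * v y)) (hu.mul (continuousOn_const.mul hv)) _

theorem IsBoundedLipschitzDomain.integral_mul_η_mul (h : IsBoundedLipschitzDomain Ω)
    {u v : E n → Cl n} (hu : ContinuousOn u (frontier Ω)) (hv : ContinuousOn v (frontier Ω)) :
    ∫ y, u y * η Ω y * v y ∂(surfaceMeasure Ω) =
      ∑ i, ∫ y, inner ℝ (outwardNormal Ω y) (EuclideanSpace.single i 1) • (u y * (e i * v y))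
        ∂(surfaceMeasure Ω) := by
  simp only [mul_η_mul]
  exact integral_finsetSum _ fun i _ => h.integrable_normal_smul
    (F := fun y => u y * (e i * v y)) (hu.mul (continuousOn_const.mul hv)) _

theorem sc_add (a b : Cl n) : Sc (a + b) = Sc a + Sc b := map_add (scL n) a b

theorem sc_sub (a b : Cl n) : Sc (a - b) = Sc a - Sc b := map_sub (scL n) a b

theorem sc_neg (a : Cl n) : Sc (-a) = -Sc a := map_neg (scL n) a

theorem sc_smul (r : ℝ) (a : Cl n) : Sc (r • a) = r * Sc a := map_smul (scL n) r a

theorem sc_sum (f : Fin n → Cl n) : Sc (∑ i, f i) = ∑ i, Sc (f i) := map_sum (scL n) f _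

theorem sc_integral {μ : Measure (E n)} {f : E n → Cl n} (hf : Integrable f μ) :
    Sc (∫ y, f y ∂μ) = ∫ y, Sc (f y) ∂μ := ((scL n).integral_comp_comm hf).symm

theorem integrable_sc {μ : Measure (E n)} {f : E n → Cl n} (hf : Integrable f μ) :
    Integrable (fun y => Sc (f y)) μ := (scL n).integrable_comp hf

theorem dirac_star {u : E n → Cl n} {y : E n} (hu : DifferentiableAt ℝ u y) :
    dirac (fun z => star (u z)) y =
      ∑ i, e i * star (fderiv ℝ u y (EuclideanSpace.single i 1)) := by
  simp only [dirac, fderiv_star_apply hu]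

/-- Conjugate inside the scalar part, then cycle the factors; the sign is that of `star (e i) = -e
i`. With `U i = ∂ᵢu` this turns the term with `D ū` into the half of the product rule where the
derivative falls on `u`. -/
theorem sc_sum_e_mul_star_mul_star (U : Fin n → Cl n) (b : Cl n) :
    Sc ((∑ i, e i * star (U i)) * star b) = -∑ i, Sc (U i * (e i * b)) := by
  rw [← sc_star, star_mul, star_star, star_sum, sc_mul_comm, Finset.sum_mul, sc_sum,
    ← Finset.sum_neg_distrib]
  refine Finset.sum_congr rfl fun i _ => ?_
  rw [star_mul, star_star, star_e, ← sc_neg]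
  congr 1
  simp [mul_assoc]

/-- The first pointwise identity behind the integral formulas. -/
theorem sc_green_mulConj (a b c : Cl n) (U V' : Fin n → Cl n) :
    Sc (a * ((∑ i, e i * V' i) - c * star b) -
      ((∑ i, e i * star (U i)) - star (star a) * c) * star b) =
      ∑ i, Sc (a * (e i * V' i) + U i * (e i * b)) := by
  have h1 := sc_sum_e_mul_star_mul_star U b
  rw [star_star, sc_sub, mul_sub, sub_mul, sc_sub, sc_sub, h1, Finset.mul_sum, sc_sum, mul_assoc]
  simp only [sc_add, Finset.sum_add_distrib]
  ring

/-- The second pointwise identity behind the integral formulas. -/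
theorem sc_green_conjMul (a b c : Cl n) (U V' : Fin n → Cl n) :
    Sc (a * ((∑ i, e i * V' i) - star b * c) -
      ((∑ i, e i * star (U i)) - c * star (star a)) * star b) =
      ∑ i, Sc (a * (e i * V' i) + U i * (e i * b)) := by
  have h1 := sc_sum_e_mul_star_mul_star U b
  -- In the first identity the zero-order terms cancel by associativity alone; here they are `a b̄
  -- c` and `c a b̄`, whose scalar parts agree by cyclicity.
  rw [star_star, sc_sub, mul_sub, sub_mul, sc_sub, sc_sub, h1, Finset.mul_sum, sc_sum, mul_assoc c,
    sc_mul_comm c, ← mul_assoc a]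
  simp only [sc_add, Finset.sum_add_distrib]
  ring

/-- The scalar part of the integral of `u ds* v`. -/
theorem sc_integral_surface (h : IsBoundedLipschitzDomain Ω) (hn : 1 ≤ n) {u v : E n → Cl n}
    (hu : IsC1Closure Ω u) (hv : IsC1Closure Ω v) :
    Sc (∫ y, u y * η Ω y * v y ∂(surfaceMeasure Ω)) =
      ∫ y in Ω, ∑ i, Sc (u y * (e i * fderiv ℝ v y (EuclideanSpace.single i 1)) +
        fderiv ℝ u y (EuclideanSpace.single i 1) * (e i * v y)) := by
  obtain ⟨u', hu'c, hu'⟩ := hu.exists_partials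
  obtain ⟨v', hv'c, hv'⟩ := hv.exists_partials
  have hd : ∀ i, ∀ y ∈ Ω, fderiv ℝ (fun y => u y * (e i * v y)) y (EuclideanSpace.single i 1) =
      u y * (e i * v' i y) + u' i y * (e i * v y) := by
    intro i y hy
    have h1 := hu.differentiableAt h hy
    have h2 := hv.differentiableAt h hy
    have h3 := (HasFDerivAt.mul_cl (hasFDerivAt_const (e i) y) h2.hasFDerivAt).differentiableAt
    rw [fderiv_mul_apply h1 h3, fderiv_mul_apply (differentiableAt_const _) h2, hu' i y hy,
      hv' i y hy]
    simp
  have hi : ∀ i, IntegrableOn (fun y => u y * (e i * v' i y) + u' i y * (e i * v y)) Ω := fun i =>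
    h.integrableOn_of_continuousOn ((hu.continuousOn.mul (continuousOn_const.mul (hv'c i))).add
      ((hu'c i).mul (continuousOn_const.mul hv.continuousOn)))
  have hi' : ∀ i, IntegrableOn
      (fun y => fderiv ℝ (fun y => u y * (e i * v y)) y (EuclideanSpace.single i 1)) Ω := fun i =>
    (hi i).congr_fun (fun y hy => (hd i y hy).symm) h.isOpen.measurableSet
  rw [h.integral_mul_η_mul (hu.continuousOn.mono frontier_subset_closure)
    (hv.continuousOn.mono frontier_subset_closure), sc_sum]
  have hsum : ∀ i, Sc (∫ y, inner ℝ (outwardNormal Ω y) (EuclideanSpace.single i 1) •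
      (u y * (e i * v y)) ∂(surfaceMeasure Ω)) =
      ∫ y in Ω, Sc (u y * (e i * v' i y) + u' i y * (e i * v y)) := by
    intro i
    rw [← h.integral_fderiv_of_contDiffOn hn (w := fun y => u y * (e i * v y))
      (ContDiffOn.mul_cl hu.contDiffOn (ContDiffOn.mul_cl contDiffOn_const hv.contDiffOn))
      (hu.continuousOn.mul (continuousOn_const.mul hv.continuousOn)) _ (hi' i),
      sc_integral (hi' i)]
    exact setIntegral_congr_fun h.isOpen.measurableSet fun y hy => by rw [hd i y hy]
  simp only [hsum]
  rw [← integral_finsetSum _ fun i _ => integrable_sc (hi i)]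
  refine setIntegral_congr_fun h.isOpen.measurableSet fun y hy => ?_
  simp only [hu' _ y hy, hv' _ y hy]

end

end Vekua

/-! ### The integral formulas for `D - αC` and `D - M^α C`. -/

namespace Vekua

section
variable {n : ℕ} {Ω : Set (E n)}

theorem dirac_continuous_extension (h : IsBoundedLipschitzDomain Ω) {v : E n → Cl n}
    (hv : IsC1Closure Ω v) : IntegrableOn (dirac v) Ω ∧
      ∃ C, ∀ᵐ y ∂volume.restrict Ω, ‖dirac v y‖ ≤ C := by
  obtain ⟨v', hv'c, hv'⟩ := hv.exists_partials
  have hc : ContinuousOn (fun y => ∑ i, e i * v' i y) (closure Ω) :=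
    continuousOn_finsetSum _ fun i _ => continuousOn_const.mul (hv'c i)
  have he : EqOn (fun y => ∑ i, e i * v' i y) (dirac v) Ω := fun y hy => by
    simp only [dirac, hv' _ y hy]
  obtain ⟨-, C, hC⟩ := exists_ae_bound h hc
  refine ⟨(h.integrableOn_of_continuousOn hc).congr_fun he h.isOpen.measurableSet, C, ?_⟩
  filter_upwards [hC, ae_restrict_mem h.isOpen.measurableSet] with y hy hyΩ
  rw [← he hyΩ]
  exact hy

theorem ae_bound_mul {f g : E n → Cl n} {μ : Measure (E n)} (hf : ∃ C, ∀ᵐ y ∂μ, ‖f y‖ ≤ C)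
    (hg : ∃ C, ∀ᵐ y ∂μ, ‖g y‖ ≤ C) : ∃ C, ∀ᵐ y ∂μ, ‖f y * g y‖ ≤ C := by
  obtain ⟨C, hC⟩ := hf
  obtain ⟨C', hC'⟩ := hg
  refine ⟨‖mulL n‖ * C * C', ?_⟩
  filter_upwards [hC, hC'] with y h1 h2
  have : 0 ≤ C := (norm_nonneg _).trans h1
  calc ‖f y * g y‖ ≤ ‖mulL n‖ * ‖f y‖ * ‖g y‖ := norm_mul_le_mulL _ _
    _ ≤ _ := by gcongr

theorem ae_bound_star {f : E n → Cl n} {μ : Measure (E n)} (hf : ∃ C, ∀ᵐ y ∂μ, ‖f y‖ ≤ C) :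
    ∃ C, ∀ᵐ y ∂μ, ‖star (f y)‖ ≤ C := by
  obtain ⟨C, hC⟩ := hf
  refine ⟨‖starL n‖ * C, ?_⟩
  filter_upwards [hC] with y h1
  exact (norm_star_le_starL _).trans (by gcongr)

theorem ae_bound_sub {f g : E n → Cl n} {μ : Measure (E n)} (hf : ∃ C, ∀ᵐ y ∂μ, ‖f y‖ ≤ C)
    (hg : ∃ C, ∀ᵐ y ∂μ, ‖g y‖ ≤ C) : ∃ C, ∀ᵐ y ∂μ, ‖f y - g y‖ ≤ C := by
  obtain ⟨C, hC⟩ := hf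
  obtain ⟨C', hC'⟩ := hg
  refine ⟨C + C', ?_⟩
  filter_upwards [hC, hC'] with y h1 h2
  exact (norm_sub_le _ _).trans (add_le_add h1 h2)

/-- The operator `T` is multiplication of the conjugate by a bounded function, from the left or from
the right. -/
def IsBoundedConj (Ω : Set (E n)) (T : (E n → Cl n) → E n → Cl n) : Prop :=
  ∃ α : E n → Cl n, MemLp α ⊤ (volume.restrict Ω) ∧ (T = mulConj α ∨ T = conjMul α)

theorem IsBoundedConj.integrableOn {T : (E n → Cl n) → E n → Cl n} (hT : IsBoundedConj Ω T)
    {g : E n → Cl n} (hg : IntegrableOn g Ω) : IntegrableOn (T g) Ω := by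
  obtain ⟨α, hα, hT⟩ := hT
  obtain ⟨hm, C, hC⟩ := exists_ae_bound_of_memLp hα
  rcases hT with rfl | rfl
  · exact integrable_bdd_mul (integrable_star hg) hm hC
  · exact integrable_mul_bdd (integrable_star hg) hm hC

theorem IsBoundedConj.ae_bound {T : (E n → Cl n) → E n → Cl n} (hT : IsBoundedConj Ω T)
    {g : E n → Cl n} (hg : ∃ C, ∀ᵐ y ∂volume.restrict Ω, ‖g y‖ ≤ C) :
    ∃ C, ∀ᵐ y ∂volume.restrict Ω, ‖T g y‖ ≤ C := by
  obtain ⟨α, hα, hT⟩ := hT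
  obtain ⟨-, hC⟩ := exists_ae_bound_of_memLp hα
  rcases hT with rfl | rfl
  · exact ae_bound_mul hC (ae_bound_star hg)
  · exact ae_bound_mul (ae_bound_star hg) hC

theorem diracSub_bounded (h : IsBoundedLipschitzDomain Ω) {v : E n → Cl n} (hv : IsC1Closure Ω v)
    {T : (E n → Cl n) → E n → Cl n} (hT : IsBoundedConj Ω T) :
    IntegrableOn (diracSub T v) Ω ∧ ∃ C, ∀ᵐ y ∂volume.restrict Ω, ‖diracSub T v y‖ ≤ C := by
  obtain ⟨h1, h2⟩ := dirac_continuous_extension h hv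
  exact ⟨h1.sub (hT.integrableOn (h.integrableOn_of_continuousOn hv.continuousOn)),
    ae_bound_sub h2 (hT.ae_bound (exists_ae_bound h hv.continuousOn).2)⟩

theorem IsC1Closure.star {u : E n → Cl n} (hu : IsC1Closure Ω u) (h : IsBoundedLipschitzDomain Ω) :
    IsC1Closure Ω fun y => star (u y) := by
  refine ⟨(starL n).contDiff.comp_contDiffOn hu.contDiffOn, hu.continuousOn.star, ?_⟩
  obtain ⟨w', hc, he⟩ := hu.exists_extension
  refine ⟨fun y => (starL n).comp (w' y), continuousOn_const.clm_comp hc, fun y hy => ?_⟩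
  have h1 := ((starL n).hasFDerivAt.comp y (hu.differentiableAt h hy).hasFDerivAt).fderiv
  exact (h1.trans (by rw [← he hy])).symm

/-- Integrability of the right-hand sides of the integral formulas. -/
theorem integrableOn_green (h : IsBoundedLipschitzDomain Ω) {u v : E n → Cl n}
    (hu : IsC1Closure Ω u) (hv : IsC1Closure Ω v) {T T' : (E n → Cl n) → E n → Cl n}
    (hT : IsBoundedConj Ω T) (hT' : IsBoundedConj Ω T') :
    IntegrableOn (fun y => u y * diracSub T v y -
      diracSub T' (fun z => star (u z)) y * star (v y)) Ω := by
  obtain ⟨hum, Cu, hCu⟩ := exists_ae_bound h hu.continuousOn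
  obtain ⟨hvm, Cv, hCv⟩ := exists_ae_bound h hv.continuousOn.star
  exact (integrable_bdd_mul (diracSub_bounded h hv hT).1 hum hCu).sub
    (integrable_mul_bdd (diracSub_bounded h (hu.star h) hT').1 hvm hCv)

/-- The integral formula for `D - αC` and `D - M^α C`. -/
theorem sc_green_formula_mulConj (h : IsBoundedLipschitzDomain Ω) (hn : 1 ≤ n) {u v : E n → Cl n}
    (hu : IsC1Closure Ω u) (hv : IsC1Closure Ω v) {α : E n → Cl n}
    (hα : MemLp α ⊤ (volume.restrict Ω)) :
    Sc (∫ y, u y * η Ω y * v y ∂(surfaceMeasure Ω)) =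
      Sc (∫ y in Ω, (u y * diracSub (mulConj α) v y
        - diracSub (conjMul α) (fun z => star (u z)) y * star (v y))) := by
  rw [sc_integral_surface h hn hu hv, sc_integral (integrableOn_green h hu hv
    ⟨α, hα, Or.inl rfl⟩ ⟨α, hα, Or.inr rfl⟩)]
  refine setIntegral_congr_fun h.isOpen.measurableSet fun y hy => ?_
  simp only [diracSub, mulConj, conjMul, dirac_star (hu.differentiableAt h hy)]
  exact (sc_green_mulConj _ _ _ _ _).symm

/-- The integral formula for `D - M^α C` and `D - αC`. -/
theorem sc_green_formula_conjMul (h : IsBoundedLipschitzDomain Ω) (hn : 1 ≤ n) {u v : E n → Cl n}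
    (hu : IsC1Closure Ω u) (hv : IsC1Closure Ω v) {α : E n → Cl n}
    (hα : MemLp α ⊤ (volume.restrict Ω)) :
    Sc (∫ y, u y * η Ω y * v y ∂(surfaceMeasure Ω)) =
      Sc (∫ y in Ω, (u y * diracSub (conjMul α) v y
        - diracSub (mulConj α) (fun z => star (u z)) y * star (v y))) := by
  rw [sc_integral_surface h hn hu hv, sc_integral (integrableOn_green h hu hv
    ⟨α, hα, Or.inr rfl⟩ ⟨α, hα, Or.inl rfl⟩)]
  refine setIntegral_congr_fun h.isOpen.measurableSet fun y hy => ?_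
  simp only [diracSub, mulConj, conjMul, dirac_star (hu.differentiableAt h hy)]
  exact (sc_green_conjMul _ _ _ _ _).symm

/-! ### Fundamental solutions and recovery of the scalar part. -/

/-- Reassembles a Clifford-valued test function from equations tested coordinate by coordinate
against the basis elements. -/
theorem sum_repr_mul_sc (a b : Cl n) :
    ∑ A, (basisCl n).coord A b * Sc (a * basisCl n A) = Sc (a * b) := by
  conv_rhs => rw [← (basisCl n).sum_repr b, Finset.mul_sum]
  rw [show Sc (∑ A, a * (basisCl n).repr b A • basisCl n A) = _ from map_sum (scL n) _ _]
  refine Finset.sum_congr rfl fun A _ => ?_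
  rw [mul_smul_comm, map_smul]
  rfl

/-- The `A`-th coordinate as a continuous linear form. -/
noncomputable def coordL (n : ℕ) (A : Finset (Fin n)) : Cl n →L[ℝ] ℝ :=
  LinearMap.toContinuousLinearMap ((basisCl n).coord A)

theorem integrable_mul_const {μ : Measure (E n)} {f : E n → Cl n} (hf : Integrable f μ)
    (c : Cl n) : Integrable (fun y => f y * c) μ :=
  integrable_mul_bdd hf aestronglyMeasurable_const (ae_of_all _ fun _ => le_rfl)

theorem integrable_const_mul' {μ : Measure (E n)} {f : E n → Cl n} (hf : Integrable f μ)
    (c : Cl n) : Integrable (fun y => c * f y) μ :=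
  integrable_bdd_mul hf aestronglyMeasurable_const (ae_of_all _ fun _ => le_rfl)

section
variable {T T' : (E n → Cl n) → E n → Cl n} {x : E n} {G : E n → Cl n}

theorem integrableOn_test {f : E n → ℝ} {F : E n → Cl n} (hf : Continuous f)
    (hc : HasCompactSupport f) (hF : IntegrableOn F Ω) :
    IntegrableOn (fun y => f y • F y) Ω := by
  obtain ⟨C, hC⟩ := hc.exists_bound_of_continuous hf
  exact hF.bdd_smul C hf.aestronglyMeasurable (ae_of_all _ hC)

theorem continuous_fderiv_apply {φ : E n → ℝ} (hφ : ContDiff ℝ 1 φ) (a : E n) :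
    Continuous fun y => fderiv ℝ φ y a :=
  (hφ.continuous_fderiv one_ne_zero).clm_apply continuous_const

theorem hasCompactSupport_fderiv_apply {φ : E n → ℝ} (hc : HasCompactSupport φ) (a : E n) :
    HasCompactSupport fun y => fderiv ℝ φ y a :=
  (hc.fderiv (𝕜 := ℝ)).comp_left (g := fun L : E n →L[ℝ] ℝ => L a) rfl

/-- The scalar form of the equation `(D - T) (-Ḡ) = δₓ`, for smooth test functions. -/
theorem IsFundamentalSolution.sc_equation_smooth (hT : IsBoundedConj Ω T)
    (hG : IntegrableOn G Ω) (hfs : IsFundamentalSolution Ω T x fun y => -star (G y)) (c : Cl n)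
    {φ : E n → ℝ} (hφ : ContDiff ℝ ∞ φ) (hc : HasCompactSupport φ) (hs : tsupport φ ⊆ Ω) :
    ∫ y in Ω, (∑ i, fderiv ℝ φ y (EuclideanSpace.single i 1) * Sc (G y * e i * c) +
      φ y * Sc (star (T (fun y => -star (G y)) y) * c)) = φ x * -Sc c := by
  have h0 := hfs.eq_delta φ hφ hc hs
  have hφ1 : ContDiff ℝ 1 φ := hφ.of_le (by exact_mod_cast le_top)
  have hg : IntegrableOn (fun y => -star (G y)) Ω := (integrable_star hG).neg
  have hi1 : ∀ i, IntegrableOn (fun y => fderiv ℝ φ y (EuclideanSpace.single i 1) •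
      (e i * -star (G y))) Ω := fun i =>
    integrableOn_test (continuous_fderiv_apply hφ1 _) (hasCompactSupport_fderiv_apply hc _)
      (integrable_const_mul' hg _)
  have hi2 : IntegrableOn (fun y => φ y • T (fun y => -star (G y)) y) Ω :=
    integrableOn_test hφ.continuous hc (hT.integrableOn hg)
  have hi12 : IntegrableOn (fun y =>
      ∑ i, fderiv ℝ φ y (EuclideanSpace.single i 1) • (e i * -star (G y)) +
        φ y • T (fun y => -star (G y)) y) Ω :=
    (integrable_finsetSum _ fun i _ => hi1 i).add hi2
  -- Conjugation turns `eᵢ (-Ḡ)` into `G eᵢ`, so this functional rewrites the vector equation for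
  -- `-Ḡ` as a scalar one for `G`.
  set L : Cl n →L[ℝ] ℝ := (scL n).comp (((mulL n).flip c).comp (starL n)) with hL
  have hLa : ∀ a, L a = Sc (star a * c) := fun a => rfl
  have h2 : ∀ y, L (∑ i, fderiv ℝ φ y (EuclideanSpace.single i 1) • (e i * -star (G y)) +
      φ y • T (fun y => -star (G y)) y) =
      ∑ i, fderiv ℝ φ y (EuclideanSpace.single i 1) * Sc (G y * e i * c) +
        φ y * Sc (star (T (fun y => -star (G y)) y) * c) := by
    intro y
    rw [map_add, map_sum, map_smul, hLa, smul_eq_mul]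
    congr 1
    refine Finset.sum_congr rfl fun i _ => ?_
    rw [map_smul, hLa, smul_eq_mul, star_mul, star_neg, star_star, star_e]
    simp
  have h3 : -L (-(∫ y in Ω, ∑ i, fderiv ℝ φ y (EuclideanSpace.single i 1) • (e i * -star (G y)))
      - ∫ y in Ω, φ y • T (fun y => -star (G y)) y) =
      ∫ y in Ω, L (∑ i, fderiv ℝ φ y (EuclideanSpace.single i 1) • (e i * -star (G y)) +
        φ y • T (fun y => -star (G y)) y) := by
    rw [L.integral_comp_comm hi12, integral_add (integrable_finsetSum _ fun i _ => hi1 i) hi2,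
      ← map_neg]
    congr 1
    abel
  simp only [h2] at h3
  rw [← h3, h0, map_smul, hLa, star_one, one_mul, smul_eq_mul, mul_neg]

/-- The scalar form of the equation `(D - T) (-Ḡ) = δₓ`, for test functions in `C¹`. -/
theorem IsFundamentalSolution.sc_equation (hΩ : IsOpen Ω) (hT : IsBoundedConj Ω T)
    (hG : IntegrableOn G Ω) (hfs : IsFundamentalSolution Ω T x fun y => -star (G y)) (c : Cl n)
    {φ : E n → ℝ} (hφ : ContDiff ℝ 1 φ) (hc : HasCompactSupport φ) (hs : tsupport φ ⊆ Ω) :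
    ∫ y in Ω, (∑ i, fderiv ℝ φ y (EuclideanSpace.single i 1) * Sc (G y * e i * c) +
      φ y * Sc (star (T (fun y => -star (G y)) y) * c)) = φ x * -Sc c :=
  weak_equation_of_contDiff_one hΩ
    (fun _ => integrable_sc (integrable_mul_const (integrable_mul_const hG _) c))
    (integrable_sc (integrable_mul_const
      (integrable_star (hT.integrableOn (integrable_star hG).neg)) c))
    (fun _ h1 h2 h3 => hfs.sc_equation_smooth hT hG c h1 h2 h3) hφ hc hs

/-- The equation `(D - T) (-Ḡ) = δₓ` tested against Clifford-valued functions in `C¹`. -/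
theorem IsFundamentalSolution.sc_equation_cl (hΩ : IsOpen Ω) (hT : IsBoundedConj Ω T)
    (hG : IntegrableOn G Ω) (hfs : IsFundamentalSolution Ω T x fun y => -star (G y))
    {w : E n → Cl n} (hw : ContDiff ℝ 1 w) (hc : HasCompactSupport w) (hs : tsupport w ⊆ Ω) :
    ∫ y in Ω, (Sc (G y * dirac w y) + Sc (star (T (fun y => -star (G y)) y) * w y)) =
      -Sc (w x) := by
  have hA : ∀ A, ∀ y a, fderiv ℝ (fun y => coordL n A (w y)) y a = coordL n A (fderiv ℝ w y a) := by
    intro A y a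
    have := ((coordL n A).hasFDerivAt.comp y (hw.differentiable one_ne_zero y).hasFDerivAt).fderiv
    exact congrArg (fun L => L a) this
  have hwA : ∀ A, ContDiff ℝ 1 fun y => coordL n A (w y) := fun A => (coordL n A).contDiff.comp hw
  have hcA : ∀ A, HasCompactSupport fun y => coordL n A (w y) := fun A =>
    hc.comp_left (map_zero (coordL n A))
  have hsA : ∀ A, tsupport (fun y => coordL n A (w y)) ⊆ Ω := fun A =>
    (tsupport_comp_subset (map_zero (coordL n A)) w).trans hs
  have hg : IntegrableOn (fun y => -star (G y)) Ω := (integrable_star hG).neg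
  -- The `A`-th coordinate of `w` serves as a real test function, with constant `c = e_A`; summing
  -- over `A` restores `w`.
  have key := fun A => hfs.sc_equation hΩ hT hG (basisCl n A) (hwA A) (hcA A) (hsA A)
  have hi : ∀ A, IntegrableOn (fun y =>
      ∑ i, fderiv ℝ (fun y => coordL n A (w y)) y (EuclideanSpace.single i 1) *
        Sc (G y * e i * basisCl n A) +
      coordL n A (w y) * Sc (star (T (fun y => -star (G y)) y) * basisCl n A)) Ω := by
    intro A
    refine Integrable.add (integrable_finsetSum _ fun i _ => ?_) ?_
    · have := integrable_sc (integrableOn_test (continuous_fderiv_apply (hwA A) _)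
        (hasCompactSupport_fderiv_apply (hcA A) (EuclideanSpace.single i 1))
        (integrable_mul_const (integrable_mul_const hG (e i)) (basisCl n A)))
      simpa only [sc_smul] using this
    · have := integrable_sc (integrableOn_test (hwA A).continuous (hcA A)
        (integrable_mul_const (integrable_star (hT.integrableOn hg))
          (basisCl n A)))
      simpa only [sc_smul] using this
  have hsum := Finset.sum_congr (rfl : (Finset.univ : Finset (Finset (Fin n))) = _)
    fun A _ => key A
  rw [← integral_finsetSum _ fun A _ => hi A] at hsum
  have h1 : ∑ A, coordL n A (w x) * -Sc (basisCl n A) = -Sc (w x) := by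
    have := sum_repr_mul_sc 1 (w x)
    simp only [one_mul] at this
    rw [← this, ← Finset.sum_neg_distrib]
    exact Finset.sum_congr rfl fun A _ => mul_neg _ _
  rw [h1] at hsum
  rw [← hsum]
  refine integral_congr_ae (ae_of_all _ fun y => ?_)
  simp only [hA]
  rw [Finset.sum_add_distrib, Finset.sum_comm, dirac, Finset.mul_sum, sc_sum]
  congr 1
  · refine Finset.sum_congr rfl fun i _ => ?_
    rw [← mul_assoc]
    exact (sum_repr_mul_sc _ _).symm
  · exact (sum_repr_mul_sc _ _).symm

/-- Recovery of the scalar part from a fundamental solution, in terms of a pair of operators `T`,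
`T'` that are adjoint with respect to the scalar part. -/
theorem IsFundamentalSolution.recovery (h : IsBoundedLipschitzDomain Ω) (hn : 1 ≤ n)
    {v : E n → Cl n} (hv : IsC1Closure Ω v) (hT : IsBoundedConj Ω T) (hT' : IsBoundedConj Ω T')
    (hx : x ∉ frontier Ω) (hfs : IsFundamentalSolution Ω T x fun y => -star (G y))
    (hGc : ContinuousOn G (closure Ω \ {x}))
    (hTT' : ∀ y, Sc (star (T (fun y => -star (G y)) y) * v y) = -Sc (G y * T' v y)) :
    Integrable (fun y => G y * η Ω y * v y) (surfaceMeasure Ω) ∧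
      IntegrableOn (fun y => G y * diracSub T' v y) Ω ∧
      (x ∈ Ω → Sc (∫ y, G y * η Ω y * v y ∂(surfaceMeasure Ω)) -
        Sc (∫ y in Ω, G y * diracSub T' v y) = Sc (v x)) ∧
      (x ∉ closure Ω → Sc (∫ y, G y * η Ω y * v y ∂(surfaceMeasure Ω)) -
        Sc (∫ y in Ω, G y * diracSub T' v y) = 0) := by
  have hGf : ContinuousOn G (frontier Ω) := hGc.mono (frontier_subset_closure_sdiff hx)
  have hvf := hv.continuousOn.mono frontier_subset_closure
  have hGi : IntegrableOn G Ω := by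
    refine h.integrableOn_of_sdiff hx hGc fun y hy => ?_
    obtain ⟨s, hs, hi⟩ := hfs.locallyIntegrableOn y hy
    refine ⟨s, hs, (integrable_star hi).neg.congr (ae_of_all _ fun z => ?_)⟩
    simp
  obtain ⟨hDi, CD, hCD⟩ := diracSub_bounded h hv hT'
  have hint : IntegrableOn (fun y => G y * diracSub T' v y) Ω :=
    integrable_mul_bdd hGi hDi.aestronglyMeasurable hCD
  obtain ⟨χ, hχ⟩ := h.exists_cutoffSeq hn
  obtain ⟨hvm, Cv, hCv⟩ := exists_ae_bound h hv.continuousOn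
  have hFi : ∀ i, IntegrableOn (fun y => G y * (e i * v y)) Ω := fun i => by
    simp only [← mul_assoc]
    exact integrable_mul_bdd (integrable_mul_const hGi (e i)) hvm hCv
  -- The equation tested against `χ k • v`. The product rule separates the gradient of the cutoff,
  -- and adjointness moves the zero-order term from `G` onto `v`.
  have hcut : ∀ k, Sc (∫ y in Ω, χ k y • (G y * diracSub T' v y)) +
      ∑ i, Sc (∫ y in Ω, fderiv ℝ (χ k) y (EuclideanSpace.single i 1) • (G y * (e i * v y))) =
      -(χ k x * Sc (v x)) := by
    intro k
    have hF : ∀ i, IntegrableOn (fun y => fderiv ℝ (χ k) y (EuclideanSpace.single i 1) •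
        (G y * (e i * v y))) Ω := fun i =>
      integrableOn_test (continuous_fderiv_apply (hχ.contDiff_one k) _)
        (hasCompactSupport_fderiv_apply (hχ.hasCompactSupport k) _) (hFi i)
    have h1 := hfs.sc_equation_cl h.isOpen hT hGi
      (contDiff_smul_of_tsupport_subset h.isOpen (hχ.contDiff_one k) (hχ.tsupport_subset k)
        hv.contDiffOn) ((hχ.hasCompactSupport k).smul_right (f' := v))
      ((tsupport_smul_subset v).trans (hχ.tsupport_subset k))
    rw [sc_smul] at h1
    rw [← h1, sc_integral (hχ.integrableOn_smul hint k)]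
    simp only [fun i => sc_integral (hF i)]
    rw [← integral_finsetSum _ fun i _ => integrable_sc (hF i),
      ← integral_add (integrable_sc (hχ.integrableOn_smul hint k))
        (integrable_finsetSum _ fun i _ => integrable_sc (hF i))]
    refine setIntegral_congr_fun h.isOpen.measurableSet fun y hy => ?_
    simp only [dirac, diracSub,
      fderiv_smul_apply h.isOpen (hχ.contDiff_one k) hv.contDiffOn hy, mul_add, mul_smul_comm,
      Finset.sum_add_distrib, Finset.mul_sum, sc_add, sc_sum, sc_smul, mul_sub, sc_sub, hTT' y]
    simp only [← Finset.mul_sum]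
    ring
  have hlim1 := (hχ.tendsto_integral_smul h.isOpen hint)
  have hlim2 := fun i => hχ.tendsto_integral_fderiv_smul_of_sdiff h hx
    (F := fun y => G y * (e i * v y))
    (hGc.mul (continuousOn_const.mul (hv.continuousOn.mono sdiff_subset)))
    (EuclideanSpace.single i 1)
  have hlim := (((scL n).continuous.tendsto _).comp hlim1).add
    (tendsto_finsetSum Finset.univ fun i _ => ((scL n).continuous.tendsto _).comp (hlim2 i))
  have hlim' := (hlim.congr fun k => hcut k)
  -- The position of `x` enters only through the eventual value of `χ k x`: `1` for `x` in `Ω`, `0`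
  -- for `x` outside the closure.
  have hval : ∀ r : ℝ, (∀ᶠ k in atTop, χ k x * Sc (v x) = r) →
      Sc (∫ y, G y * η Ω y * v y ∂(surfaceMeasure Ω)) -
        Sc (∫ y in Ω, G y * diracSub T' v y) = r := by
    intro r hr
    have h1 := tendsto_nhds_unique hlim' (tendsto_const_nhds (x := -r) |>.congr'
      (hr.mono fun k hk => by simp only [hk]))
    rw [h.integral_mul_η_mul hGf hvf, sc_sum]
    simp only [map_neg, scL_apply, Finset.sum_neg_distrib] at h1
    linarith
  refine ⟨h.integrable_mul_η_mul hGf hvf, hint, fun hxΩ => hval _ ?_, fun hxc => hval _ ?_⟩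
  · filter_upwards [hχ.eventually_eq_one {x} (singleton_subset_iff.2 hxΩ) isCompact_singleton]
      with k hk
    rw [hk x rfl, one_mul]
  · refine Eventually.of_forall fun k => ?_
    rw [eq_zero_of_notMem (hχ.tsupport_subset k) fun hxΩ => hxc (subset_closure hxΩ), zero_mul]

/-- Invariance under conjugation and cyclicity of `Sc` move `α` from one side of `v̄` to the other.
This adjointness is why a fundamental solution for one operator recovers functions from the other.
-/
theorem sc_star_conjMul_mul (α G v : E n → Cl n) (y : E n) :
    Sc (star (conjMul α (fun y => -star (G y)) y) * v y) = -Sc (G y * mulConj α v y) := by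
  rw [← sc_star]
  simp only [conjMul, mulConj, star_neg, star_star, star_mul, neg_mul]
  rw [sc_neg, sc_mul_comm, mul_assoc]

theorem sc_star_mulConj_mul (α G v : E n → Cl n) (y : E n) :
    Sc (star (mulConj α (fun y => -star (G y)) y) * v y) = -Sc (G y * conjMul α v y) := by
  rw [← sc_star]
  simp only [conjMul, mulConj, star_neg, star_star, star_mul, neg_mul, mul_neg]
  rw [sc_neg, ← mul_assoc, sc_mul_comm, ← mul_assoc]

end

end

end Vekua

/-! ### The integral formulas and the two recovery statements together. -/

theorem mainTheorem5 {n : ℕ} (hn : 1 ≤ n) {Ω : Set (E n)} (hΩ : IsBoundedLipschitzDomain Ω)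
    {u v : E n → Cl n} (hu : IsC1Closure Ω u) (hv : IsC1Closure Ω v)
    {α : E n → Cl n} (hα : MemLp α ⊤ (volume.restrict Ω)) :
    -- the two integral formulas; all the integrals converge absolutely
    (Integrable (fun y => u y * η Ω y * v y) (surfaceMeasure Ω) ∧
      IntegrableOn (fun y => u y * diracSub (mulConj α) v y
        - diracSub (conjMul α) (fun z => star (u z)) y * star (v y)) Ω ∧
      IntegrableOn (fun y => u y * diracSub (conjMul α) v y
        - diracSub (mulConj α) (fun z => star (u z)) y * star (v y)) Ω ∧
      Sc (∫ y, u y * η Ω y * v y ∂(surfaceMeasure Ω)) =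
        Sc (∫ y in Ω, (u y * diracSub (mulConj α) v y
          - diracSub (conjMul α) (fun z => star (u z)) y * star (v y))) ∧
      Sc (∫ y, u y * η Ω y * v y ∂(surfaceMeasure Ω)) =
        Sc (∫ y in Ω, (u y * diracSub (conjMul α) v y
          - diracSub (mulConj α) (fun z => star (u z)) y * star (v y)))) ∧
    -- recovery of the scalar part with a fundamental solution of `D - M^α C`
    (∀ (x : E n) (Φ : E n → Cl n), x ∉ frontier Ω →
      IsFundamentalSolution Ω (conjMul α) x (fun y => -star (Φ (y - x))) →
      ContinuousOn (fun y => Φ (y - x)) (closure Ω \ {x}) →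
      (x ∈ Ω → SphereConstraint Ω Φ x) →
      Integrable (fun y => Φ (y - x) * η Ω y * v y) (surfaceMeasure Ω) ∧
      IntegrableOn (fun y => Φ (y - x) * diracSub (mulConj α) v y) Ω ∧
      (x ∈ Ω →
        Sc (∫ y, Φ (y - x) * η Ω y * v y ∂(surfaceMeasure Ω))
          - Sc (∫ y in Ω, Φ (y - x) * diracSub (mulConj α) v y) = Sc (v x)) ∧
      (x ∉ closure Ω →
        Sc (∫ y, Φ (y - x) * η Ω y * v y ∂(surfaceMeasure Ω))
          - Sc (∫ y in Ω, Φ (y - x) * diracSub (mulConj α) v y) = 0)) ∧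
    -- recovery of the scalar part with a fundamental solution of `D - αC`
    (∀ (x : E n) (Ψ : E n → Cl n), x ∉ frontier Ω →
      IsFundamentalSolution Ω (mulConj α) x (fun y => -star (Ψ (y - x))) →
      ContinuousOn (fun y => Ψ (y - x)) (closure Ω \ {x}) →
      (x ∈ Ω → SphereConstraint Ω Ψ x) →
      Integrable (fun y => Ψ (y - x) * η Ω y * v y) (surfaceMeasure Ω) ∧
      IntegrableOn (fun y => Ψ (y - x) * diracSub (conjMul α) v y) Ω ∧
      (x ∈ Ω →
        Sc (∫ y, Ψ (y - x) * η Ω y * v y ∂(surfaceMeasure Ω))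
          - Sc (∫ y in Ω, Ψ (y - x) * diracSub (conjMul α) v y) = Sc (v x)) ∧
      (x ∉ closure Ω →
        Sc (∫ y, Ψ (y - x) * η Ω y * v y ∂(surfaceMeasure Ω))
          - Sc (∫ y in Ω, Ψ (y - x) * diracSub (conjMul α) v y) = 0)) := by
  refine ⟨⟨hΩ.integrable_mul_η_mul (hu.continuousOn.mono frontier_subset_closure)
      (hv.continuousOn.mono frontier_subset_closure),
    integrableOn_green hΩ hu hv ⟨α, hα, Or.inl rfl⟩ ⟨α, hα, Or.inr rfl⟩,
    integrableOn_green hΩ hu hv ⟨α, hα, Or.inr rfl⟩ ⟨α, hα, Or.inl rfl⟩,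
    sc_green_formula_mulConj hΩ hn hu hv hα, sc_green_formula_conjMul hΩ hn hu hv hα⟩, ?_, ?_⟩
  · intro x Φ hx hfs hc _
    exact hfs.recovery (G := fun y => Φ (y - x)) hΩ hn hv ⟨α, hα, Or.inr rfl⟩ ⟨α, hα, Or.inl rfl⟩
      hx hc (fun y => sc_star_conjMul_mul α _ v y)
  · intro x Ψ hx hfs hc _
    exact hfs.recovery (G := fun y => Ψ (y - x)) hΩ hn hv ⟨α, hα, Or.inl rfl⟩ ⟨α, hα, Or.inr rfl⟩
      hx hc (fun y => sc_star_mulConj_mul α _ v y)
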